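/- Let $\mathbb S^2\subset\mathbb R^3$ be the unit sphere with its surface measure $dx$ (total mass $4\pi$), let $P_\ell$ be the Legendre polynomials, and let $p\ge 1$, $L\ge 0$ be integers. For a function $f$ on $[-1,1]$ put $f_\ell := 2\pi\int_{-1}^1 f(z)P_\ell(z)\,dz$, the coefficients of the expansion $f=\sum_\ell f_\ell\frac{2\ell+1}{4\pi}P_\ell$. Let $\{T(x,t)\}$ and $\{Z(x,t)\}$, $(x,t)\in\mathbb S^2\times\mathbb Z$, be jointly measurable random fields on a probability space such that * $T$ is zero-mean Gaussian with isotropic and stationary covariance $\mathbb E[T(x,t)T(y,s)]=\Gamma_0(\langle x,y\rangle,t-s)$; let $C_\ell(\tau)$ be the Legendre coefficients (as above) of $\Gamma_0(\cdot,\tau)$; * $Z$ is a Gaussian spherical white noise: the fields $Z(\cdot,t)$, $t\in\mathbb Z$, are independent, zero-mean Gaussian, with $\mathbb E[Z(x,t)Z(y,t)]=\sum_{\ell\ge0}\frac{2\ell+1}{4\pi}C_{\ell;Z}P_\ell(\langle x,y\rangle)$ and $\sum_\ell\frac{2\ell+1}{4\pi}C_{\ell;Z}<\infty$; * $T$ solves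 the spherical autoregressive equation $T_t=\Phi_1T_{t-1}+\dots+\Phi_pT_{t-p}+Z_t$, where $(\Phi_jf)(x)=\int_{\mathbb S^2}k_j(\langle x,y\rangle)f(y)\,dy$ with $k_j\in L^2[-1,1]$, the equality holding in $L^2(\Omega)$ for every $(x,t)$ and in $L^2(\Omega\times\mathbb S^2)$ for every $t$. Let $\phi_{\ell;j}$ be the Legendre coefficients of $k_j$, and assume: 1. there is $\delta>0$ such that $1-\phi_{\ell;1}z-\dots-\phi_{\ell;p}z^p\ne0$ for all $\ell\ge0$ and all $z\in\mathbb C$ with $|z|\le1+\delta$; 2. $C_{\ell;Z}>0$ for all $\ell\ge0$; 3. $\phi_{\ell;j}=0$ for all $\ell>L$ and $j=1,\dots,p$. Then $k=(k_1,\dots,k_p)'$ has a continuous version on $[-1,1]$, again denoted by $k$. Let $\hat k_N$ be the least squares estimator $$\hat k_N=\arg\min_{\kappa\in\mathcal P_L^p}\ \sum_{t=1}^N\Big\|T_{t+p}-\sum_{j=1}^p\int_{\mathbb S^2}\kappa_j(\langle\cdot,y\rangle)T_{t+p-j}(y)\,dy\Big\|^2_{L^2(\mathbb S^2)},\qquad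 \mathcal P_L=\mathrm{span}\{P_\ell:\ \ell\le L\}$$ (set to $0$ on the event that the minimizer is not unique). Then, as $N\to\infty$, $$\sqrt N\big(\hat k_N(\cdot)-k(\cdot)\big)\Longrightarrow W_p(\cdot)$$ weakly in $C_p[-1,1]$, the space of continuous functions from $[-1,1]$ to $\mathbb R^p$ with the uniform metric, where $W_p$ is the zero-mean Gaussian process with continuous paths and matrix-valued covariance function $$\Gamma_k(z,z')=\sum_{\ell=0}^{L}C_{\ell;Z}\,\Gamma_\ell^{-1}\,\frac{2\ell+1}{16\pi^2}\,P_\ell(z)P_\ell(z'),\qquad \Gamma_\ell=\big(C_\ell(|i-j|)\big)_{i,j=1}^p .$$ -/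

import Mathlib

open MeasureTheory ProbabilityTheory Filter Topology Set
open scoped Polynomial

noncomputable section

namespace SPHAR

/-- The unit sphere `𝕊²` of `ℝ³`. -/
abbrev S2 : Type := Metric.sphere (0 : EuclideanSpace ℝ (Fin 3)) 1

/-- The surface measure `dx` on `𝕊²` (total mass `4π`). -/
def surf : Measure S2 := (volume : Measure (EuclideanSpace ℝ (Fin 3))).toSphere

/-- The standard inner product of two points of the sphere. -/
def dot (x y : S2) : ℝ :=
  inner ℝ (x : EuclideanSpace ℝ (Fin 3)) (y : EuclideanSpace ℝ (Fin 3))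

/-- The Legendre polynomial `P_ℓ`, by Rodrigues' formula. -/
def legendreP (l : ℕ) : ℝ[X] :=
  Polynomial.C (1 / ((2 : ℝ) ^ l * (l.factorial : ℝ))) *
    Polynomial.derivative^[l] ((Polynomial.X ^ 2 - 1) ^ l)

/-- The coefficient `f_ℓ` in the Legendre expansion
`f(z) = ∑ f_ℓ (2ℓ+1)/(4π) P_ℓ(z)` of a function on `[-1,1]`. -/
def legendreCoeff (f : ℝ → ℝ) (l : ℕ) : ℝ :=
  2 * Real.pi * ∫ z in (-1 : ℝ)..1, f z * (legendreP l).eval z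

/-- The isotropic kernel operator `(Φ f)(x) = ∫ k(⟨x,y⟩) f(y) dy`. -/
def kernelOp (k : ℝ → ℝ) (f : S2 → ℝ) (x : S2) : ℝ :=
  ∫ y, k (dot x y) * f y ∂surf

/-- `T` is a zero-mean Gaussian, isotropic and stationary space-time random field on
`𝕊² × ℤ`, with covariance function `Γ₀(⟨x,y⟩, t - s)`. -/
structure IsGaussianIsotropicStationary {Ω : Type*} [MeasurableSpace Ω] (P : Measure Ω)
    (T : S2 → ℤ → Ω → ℝ) (Γ₀ : ℝ → ℤ → ℝ) : Prop where
  measurable : Measurable fun q : Ω × S2 × ℤ => T q.2.1 q.2.2 q.1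
  gaussian : IsGaussianProcess (fun q : S2 × ℤ => T q.1 q.2) P
  mean_zero : ∀ x t, ∫ ω, T x t ω ∂P = 0
  covariance_eq : ∀ x t y s, covariance (T x t) (T y s) P = Γ₀ (dot x y) (t - s)

/-- `Z` is a Gaussian spherical white noise with angular power spectrum `C_{ℓ;Z}`. -/
structure IsSphericalWhiteNoise {Ω : Type*} [MeasurableSpace Ω] (P : Measure Ω)
    (Z : S2 → ℤ → Ω → ℝ) (CZ : ℕ → ℝ) : Prop where
  measurable : Measurable fun q : Ω × S2 × ℤ => Z q.2.1 q.2.2 q.1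
  gaussian : ∀ t, IsGaussianProcess (fun x : S2 => Z x t) P
  mean_zero : ∀ x t, ∫ ω, Z x t ω ∂P = 0
  summable : Summable fun l : ℕ => (2 * (l : ℝ) + 1) / (4 * Real.pi) * CZ l
  covariance_eq : ∀ t x y,
    HasSum (fun l : ℕ => (2 * (l : ℝ) + 1) / (4 * Real.pi) * CZ l * (legendreP l).eval (dot x y))
      (covariance (Z x t) (Z y t) P)
  indep : iIndepFun (fun (t : ℤ) (ω : Ω) (x : S2) => Z x t ω) P

/-- The spherical autoregressive equation of order `p`,
`T_t = Φ_1 T_{t-1} + ⋯ + Φ_p T_{t-p} + Z_t`, where `Φ_{j+1}` (`j : Fin p`) has the square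
integrable kernel `k j`; equality in `L²(Ω)` for every `(x,t)`, and in `L²(Ω × 𝕊²)` for
every `t`. -/
structure IsSPHAR {Ω : Type*} [MeasurableSpace Ω] (P : Measure Ω) (p : ℕ)
    (k : Fin p → ℝ → ℝ) (T Z : S2 → ℤ → Ω → ℝ) : Prop where
  kernel_memLp : ∀ j, MemLp (k j) 2 (volume.restrict (Icc (-1 : ℝ) 1))
  eq_pointwise : ∀ x t, ∀ᵐ ω ∂P,
    T x t ω - ∑ j : Fin p, kernelOp (k j) (fun y => T y (t - ((j : ℤ) + 1)) ω) x - Z x t ω = 0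
  eq_product : ∀ t, ∀ᵐ q : Ω × S2 ∂(P.prod surf),
    T q.2 t q.1 - ∑ j : Fin p, kernelOp (k j) (fun y => T y (t - ((j : ℤ) + 1)) q.1) q.2
      - Z q.2 t q.1 = 0

/-- The associated polynomials `1 - φ_{ℓ;1} z - ⋯ - φ_{ℓ;p} z^p` have no roots in a common
`δ`-enlargement of the closed unit disk. -/
def StationarityCondition {p : ℕ} (k : Fin p → ℝ → ℝ) : Prop :=
  ∃ δ : ℝ, 0 < δ ∧ ∀ (l : ℕ) (z : ℂ), ‖z‖ ≤ 1 + δ →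
    1 - ∑ j : Fin p, ((legendreCoeff (k j) l : ℝ) : ℂ) * z ^ ((j : ℕ) + 1) ≠ 0

/-- The space spanned by the Legendre polynomials of degree at most `L`. -/
def legendreSpan (L : ℕ) : Submodule ℝ ℝ[X] :=
  Submodule.span ℝ (legendreP '' {l | l ≤ L})

/-- The least squares criterion
`∑_{t=1}^N ‖T_{t+p} - ∑_{j=1}^p Φ_j T_{t+p-j}‖²` in `L²(𝕊²)`, for the kernels `κ`. -/
def lsCriterion {Ω : Type*} {p : ℕ} (T : S2 → ℤ → Ω → ℝ) (N : ℕ) (ω : Ω)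
    (κ : Fin p → ℝ[X]) : ℝ :=
  ∑ t ∈ Finset.Icc 1 N, ∫ x, (T x ((t : ℤ) + p) ω -
    ∑ j : Fin p, kernelOp (fun z => (κ j).eval z)
      (fun y => T y ((t : ℤ) + p - ((j : ℤ) + 1)) ω) x) ^ 2 ∂surf

/-- `κ` minimizes the least squares criterion over the `p`-fold product of `legendreSpan L`. -/
def IsLSMinimizer {Ω : Type*} {p : ℕ} (T : S2 → ℤ → Ω → ℝ) (L N : ℕ) (ω : Ω)
    (κ : Fin p → ℝ[X]) : Prop :=
  (∀ j, κ j ∈ legendreSpan L) ∧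
    ∀ κ' : Fin p → ℝ[X], (∀ j, κ' j ∈ legendreSpan L) →
      lsCriterion T N ω κ ≤ lsCriterion T N ω κ'

open Classical in
/-- The least squares kernel estimator: the minimizer of the criterion (and `0` on the event
that there is no unique minimizer). -/
def kernelEstimator {Ω : Type*} (p : ℕ) (T : S2 → ℤ → Ω → ℝ) (L N : ℕ) (ω : Ω) :
    Fin p → ℝ[X] :=
  if h : ∃! κ : Fin p → ℝ[X], IsLSMinimizer T L N ω κ then h.choose else 0

/-- `C_p[-1,1]`, the continuous functions from `[-1,1]` to `ℝ^p` with the uniform metric. -/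
abbrev Cp (p : ℕ) : Type := C(Icc (-1 : ℝ) 1, EuclideanSpace ℝ (Fin p))

instance instMeasurableSpaceCp (p : ℕ) : MeasurableSpace (Cp p) := borel _

instance instBorelSpaceCp (p : ℕ) : BorelSpace (Cp p) := ⟨rfl⟩

/-- A vector of polynomials as an element of `C_p[-1,1]`. -/
def toCp {p : ℕ} (κ : Fin p → ℝ[X]) : Cp p where
  toFun z := WithLp.toLp 2 fun j => (κ j).eval (z : ℝ)
  continuous_toFun := by fun_prop

/-- The autocovariance matrix `Γ_ℓ`, with entries `C_ℓ(|i - j|)`, where `C_ℓ(τ)` are the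
Legendre coefficients of the covariance function `Γ₀(·, τ)`. -/
def autocovMatrix (p : ℕ) (Γ₀ : ℝ → ℤ → ℝ) (l : ℕ) : Matrix (Fin p) (Fin p) ℝ :=
  Matrix.of fun i j => legendreCoeff (fun z => Γ₀ z |(i : ℤ) - (j : ℤ)|) l

/-- The limit covariance
`∑_{ℓ ≤ L} C_{ℓ;Z} Γ_ℓ⁻¹ (2ℓ+1)/(16π²) P_ℓ(z) P_ℓ(z')`. -/
def limitCov (p L : ℕ) (CZ : ℕ → ℝ) (Γ₀ : ℝ → ℤ → ℝ) (z z' : ℝ) : Matrix (Fin p) (Fin p) ℝ :=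
  ∑ l ∈ Finset.range (L + 1),
    (CZ l * ((2 * (l : ℝ) + 1) / (16 * Real.pi ^ 2)) *
      (legendreP l).eval z * (legendreP l).eval z') • (autocovMatrix p Γ₀ l)⁻¹

/-- Under the law `μ` on `C_p[-1,1]`, the coordinate process is a zero-mean Gaussian process
with covariance function `K`. -/
structure IsCenteredGaussianLaw {p : ℕ} (μ : ProbabilityMeasure (Cp p))
    (K : ℝ → ℝ → Matrix (Fin p) (Fin p) ℝ) : Prop where
  gaussian : IsGaussianProcess (fun (z : Icc (-1 : ℝ) 1) (f : Cp p) => f z) (μ : Measure (Cp p))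
  mean_zero : ∀ z, ∫ f : Cp p, f z ∂(μ : Measure (Cp p)) = 0
  covariance_eq : ∀ (z z' : Icc (-1 : ℝ) 1) (i j : Fin p),
    covariance (fun f : Cp p => f z i) (fun f : Cp p => f z' j) (μ : Measure (Cp p)) = K z z' i j

end SPHAR

end

noncomputable section

namespace SPHAR
open Polynomial

/-! ### Legendre polynomials -/

/-! Isotropic kernels are diagonal in spherical harmonics. By the Funk–Hecke formula (`funkHecke`,
resting on the hat-box theorem `map_dot_surf`) the operator `Φ_j` multiplies every harmonic of
degree `ℓ` by `φ_{ℓ;j}`. Integrating the field equation against an orthonormal basis of harmonics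
therefore gives, for each `ℓ`, `2ℓ+1` scalar AR(p) sequences with the same coefficients,
autocovariance `C_ℓ` and innovation variance `C_{ℓ;Z}` (`IsSPHAR.ae_coeff_eq`). Since only degrees
up to `L` enter the kernels, these agree almost everywhere with polynomials (`ae_eq_sum_legendreP`),
and by Pythagoras the least squares criterion is a term free of the kernels plus one ordinary
regression per degree (`exists_lsCriterion_eq`). Whenever the Gram matrices `G_ℓ` of the regressors
are invertible, the error in degree `ℓ` is `G_ℓ⁻¹ S_ℓ`, where the score `S_ℓ` pairs the regressors
with the noise (`IsSPHAR.ae_lsCoeff_eq`).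

The asymptotics have three ingredients. Causality: the companion matrix of a stable autoregression
has spectral radius below one, and the coefficients of the field have constant second moments, so
they are functionals of the past noise (`mem_of_innovation_mem`,
`IsSPHAR.aestronglyMeasurable_coeff`). Hence the present noise is independent of the past field;
this gives the Yule–Walker equations, the decay of `C_ℓ(τ)` and the positive definiteness of `Γ_ℓ`
(`IsSPHAR.posDef_autocovMatrix`). Law of large numbers: for Gaussian sequences the covariance of
squares is twice the squared covariance, so decaying autocovariances force `N⁻¹ G_ℓ → (2ℓ+1) Γ_ℓ` in
probability (`IsSPHAR.tendsto_gram`). Central limit theorem: given the past, each score increment is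
exactly Gaussian, so the exponential martingale has expectation one and convergence of the quadratic
variation suffices, with no Lindeberg condition (`tendsto_integral_exp_of_indep_gaussian`). The
limit of `N^{-1/2} S_ℓ` has covariance `(2ℓ+1) C_{ℓ;Z} Γ_ℓ`, independently over `ℓ`.

Slutsky's argument combines these. The kernels depend linearly on finitely many coefficients, so
convergence in `C_p[-1,1]` is convergence of a random vector pushed through a continuous linear map,
and no tightness argument is needed. The limit covariance is the sum of the sandwiches `((2ℓ+1)/4π)²
(2ℓ+1)⁻² Γ_ℓ⁻¹ (2ℓ+1) C_{ℓ;Z} Γ_ℓ Γ_ℓ⁻¹`, weighted by `P_ℓ(z) P_ℓ(z')`. -/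

lemma eval_iterate_derivative_eq (u : ℝ[X]) (n : ℕ) (r : ℝ) :
    (derivative^[n] u).eval r = n.factorial * (taylor r u).coeff n := by
  rw [taylor_coeff, ← factorial_smul_hasseDeriv]
  simp

/-- Recentring at the endpoint exhibits the zero of order `l` as a factor `X ^ l`: coefficients
below `l` vanish, which kills boundary terms, and the `l`-th one gives the value of `P_l` at the
endpoint. -/
lemma taylor_one_sq_sub_one_pow (l : ℕ) :
    taylor (1 : ℝ) ((X ^ 2 - 1) ^ l) = (X + C 2) ^ l * X ^ l := by
  rw [taylor_pow, ← mul_pow]; congr 1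
  simp only [map_sub, taylor_pow, taylor_X, taylor_one]
  have : (C (2 : ℝ)) = C 1 + C 1 := by rw [← C_add]; norm_num
  rw [this]; simp; ring

lemma taylor_neg_one_sq_sub_one_pow (l : ℕ) :
    taylor (-1 : ℝ) ((X ^ 2 - 1) ^ l) = (X + C (-2)) ^ l * X ^ l := by
  rw [taylor_pow, ← mul_pow]; congr 1
  simp only [map_sub, taylor_pow, taylor_X, taylor_one]
  have : (C (-2 : ℝ)) = C (-1) + C (-1) := by rw [← C_add]; norm_num
  rw [this]; simp; ring

lemma eval_one_iterate_derivative_of_lt {l n : ℕ} (h : n < l) :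
    (derivative^[n] ((X ^ 2 - 1 : ℝ[X]) ^ l)).eval 1 = 0 := by
  rw [eval_iterate_derivative_eq, taylor_one_sq_sub_one_pow, coeff_mul_X_pow', if_neg (by omega),
    mul_zero]

lemma eval_neg_one_iterate_derivative_of_lt {l n : ℕ} (h : n < l) :
    (derivative^[n] ((X ^ 2 - 1 : ℝ[X]) ^ l)).eval (-1) = 0 := by
  rw [eval_iterate_derivative_eq, taylor_neg_one_sq_sub_one_pow, coeff_mul_X_pow',
    if_neg (by omega), mul_zero]

lemma eval_one_legendreP (l : ℕ) : (legendreP l).eval 1 = 1 := by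
  rw [legendreP, eval_mul, eval_C, eval_iterate_derivative_eq, taylor_one_sq_sub_one_pow,
    coeff_mul_X_pow', if_pos le_rfl, Nat.sub_self, coeff_zero_eq_eval_zero]
  have : (l.factorial : ℝ) ≠ 0 := by positivity
  simp; field_simp

lemma eval_neg_one_legendreP (l : ℕ) : (legendreP l).eval (-1) = (-1) ^ l := by
  rw [legendreP, eval_mul, eval_C, eval_iterate_derivative_eq, taylor_neg_one_sq_sub_one_pow,
    coeff_mul_X_pow', if_pos le_rfl, Nat.sub_self, coeff_zero_eq_eval_zero]
  have : (l.factorial : ℝ) ≠ 0 := by positivity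
  have h2 : ((-2 : ℝ)) ^ l = (-1) ^ l * 2 ^ l := by rw [← mul_pow]; norm_num
  simp [h2]; field_simp

lemma natDegree_legendreP_le (l : ℕ) : (legendreP l).natDegree ≤ l := by
  refine (natDegree_C_mul_le _ _).trans ((natDegree_iterate_derivative _ _).trans ?_)
  have : ((X ^ 2 - 1 : ℝ[X]) ^ l).natDegree ≤ l * 2 := by
    refine natDegree_pow_le.trans (Nat.mul_le_mul_left _ ?_)
    exact (natDegree_sub_le _ _).trans (by simp)
  omega

lemma integral_derivative_mul (u q : ℝ[X]) :
    ∫ z in (-1 : ℝ)..1, (derivative u).eval z * q.eval z =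
      u.eval 1 * q.eval 1 - u.eval (-1) * q.eval (-1) -
        ∫ z in (-1 : ℝ)..1, u.eval z * (derivative q).eval z := by
  rw [eq_sub_iff_add_eq, ← intervalIntegral.integral_add
    (Continuous.intervalIntegrable (by fun_prop) _ _)
    (Continuous.intervalIntegrable (by fun_prop) _ _)]
  exact intervalIntegral.integral_deriv_mul_eq_sub (u := fun z => u.eval z)
    (v := fun z => q.eval z) (fun x _ => u.hasDerivAt x) (fun x _ => q.hasDerivAt x)
    (Continuous.intervalIntegrable (by fun_prop) _ _)
    (Continuous.intervalIntegrable (by fun_prop) _ _)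

/-- Repeated integration by parts, the boundary terms vanishing by assumption. It moves the
derivatives of Rodrigues' formula onto `q`, where they kill low degrees. -/
lemma integral_iterate_derivative_mul (u : ℝ[X]) (n : ℕ)
    (h1 : ∀ k < n, (derivative^[k] u).eval 1 = 0) (h2 : ∀ k < n, (derivative^[k] u).eval (-1) = 0)
    (q : ℝ[X]) :
    ∫ z in (-1 : ℝ)..1, (derivative^[n] u).eval z * q.eval z =
      (-1) ^ n * ∫ z in (-1 : ℝ)..1, u.eval z * (derivative^[n] q).eval z := by
  induction n generalizing q with
  | zero => simp
  | succ n ih =>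
    rw [Function.iterate_succ_apply', integral_derivative_mul, h1 n (by simp), h2 n (by simp),
      ih (fun k hk => h1 k (by omega)) (fun k hk => h2 k (by omega)), ← Function.iterate_succ_apply]
    ring

lemma integral_legendreP_mul_of_natDegree_lt {l : ℕ} {q : ℝ[X]} (hq : q.natDegree < l) :
    ∫ z in (-1 : ℝ)..1, (legendreP l).eval z * q.eval z = 0 := by
  have h := integral_iterate_derivative_mul ((X ^ 2 - 1 : ℝ[X]) ^ l) l
    (fun k hk => eval_one_iterate_derivative_of_lt hk)
    (fun k hk => eval_neg_one_iterate_derivative_of_lt hk) q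
  rw [iterate_derivative_eq_zero hq] at h
  simp only [legendreP, eval_mul, eval_C, mul_assoc, intervalIntegral.integral_const_mul, h]
  simp

lemma integral_legendreP_mul_legendreP_of_ne {l m : ℕ} (h : l ≠ m) :
    ∫ z in (-1 : ℝ)..1, (legendreP l).eval z * (legendreP m).eval z = 0 := by
  rcases lt_or_gt_of_ne h with h | h
  · simp_rw [mul_comm ((legendreP l).eval _)]
    exact integral_legendreP_mul_of_natDegree_lt ((natDegree_legendreP_le l).trans_lt h)
  · exact integral_legendreP_mul_of_natDegree_lt ((natDegree_legendreP_le m).trans_lt h)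

/-- The Euler operator multiplies `X ^ n` by `n`, so subtracting `l` times the polynomial cancels
the top coefficient. -/
lemma natDegree_X_mul_derivative_sub_lt {q : ℝ[X]} {l : ℕ} (hq : q.natDegree ≤ l) (hl : 0 < l) :
    (X * derivative q - C (l : ℝ) * q).natDegree < l := by
  refine lt_of_le_of_lt ((natDegree_le_iff_coeff_eq_zero (n := l - 1)).2 fun n hn => ?_) (by omega)
  obtain ⟨n, rfl⟩ : ∃ k, n = k + 1 := ⟨n - 1, by omega⟩
  rw [coeff_sub, coeff_X_mul, coeff_derivative, coeff_C_mul]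
  rcases eq_or_ne (n + 1) l with h | h
  · rw [← h]; push_cast; ring
  · rw [coeff_eq_zero_of_natDegree_lt (by omega)]; simp

/-- Integrate `P_l' · X P_l` by parts: the boundary contributes 2, and `X P_l'` equals `l P_l`
modulo lower degrees, which are orthogonal to `P_l`. With `I` the integral sought, this reads `2 l I
+ I = 2`. -/
lemma integral_legendreP_sq (l : ℕ) :
    ∫ z in (-1 : ℝ)..1, (legendreP l).eval z * (legendreP l).eval z = 2 / (2 * l + 1) := by
  set I := ∫ z in (-1 : ℝ)..1, (legendreP l).eval z * (legendreP l).eval z with hI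
  set J := ∫ z in (-1 : ℝ)..1, (legendreP l).eval z * (X * derivative (legendreP l)).eval z with hJ
  have h1 : J = l * I := by
    rcases Nat.eq_zero_or_pos l with rfl | hl
    · have : (derivative (legendreP 0)) = 0 := by simp [legendreP]
      simp [hJ, this]
    · have h := integral_legendreP_mul_of_natDegree_lt
        (natDegree_X_mul_derivative_sub_lt (natDegree_legendreP_le l) hl)
      rw [← sub_eq_zero, ← h, hJ, hI, ← intervalIntegral.integral_const_mul,
        ← intervalIntegral.integral_sub]
      · congr 1; ext z; simp; ring
      · exact Continuous.intervalIntegrable (by fun_prop) _ _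
      · exact Continuous.intervalIntegrable (by fun_prop) _ _
  have h2 := integral_derivative_mul (legendreP l) (X * legendreP l)
  have h3 : ∫ z in (-1 : ℝ)..1, (derivative (legendreP l)).eval z * (X * legendreP l).eval z = J := by
    rw [hJ]; congr 1; ext z; simp; ring
  have h4 : ∫ z in (-1 : ℝ)..1, (legendreP l).eval z * (derivative (X * legendreP l)).eval z
      = I + J := by
    rw [hJ, hI, ← intervalIntegral.integral_add]
    · congr 1; ext z; simp; ring
    · exact Continuous.intervalIntegrable (by fun_prop) _ _
    · exact Continuous.intervalIntegrable (by fun_prop) _ _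
  rw [h3, h4] at h2
  simp only [eval_mul, eval_X, eval_one_legendreP, eval_neg_one_legendreP] at h2
  have h5 : ((-1 : ℝ) ^ l) * (-1) ^ l = 1 := by rw [← mul_pow]; simp
  rw [eq_div_iff (by positivity)]
  have h6 : (-1 : ℝ) ^ l * (-1 * (-1) ^ l) = -1 := by linear_combination -h5
  rw [h6] at h2
  linear_combination h2 - 2 * h1

/-- Otherwise `P_l` would have lower degree or be zero, hence be orthogonal to itself, against the
value of its norm. -/
lemma legendreP_coeff_ne_zero (l : ℕ) : (legendreP l).coeff l ≠ 0 := by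
  intro h
  have hd : (legendreP l).natDegree < l ∨ legendreP l = 0 := by
    rcases (natDegree_legendreP_le l).lt_or_eq with h' | h'
    · exact .inl h'
    · right; rw [← leadingCoeff_eq_zero, leadingCoeff, h', h]
  have h0 : ∫ z in (-1 : ℝ)..1, (legendreP l).eval z * (legendreP l).eval z = 0 := by
    rcases hd with hd | hd
    · exact integral_legendreP_mul_of_natDegree_lt hd
    · simp [hd]
  rw [integral_legendreP_sq] at h0
  have : (0 : ℝ) < 2 / (2 * l + 1) := by positivity
  linarith

lemma exists_eq_sum_legendreP (n : ℕ) (q : ℝ[X]) (hq : q.degree < n) :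
    ∃ c : ℕ → ℝ, q = ∑ l ∈ Finset.range n, C (c l) * legendreP l := by
  induction n generalizing q with
  | zero => exact ⟨0, by simpa using hq⟩
  | succ n ih =>
    set a := q.coeff n / (legendreP n).coeff n
    obtain ⟨c, hc⟩ := ih (q - C a * legendreP n) (by
      rw [degree_lt_iff_coeff_zero] at hq ⊢
      intro m hm
      rcases hm.eq_or_lt with rfl | hm
      · simp [a, legendreP_coeff_ne_zero]
      · have := natDegree_legendreP_le n
        rw [coeff_sub, hq m (by omega), coeff_C_mul, coeff_eq_zero_of_natDegree_lt (by omega)]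
        simp)
    refine ⟨Function.update c n a, ?_⟩
    rw [Finset.sum_range_succ, Function.update_self, ← sub_eq_iff_eq_add, hc]
    refine Finset.sum_congr rfl fun l hl => ?_
    rw [Function.update_of_ne (by simp at hl; omega)]

lemma legendreCoeff_sum (n : ℕ) (c : ℕ → ℝ) (l : ℕ) :
    legendreCoeff (fun z => (∑ m ∈ Finset.range n, C (c m) * legendreP m).eval z) l =
      if l < n then 4 * Real.pi / (2 * l + 1) * c l else 0 := by
  have : ∫ z in (-1 : ℝ)..1, (∑ m ∈ Finset.range n, C (c m) * legendreP m).eval z *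
      (legendreP l).eval z = ∑ m ∈ Finset.range n, c m *
        ∫ z in (-1 : ℝ)..1, (legendreP m).eval z * (legendreP l).eval z := by
    simp_rw [eval_finsetSum, Finset.sum_mul, eval_mul, eval_C, mul_assoc]
    rw [intervalIntegral.integral_finsetSum]
    · simp_rw [intervalIntegral.integral_const_mul]
    · intro i _
      exact Continuous.intervalIntegrable (by fun_prop) _ _
  rw [legendreCoeff, this]
  split_ifs with h
  · rw [Finset.sum_eq_single l, integral_legendreP_sq]
    · ring
    · intro m _ hm; rw [integral_legendreP_mul_legendreP_of_ne hm, mul_zero]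
    · simp [h]
  · rw [Finset.sum_eq_zero, mul_zero]
    intro m hm
    rw [integral_legendreP_mul_legendreP_of_ne (by simp at hm; omega), mul_zero]

/-- A polynomial of degree at most `n` is the sum of its Legendre expansion. -/
lemma eq_sum_legendreCoeff {n : ℕ} {q : ℝ[X]} (hq : q.degree < n) :
    q = ∑ l ∈ Finset.range n,
      C ((2 * l + 1) / (4 * Real.pi) * legendreCoeff (fun z => q.eval z) l) * legendreP l := by
  obtain ⟨c, rfl⟩ := exists_eq_sum_legendreP n q hq
  refine Finset.sum_congr rfl fun l hl => ?_
  rw [legendreCoeff_sum, if_pos (by simpa using hl)]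
  have := Real.pi_pos
  congr 2; field_simp

/-- In degree at most `l` only the top Legendre term survives orthogonality to lower degrees;
evaluation at 1 identifies its coefficient. This is how the Funk–Hecke eigenfunctions are
recognized. -/
lemma eq_C_mul_legendreP_of_orthogonal {l : ℕ} {h : ℝ[X]} (hd : h.natDegree ≤ l)
    (ho : ∀ q : ℝ[X], q.natDegree < l → ∫ z in (-1 : ℝ)..1, h.eval z * q.eval z = 0) :
    h = C (h.eval 1) * legendreP l := by
  have h1 := eq_sum_legendreCoeff (n := l + 1) (q := h)
    (by refine lt_of_le_of_lt degree_le_natDegree ?_; exact_mod_cast Nat.lt_succ_of_le hd)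
  rw [Finset.sum_range_succ, Finset.sum_eq_zero, zero_add] at h1
  · have h2 := congrArg (eval 1) h1
    rw [eval_mul, eval_C, eval_one_legendreP, mul_one] at h2
    rw [h2, ← h1]
  · intro m hm
    rw [legendreCoeff, ho _ ((natDegree_legendreP_le m).trans_lt (by simpa using hm))]
    simp

lemma mem_legendreSpan_iff {L : ℕ} {q : ℝ[X]} : q ∈ legendreSpan L ↔ q.natDegree ≤ L := by
  constructor
  · intro hq
    rw [natDegree_le_iff_degree_le, ← mem_degreeLE]
    refine Submodule.span_le.2 ?_ hq
    rintro _ ⟨l, hl, rfl⟩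
    exact mem_degreeLE.2 (natDegree_le_iff_degree_le.1 ((natDegree_legendreP_le l).trans hl))
  · intro hq
    rw [eq_sum_legendreCoeff (n := L + 1) (q := q)
      (by refine lt_of_le_of_lt degree_le_natDegree ?_; exact_mod_cast Nat.lt_succ_of_le hq)]
    refine Submodule.sum_mem _ fun l hl => ?_
    rw [← smul_eq_C_mul]
    exact Submodule.smul_mem _ _ (Submodule.subset_span ⟨l, by simpa [Nat.lt_succ_iff] using hl, rfl⟩)

/-- Weierstrass approximation: uniform closeness is what an integrable weight `f` requires. -/
lemma integral_mul_continuous_eq_zero {f : ℝ → ℝ} (hf : IntegrableOn f (Icc (-1) 1))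
    (h0 : ∀ q : ℝ[X], ∫ z in (-1 : ℝ)..1, f z * q.eval z = 0) {g : ℝ → ℝ} (hg : Continuous g) :
    ∫ z in Icc (-1 : ℝ) 1, f z * g z = 0 := by
  have hq : ∀ q : ℝ[X], ∫ z in Icc (-1 : ℝ) 1, f z * q.eval z = 0 := fun q => by
    rw [← h0 q, intervalIntegral.integral_of_le (by norm_num), integral_Icc_eq_integral_Ioc]
  have hint : ∀ {u : ℝ → ℝ}, Continuous u → IntegrableOn (fun z => f z * u z) (Icc (-1) 1) :=
    fun hu => hf.mul_continuousOn hu.continuousOn isCompact_Icc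
  rw [← abs_nonpos_iff]
  refine le_of_forall_pos_le_add fun ε hε => ?_
  set M := ∫ z in Icc (-1 : ℝ) 1, |f z| with hM
  have hM0 : 0 ≤ M := integral_nonneg fun _ => abs_nonneg _
  -- The `+ 1` keeps the tolerance meaningful when `f` vanishes almost everywhere.
  obtain ⟨q, hqg⟩ := exists_polynomial_near_of_continuousOn (-1) 1 g hg.continuousOn
    (ε / (M + 1)) (by positivity)
  have h1 : ∫ z in Icc (-1 : ℝ) 1, f z * g z =
      ∫ z in Icc (-1 : ℝ) 1, f z * (g z - q.eval z) := by
    simp_rw [mul_sub]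
    rw [integral_sub (hint hg) (hint q.continuous), hq, sub_zero]
  rw [h1]
  calc |∫ z in Icc (-1 : ℝ) 1, f z * (g z - q.eval z)|
      ≤ ∫ z in Icc (-1 : ℝ) 1, |f z * (g z - q.eval z)| := abs_integral_le_integral_abs
    _ ≤ ∫ z in Icc (-1 : ℝ) 1, |f z| * (ε / (M + 1)) := by
      refine setIntegral_mono_on (hint (hg.sub q.continuous)).abs (hf.abs.mul_const _)
        measurableSet_Icc fun z hz => ?_
      rw [abs_mul, abs_sub_comm]
      exact mul_le_mul_of_nonneg_left (hqg z hz).le (abs_nonneg _)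
    _ = M * (ε / (M + 1)) := by rw [integral_mul_const]
    _ ≤ 0 + ε := by
      rw [zero_add, mul_div_assoc', div_le_iff₀ (by positivity)]; nlinarith

lemma ae_eq_zero_of_integral_mul_eval_eq_zero {f : ℝ → ℝ} (hf : IntegrableOn f (Icc (-1) 1))
    (h0 : ∀ q : ℝ[X], ∫ z in (-1 : ℝ)..1, f z * q.eval z = 0) :
    ∀ᵐ z : ℝ, z ∈ Icc (-1 : ℝ) 1 → f z = 0 := by
  have h := ae_eq_zero_of_integral_contDiff_smul_eq_zero (μ := (volume : Measure ℝ))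
    (f := (Icc (-1 : ℝ) 1).indicator f)
    ((integrable_indicator_iff measurableSet_Icc).2 hf).locallyIntegrable (fun g hg _ => by
      have := integral_mul_continuous_eq_zero hf h0 hg.continuous
      rw [← integral_indicator measurableSet_Icc] at this
      rw [← this]
      congr 1; ext z
      by_cases hz : z ∈ Icc (-1 : ℝ) 1 <;> simp [hz, mul_comm])
  filter_upwards [h] with z hz hz1
  simpa [hz1] using hz

/-- A square integrable function on `[-1,1]` with finitely many nonzero Legendre coefficients
agrees almost everywhere with a polynomial. -/
lemma ae_eq_sum_legendreP {f : ℝ → ℝ} {L : ℕ}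
    (hf : MemLp f 2 (volume.restrict (Icc (-1 : ℝ) 1)))
    (h : ∀ l, L < l → legendreCoeff f l = 0) :
    ∀ᵐ z : ℝ, z ∈ Icc (-1 : ℝ) 1 → f z = (∑ l ∈ Finset.range (L + 1),
      C ((2 * l + 1) / (4 * Real.pi) * legendreCoeff f l) * legendreP l).eval z := by
  set Q := ∑ l ∈ Finset.range (L + 1),
      C ((2 * l + 1) / (4 * Real.pi) * legendreCoeff f l) * legendreP l with hQ
  have hfi : IntegrableOn f (Icc (-1) 1) := hf.integrable (by norm_num)
  have hQi : IntegrableOn (fun z => Q.eval z) (Icc (-1) 1) :=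
    Q.continuous.continuousOn.integrableOn_compact isCompact_Icc
  have hint : ∀ {u v : ℝ → ℝ}, IntegrableOn v (Icc (-1) 1) → Continuous u →
      IntervalIntegrable (fun z => v z * u z) volume (-1) 1 := fun hv hu => by
    rw [intervalIntegrable_iff_integrableOn_Icc_of_le (by norm_num)]
    exact hv.mul_continuousOn hu.continuousOn isCompact_Icc
  -- `Q` has the same Legendre coefficients as `f`, those beyond `L` being zero for both.
  have h1 : ∀ l, ∫ z in (-1 : ℝ)..1, (f z - Q.eval z) * (legendreP l).eval z = 0 := by
    intro l
    simp_rw [sub_mul]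
    rw [intervalIntegral.integral_sub (hint hfi (legendreP l).continuous)
      (hint hQi (legendreP l).continuous), sub_eq_zero]
    have h2 := legendreCoeff_sum (L + 1)
      (fun l => (2 * l + 1) / (4 * Real.pi) * legendreCoeff f l) l
    have h3 : legendreCoeff (fun z => Q.eval z) l = legendreCoeff f l := by
      rw [hQ, h2]
      split_ifs with h'
      · have := Real.pi_pos
        field_simp
      · rw [h l (by omega)]
    have := Real.pi_pos
    exact (mul_left_cancel₀ (by positivity) h3).symm
  have h2 := ae_eq_zero_of_integral_mul_eval_eq_zero (f := fun z => f z - Q.eval z)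
    (hfi.sub hQi) (fun q => by
      rw [eq_sum_legendreCoeff (n := q.natDegree + 1) (q := q)
        (by refine lt_of_le_of_lt degree_le_natDegree ?_; exact_mod_cast Nat.lt_succ_self _)]
      simp_rw [eval_finsetSum, Finset.mul_sum, eval_mul, eval_C, mul_left_comm _ (_ * _ : ℝ)]
      rw [intervalIntegral.integral_finsetSum]
      · simp_rw [intervalIntegral.integral_const_mul, h1]; simp
      · intro i _
        exact (hint (hfi.sub hQi) (legendreP i).continuous).const_mul _)
  filter_upwards [h2] with z hz hz1
  exact sub_eq_zero.1 (hz hz1)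

/-! ### The surface measure of the sphere -/

abbrev E3 : Type := EuclideanSpace ℝ (Fin 3)

instance : IsFiniteMeasure surf := by unfold surf; infer_instance

instance : surf.IsOpenPosMeasure := by unfold surf; infer_instance

lemma dot_comm (x y : S2) : dot x y = dot y x := real_inner_comm _ _

lemma dot_self (x : S2) : dot x x = 1 := by
  rw [dot, real_inner_self_eq_norm_sq, norm_eq_of_mem_sphere]; norm_num

lemma dot_mem_Icc (x y : S2) : dot x y ∈ Icc (-1 : ℝ) 1 := by
  have := abs_real_inner_le_norm (x : E3) (y : E3)
  rw [norm_eq_of_mem_sphere, norm_eq_of_mem_sphere, one_mul] at this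
  exact abs_le.1 this

@[fun_prop]
lemma Continuous.dot {α : Type*} [TopologicalSpace α] {f g : α → S2} (hf : Continuous f)
    (hg : Continuous g) : Continuous fun a => SPHAR.dot (f a) (g a) := by
  unfold SPHAR.dot; fun_prop

lemma dot_eq_sum (x y : S2) : dot x y = ∑ i, (x : E3) i * (y : E3) i := by
  rw [dot, PiLp.inner_apply]; simp [mul_comm]

/-- The action of a linear isometry on the sphere. -/
def rot (U : E3 ≃ₗᵢ[ℝ] E3) (x : S2) : S2 := ⟨U x, by simp⟩

lemma dot_rot (U : E3 ≃ₗᵢ[ℝ] E3) (x y : S2) : dot (rot U x) (rot U y) = dot x y :=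
  U.inner_map_map _ _

lemma continuous_rot (U : E3 ≃ₗᵢ[ℝ] E3) : Continuous (rot U) := by
  unfold rot; fun_prop

/-- `rot U` as a homeomorphism. -/
def rotHomeo (U : E3 ≃ₗᵢ[ℝ] E3) : S2 ≃ₜ S2 where
  toFun := rot U
  invFun := rot U.symm
  left_inv x := by ext1; simp [rot]
  right_inv x := by ext1; simp [rot]
  continuous_toFun := continuous_rot U
  continuous_invFun := continuous_rot U.symm

open scoped Pointwise in
lemma measurePreserving_rot (U : E3 ≃ₗᵢ[ℝ] E3) : MeasurePreserving (rot U) surf surf := by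
  refine ⟨(continuous_rot U).measurable, ?_⟩
  ext s hs
  rw [Measure.map_apply (continuous_rot U).measurable hs, surf, Measure.toSphere_apply' _ hs,
    Measure.toSphere_apply' _ ((continuous_rot U).measurable hs)]
  congr 1
  rw [← MeasurePreserving.measure_preimage_equiv (f := U.toMeasurableEquiv) U.measurePreserving
    (Ioo (0 : ℝ) 1 • (Subtype.val '' s))]
  · congr 1
    ext v
    simp only [Set.mem_smul, mem_preimage, mem_image]
    constructor
    · rintro ⟨r, hr, _, ⟨x, hx, rfl⟩, rfl⟩
      exact ⟨r, hr, _, ⟨rot U x, hx, rfl⟩, by simp [rot]⟩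
    · rintro ⟨r, hr, _, ⟨x, hx, rfl⟩, h⟩
      replace h : r • x.1 = U v := h
      refine ⟨r, hr, _, ⟨rot U.symm x, ?_, rfl⟩, ?_⟩
      · convert hx; ext1; simp [rot]
      · apply U.injective; simp [rot, h]

lemma integral_comp_rot (U : E3 ≃ₗᵢ[ℝ] E3) (f : S2 → ℝ) :
    ∫ x, f (rot U x) ∂surf = ∫ x, f x ∂surf :=
  (measurePreserving_rot U).integral_comp (rotHomeo U).measurableEmbedding f

/-! ### Coordinate moments and the law of the height on the sphere. -/

/-- Polar coordinates: `v = r x` gives `r ^ n x_i ^ n`, and the radial density `r ^ 2` raises the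
exponent to `n + 2`. -/
lemma integral_volume_eq_integral_surf_mul (g : ℝ → ℝ) (i : Fin 3)
    (n : ℕ) :
    ∫ v : E3, v i ^ n * g ‖v‖ = (∫ x : S2, x.1 i ^ n ∂surf) *
      ∫ r in Ioi (0 : ℝ), r ^ (n + 2) * g r := by
  have h1 : ∫ v : E3, v i ^ n * g ‖v‖ =
      ∫ v : ({(0 : E3)}ᶜ : Set E3), v.1 i ^ n * g ‖v.1‖ ∂(volume.comap Subtype.val) := by
    rw [integral_subtype_comap (measurableSet_singleton _).compl fun v : E3 => v i ^ n * g ‖v‖,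
        restrict_compl_singleton]
  have h2 := (volume : Measure E3).measurePreserving_homeomorphUnitSphereProd.integral_comp
        (Homeomorph.measurableEmbedding _)
        (fun q : S2 × Ioi (0 : ℝ) => (q.1 : E3) i ^ n * (q.2.1 ^ n * g q.2.1))
  rw [integral_prod_mul (fun x : S2 => x.1 i ^ n)
    (fun r : Ioi (0 : ℝ) => r.1 ^ n * g r.1)] at h2
  have h3 := h1.trans (show _ = _ by
    refine Eq.trans ?_ h2
    refine integral_congr_ae (Eventually.of_forall fun v => ?_)
    have hv : ‖v.1‖ ≠ 0 := norm_ne_zero_iff.2 v.2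
    simp only [homeomorphUnitSphereProd_apply_fst_coe, homeomorphUnitSphereProd_apply_snd_coe]
    simp [mul_pow]
    field_simp)
  rw [h3]
  congr 1
  simp only [Measure.volumeIoiPow, ENNReal.ofReal]
  rw [integral_withDensity_eq_integral_smul,
    integral_subtype_comap measurableSet_Ioi
      fun a ↦ Real.toNNReal (a ^ (Module.finrank ℝ E3 - 1)) • (a ^ n * g a),
        setIntegral_congr_fun measurableSet_Ioi fun x hx ↦ ?_]
  · rw [NNReal.smul_def, Real.coe_toNNReal _ (pow_nonneg (mem_Ioi.1 hx).le _)]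
    simp; ring
  · exact (measurable_subtype_coe.pow_const _).real_toNNReal

/-- The Gaussian weight factors over the coordinates; the two free ones contribute `√π` each. -/
lemma integral_pow_mul_exp_neg_norm_sq (n : ℕ) :
    ∫ v : E3, v 2 ^ n * Real.exp (-‖v‖ ^ 2) =
      Real.pi * ∫ t : ℝ, t ^ n * Real.exp (-t ^ 2) := by
  have h1 := (EuclideanSpace.volume_preserving_symm_measurableEquiv_toLp (Fin 3)).symm.integral_comp
    (MeasurableEquiv.measurableEmbedding _) (fun v : E3 => v 2 ^ n * Real.exp (-‖v‖ ^ 2))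
  rw [← h1]
  have h2 := integral_fintype_prod_volume_eq_prod (𝕜 := ℝ) (ι := Fin 3) (E := fun _ => ℝ)
    ![fun t => Real.exp (-t ^ 2), fun t => Real.exp (-t ^ 2),
      fun t => t ^ n * Real.exp (-t ^ 2)]
  have h3 : ∫ t : ℝ, Real.exp (-t ^ 2) = √Real.pi := by simpa using integral_gaussian 1
  simp [Fin.prod_univ_three, h3, Real.mul_self_sqrt Real.pi_pos.le] at h2
  refine Eq.trans ?_ h2
  congr 1; ext v
  simp [EuclideanSpace.norm_sq_eq, Fin.sum_univ_three, Real.exp_add]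
  ring

lemma integral_Ioi_pow_add_two_mul_exp (n : ℕ) :
    ∫ r in Ioi (0 : ℝ), r ^ (n + 2) * Real.exp (-r ^ 2) =
      (n + 1) / 2 * ∫ r in Ioi (0 : ℝ), r ^ n * Real.exp (-r ^ 2) := by
  have h : ∀ m : ℕ, ∫ r in Ioi (0 : ℝ), r ^ m * Real.exp (-r ^ 2) =
      1 / 2 * Real.Gamma ((m + 1) / 2) := fun m => by
    have := integral_rpow_mul_exp_neg_rpow (p := 2) (q := m) (by norm_num)
      (by have : (0 : ℝ) ≤ m := by positivity
          linarith)
    simpa using this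
  rw [h, h]
  have h1 : (((n + 2 : ℕ) : ℝ) + 1) / 2 = (n + 1) / 2 + 1 := by push_cast; ring
  rw [h1, Real.Gamma_add_one (by positivity)]
  ring

lemma integral_Ioi_pow_mul_exp_pos (n : ℕ) :
    0 < ∫ r in Ioi (0 : ℝ), r ^ n * Real.exp (-r ^ 2) := by
  have := integral_rpow_mul_exp_neg_rpow (p := 2) (q := n) (by norm_num)
      (by have : (0 : ℝ) ≤ n := by positivity
          linarith)
  have h2 : ∫ r in Ioi (0 : ℝ), r ^ n * Real.exp (-r ^ 2) = 1 / 2 * Real.Gamma ((n + 1) / 2) := by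
    simpa using this
  rw [h2]
  have := Real.Gamma_pos_of_pos (s := ((n : ℝ) + 1) / 2) (by positivity)
  positivity

/-- One Gaussian integral over space, computed in polar and in Cartesian coordinates. Both sides
contain the same positive half-line integral, the radial one through `Γ(s+1) = s Γ(s)`, and it
cancels. -/
lemma integral_surf_pow (n : ℕ) :
    ∫ x : S2, x.1 2 ^ n ∂surf = 2 * Real.pi * ∫ z in (-1 : ℝ)..1, z ^ n := by
  have h1 := integral_volume_eq_integral_surf_mul (fun r => Real.exp (-r ^ 2)) 2 n
  simp only [] at h1
  rw [integral_pow_mul_exp_neg_norm_sq, integral_Ioi_pow_add_two_mul_exp] at h1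
  have h2 : ∫ t : ℝ, t ^ n * Real.exp (-t ^ 2) =
      (1 + (-1) ^ n) * ∫ r in Ioi (0 : ℝ), r ^ n * Real.exp (-r ^ 2) := by
    rcases Nat.even_or_odd n with hn | hn
    · have := integral_comp_abs (f := fun t : ℝ => t ^ n * Real.exp (-t ^ 2))
      simp only [hn.pow_abs, sq_abs] at this
      rw [this, hn.neg_one_pow]; norm_num
    · have := integral_neg_eq_self (fun t : ℝ => t ^ n * Real.exp (-t ^ 2)) volume
      simp only [hn.neg_pow, neg_sq, neg_mul, integral_neg] at this
      rw [hn.neg_one_pow]; simp; linarith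
  rw [h2] at h1
  have h3 := integral_Ioi_pow_mul_exp_pos n
  have h4 : Real.pi * (1 + (-1) ^ n) = (∫ x : S2, x.1 2 ^ n ∂surf) * ((n + 1) / 2) := by
    apply mul_right_cancel₀ h3.ne'
    linear_combination h1
  rw [integral_pow]
  have h5 : (n : ℝ) + 1 ≠ 0 := by positivity
  field_simp at h4 ⊢
  rw [pow_succ]; simp only [one_pow]
  linear_combination -h4

/-- Equal moments mean equal integrals of polynomials, and polynomials are uniformly dense on the
compact interval carrying both measures. -/
lemma Measure.ext_of_moments {μ ν : Measure ℝ} [IsFiniteMeasure μ] [IsFiniteMeasure ν]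
    (hμ : ∀ᵐ z ∂μ, z ∈ Icc (-1 : ℝ) 1) (hν : ∀ᵐ z ∂ν, z ∈ Icc (-1 : ℝ) 1)
    (h : ∀ n : ℕ, ∫ z, z ^ n ∂μ = ∫ z, z ^ n ∂ν) : μ = ν := by
  have hint : ∀ (μ : Measure ℝ) [IsFiniteMeasure μ], (∀ᵐ z ∂μ, z ∈ Icc (-1 : ℝ) 1) →
      ∀ f : ℝ → ℝ, Continuous f → Integrable f μ := fun μ _ hμ f hf => by
    obtain ⟨C, hC⟩ := isCompact_Icc.exists_bound_of_continuousOn (s := Icc (-1 : ℝ) 1) hf.continuousOn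
    exact Integrable.of_bound hf.aestronglyMeasurable C (hμ.mono fun z hz => hC z hz)
  have hq : ∀ q : ℝ[X], ∫ z, q.eval z ∂μ = ∫ z, q.eval z ∂ν := fun q => by
    simp_rw [Polynomial.eval_eq_sum_range]
    rw [integral_finsetSum _ fun i _ => hint μ hμ _ (by fun_prop),
      integral_finsetSum _ fun i _ => hint ν hν _ (by fun_prop)]
    simp_rw [integral_const_mul, h]
  refine ext_of_forall_integral_eq_of_IsFiniteMeasure fun f => ?_
  rw [← sub_eq_zero, ← abs_nonpos_iff]
  refine le_of_forall_pos_le_add fun ε hε => ?_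
  set M := μ.real univ + ν.real univ with hM
  have hM0 : 0 ≤ M := by positivity
  obtain ⟨q, hqf⟩ := exists_polynomial_near_of_continuousOn (-1) 1 f f.continuous.continuousOn
    (ε / (M + 1)) (by positivity)
  have key : ∀ (μ : Measure ℝ) [IsFiniteMeasure μ], (∀ᵐ z ∂μ, z ∈ Icc (-1 : ℝ) 1) →
      |∫ z, f z ∂μ - ∫ z, q.eval z ∂μ| ≤ ε / (M + 1) * μ.real univ := fun μ _ hμ => by
    rw [← integral_sub (hint μ hμ _ f.continuous) (hint μ hμ _ q.continuous)]
    refine norm_integral_le_of_norm_le_const (f := fun z => f z - q.eval z)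
      (hμ.mono fun z hz => ?_)
    rw [Real.norm_eq_abs, abs_sub_comm]; exact (hqf z hz).le
  have h1 := key μ hμ
  have h2 := key ν hν
  rw [hq] at h1
  have h3 : ε / (M + 1) * M ≤ ε := by
    rw [div_mul_eq_mul_div, div_le_iff₀ (by positivity)]; nlinarith
  rw [abs_le] at *
  constructor <;> linarith [h1.1, h1.2, h2.1, h2.2, mul_add (ε / (M + 1)) (μ.real univ) (ν.real univ)]

/-- The point `(0,0,1)` of the sphere. -/
def north : S2 := ⟨EuclideanSpace.single 2 1, by simp⟩

lemma dot_north (x : S2) : dot x north = x.1 2 := by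
  simp [dot, north, EuclideanSpace.inner_single_right]

/-- For unit vectors `x`, `z` there is an isometry which maps `z` to the north pole and `x` into a
coordinate plane. -/
lemma exists_rot_eq_north (x z : S2) :
    ∃ U : E3 ≃ₗᵢ[ℝ] E3, rot U z = north ∧ (rot U x).1 1 = 0 := by
  obtain ⟨w, hw, hw1⟩ : ∃ w ∈ (Submodule.span ℝ {x.1, z.1})ᗮ, ‖w‖ = 1 := by
    -- Two vectors span at most a plane, so dimension three leaves a common normal, also when they
    -- are collinear.
    have h1 : (Submodule.span ℝ {x.1, z.1})ᗮ ≠ ⊥ := by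
      intro h
      have h2 : Module.finrank ℝ (Submodule.span ℝ {x.1, z.1}) +
          Module.finrank ℝ (Submodule.span ℝ {x.1, z.1})ᗮ = 3 := by
        rw [Submodule.finrank_add_finrank_orthogonal]; simp
      rw [h, finrank_bot] at h2
      have h3 := finrank_span_le_card (R := ℝ) ({x.1, z.1} : Set E3)
      have h4 : ({x.1, z.1} : Set E3).toFinset.card ≤ 2 := by
        rw [Set.toFinset_insert, Set.toFinset_singleton]; exact Finset.card_le_two
      exact absurd (h2.symm.le.trans (h3.trans h4)) (by norm_num)
    obtain ⟨w, hw, hw0⟩ := Submodule.exists_mem_ne_zero_of_ne_bot h1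
    exact ⟨‖w‖⁻¹ • w, Submodule.smul_mem _ _ hw, by simp [norm_smul, hw0]⟩
  rw [Submodule.mem_orthogonal] at hw
  have hwx : inner ℝ w x.1 = 0 := by
    rw [real_inner_comm]; exact hw _ (Submodule.subset_span (by simp))
  have hwz : inner ℝ w z.1 = 0 := by
    rw [real_inner_comm]; exact hw _ (Submodule.subset_span (by simp))
  have hz1 : ‖z.1‖ = 1 := norm_eq_of_mem_sphere z
  obtain ⟨b, hb⟩ := Orthonormal.exists_orthonormalBasis_extension_of_card_eq (𝕜 := ℝ) (E := E3)
    (ι := Fin 3) (by simp) (v := ![0, w, z.1]) (s := {1, 2}) (by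
      constructor
      · rintro ⟨i, hi⟩
        rcases hi with rfl | rfl <;> simp [hw1, hz1]
      · rintro ⟨i, hi⟩ ⟨j, hj⟩ hij
        rcases hi with rfl | rfl <;> rcases hj with rfl | rfl <;>
          simp [hwz, real_inner_comm] at hij ⊢)
  have hb1 : b 1 = w := by simpa using hb 1 (by simp)
  have hb2 : b 2 = z.1 := by simpa using hb 2 (by simp)
  refine ⟨b.repr, ?_, ?_⟩
  · ext1
    simp only [rot, north, ← hb2]
    exact b.repr_self 2
  · simp only [rot, b.repr_apply_apply, hb1, hwx]

/-- The Archimedes hat-box theorem. -/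
lemma map_dot_surf (x : S2) :
    surf.map (dot x) = ENNReal.ofReal (2 * Real.pi) • volume.restrict (Icc (-1 : ℝ) 1) := by
  have hm : Measurable (dot x) := by
    have : Continuous (dot x) := by fun_prop
    exact this.measurable
  have : IsFiniteMeasure (ENNReal.ofReal (2 * Real.pi) • volume.restrict (Icc (-1 : ℝ) 1)) :=
    Measure.smul_finite _ ENNReal.ofReal_ne_top
  refine Measure.ext_of_moments ?_ ?_ fun n => ?_
  · refine (ae_map_iff hm.aemeasurable measurableSet_Icc).2 ?_
    exact Eventually.of_forall fun y => dot_mem_Icc x y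
  · exact Measure.ae_smul_measure (ae_restrict_mem measurableSet_Icc) _
  · rw [integral_map hm.aemeasurable (by fun_prop), integral_smul_measure,
      ENNReal.toReal_ofReal (by positivity), integral_Icc_eq_integral_Ioc,
      ← intervalIntegral.integral_of_le (by norm_num), smul_eq_mul, ← integral_surf_pow]
    -- Rotating `x` to the pole turns `dot x` into the third coordinate.
    obtain ⟨U, hU, -⟩ := exists_rot_eq_north x x
    rw [← integral_comp_rot U (fun y => y.1 2 ^ n)]
    congr 1; ext y
    rw [← dot_north, ← hU, dot_rot, dot_comm]

lemma measurable_dot_left (x : S2) : Measurable (dot x) := by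
  have : Continuous (dot x) := by fun_prop
  exact this.measurable

lemma integral_comp_dot {g : ℝ → ℝ} (x : S2)
    (hg : AEStronglyMeasurable g (volume.restrict (Icc (-1 : ℝ) 1))) :
    ∫ y, g (dot x y) ∂surf = 2 * Real.pi * ∫ z in (-1 : ℝ)..1, g z := by
  rw [← integral_map (f := g) (measurable_dot_left x).aemeasurable, map_dot_surf,
    integral_smul_measure, ENNReal.toReal_ofReal (by positivity), integral_Icc_eq_integral_Ioc,
      ← intervalIntegral.integral_of_le (by norm_num), smul_eq_mul]
  rw [map_dot_surf]
  exact hg.smul_measure _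

lemma ae_comp_dot {r : ℝ → Prop} (x : S2) (h : ∀ᵐ z : ℝ, z ∈ Icc (-1 : ℝ) 1 → r z) :
    ∀ᵐ y ∂surf, r (dot x y) := by
  refine ae_of_ae_map (measurable_dot_left x).aemeasurable ?_
  rw [map_dot_surf]
  exact Measure.ae_smul_measure ((ae_restrict_iff' measurableSet_Icc).2 h) _

lemma surf_real_univ : surf.real univ = 4 * Real.pi := by
  have := integral_comp_dot (g := fun _ => 1) north (by fun_prop)
  simp at this
  rw [this]; ring

/-! ### The Funk–Hecke formula and spherical harmonics -/

lemma measurable_dot : Measurable fun q : S2 × S2 => dot q.1 q.2 := by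
  have : Continuous fun q : S2 × S2 => dot q.1 q.2 := by fun_prop
  exact this.measurable

lemma integrable_of_bounded {f : S2 → ℝ} (hf : Measurable f) {M : ℝ} (h : ∀ x, |f x| ≤ M) :
    Integrable f surf :=
  Integrable.of_bound hf.aestronglyMeasurable M (Eventually.of_forall h)

lemma exists_bound_eval_dot (q : ℝ[X]) : ∃ M, ∀ x y, |q.eval (dot x y)| ≤ M := by
  obtain ⟨C, hC⟩ := isCompact_Icc.exists_bound_of_continuousOn (s := Icc (-1 : ℝ) 1)
    q.continuous.continuousOn
  exact ⟨C, fun x y => hC _ (dot_mem_Icc x y)⟩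

/-- Reflection in the first coordinate. -/
def reflFst : E3 ≃ₗᵢ[ℝ] E3 :=
  LinearIsometryEquiv.piLpCongrRight 2 ![LinearIsometryEquiv.neg ℝ, LinearIsometryEquiv.refl ℝ ℝ,
    LinearIsometryEquiv.refl ℝ ℝ]

lemma reflFst_zero (v : E3) : reflFst v 0 = - v 0 := by simp [reflFst]

lemma reflFst_two (v : E3) : reflFst v 2 = v 2 := by simp [reflFst]

/-- Reflecting the first coordinate preserves the surface measure and changes the sign of the
integrand. -/
lemma integral_coord_pow_eq_zero (g : ℝ → ℝ) (j k : ℕ) (hk : Odd k) :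
    ∫ y : S2, y.1 2 ^ j * y.1 0 ^ k * g (y.1 2) ∂surf = 0 := by
  have h := integral_comp_rot reflFst (fun y : S2 => y.1 2 ^ j * y.1 0 ^ k * g (y.1 2))
  simp only [rot, reflFst_zero, reflFst_two, hk.neg_pow, mul_neg, neg_mul, integral_neg] at h
  linarith

lemma abs_coord_le (y : S2) (i : Fin 3) : |y.1 i| ≤ 1 := by
  have := PiLp.norm_apply_le y.1 i
  rwa [norm_eq_of_mem_sphere] at this

lemma measurable_coord (i : Fin 3) : Measurable fun y : S2 => y.1 i := by
  have : Continuous fun y : S2 => y.1 i := by fun_prop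
  exact this.measurable

lemma integrable_coord_pow {g : ℝ → ℝ} (hg : Measurable g) {M : ℝ} (hM : ∀ z, |g z| ≤ M)
    (j k : ℕ) : Integrable (fun y : S2 => y.1 2 ^ j * y.1 0 ^ k * g (y.1 2)) surf := by
  refine integrable_of_bounded (M := M) ?_ fun y => ?_
  · exact (((measurable_coord 2).pow_const _).mul ((measurable_coord 0).pow_const _)).mul
      (hg.comp (measurable_coord 2))
  · rw [abs_mul, abs_mul, abs_pow, abs_pow]
    have h1 := pow_le_one₀ (n := j) (abs_nonneg _) (abs_coord_le y 2)
    have h2 := pow_le_one₀ (n := k) (abs_nonneg _) (abs_coord_le y 0)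
    calc _ ≤ 1 * 1 * |g (y.1 2)| := by gcongr
      _ ≤ M := by simpa using hM _

open Polynomial in
/-- The zonal convolution of a polynomial with a bounded function is a polynomial. -/
lemma exists_polynomial_integral_pow {g : ℝ → ℝ} (hg : Measurable g) {M : ℝ}
    (hM : ∀ z, |g z| ≤ M) (k : ℕ) :
    ∃ h : ℝ[X], h.natDegree ≤ k ∧
      ∀ x z : S2, ∫ y, dot x y ^ k * g (dot y z) ∂surf = h.eval (dot x z) := by
  set c : ℕ → ℕ → ℝ := fun j i => ∫ y : S2, y.1 2 ^ j * y.1 0 ^ i * g (y.1 2) ∂surf with hc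
  -- The rounding in `(k - j) / 2` is harmless: for odd `k - j` the coefficient `c j (k - j)`
  -- vanishes by reflection.
  refine ⟨∑ j ∈ Finset.range (k + 1), C (k.choose j * c j (k - j)) *
    (X ^ j * (1 - X ^ 2) ^ ((k - j) / 2)), ?_, fun x z => ?_⟩
  · refine natDegree_sum_le_of_forall_le _ _ fun j hj => ?_
    simp only [Finset.mem_range] at hj
    refine (natDegree_C_mul_le _ _).trans (natDegree_mul_le.trans ?_)
    have h1 : ((1 - X ^ 2 : ℝ[X]) ^ ((k - j) / 2)).natDegree ≤ (k - j) / 2 * 2 :=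
      natDegree_pow_le.trans (Nat.mul_le_mul_left _ ((natDegree_sub_le _ _).trans (by simp)))
    rw [natDegree_X_pow]
    omega
  -- With `z` at the pole and the middle coordinate of `x` zero, `dot x y` becomes `s y_2 + u y_0`
  -- with `u ^ 2 = 1 - s ^ 2`. In the binomial expansion only even powers of `u` survive, and these
  -- are polynomials in `s`.
  · obtain ⟨U, hz, hx⟩ := exists_rot_eq_north x z
    set s := dot x z
    set u := (rot U x).1 0
    have hs : (rot U x).1 2 = s := by rw [← dot_north, ← hz, dot_rot]
    have hu : u ^ 2 = 1 - s ^ 2 := by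
      have := dot_self (rot U x)
      rw [dot_eq_sum, Fin.sum_univ_three, hx, hs] at this
      linear_combination this
    have h1 : ∫ y, dot x y ^ k * g (dot y z) ∂surf =
        ∫ y : S2, (s * y.1 2 + u * y.1 0) ^ k * g (y.1 2) ∂surf := by
      rw [← integral_comp_rot U (fun y : S2 => (s * y.1 2 + u * y.1 0) ^ k * g (y.1 2))]
      congr 1; ext y
      rw [← dot_north (rot U y), ← hz, dot_rot, ← dot_rot U x y, dot_eq_sum (rot U x),
        Fin.sum_univ_three, hx, hs, ← dot_north (rot U y), ← hz, dot_rot]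
      congr 2
      ring
    have h2 : ∀ y : S2, (s * y.1 2 + u * y.1 0) ^ k * g (y.1 2) =
        ∑ j ∈ Finset.range (k + 1), (k.choose j * s ^ j * u ^ (k - j)) *
          (y.1 2 ^ j * y.1 0 ^ (k - j) * g (y.1 2)) := fun y => by
      rw [add_pow, Finset.sum_mul]
      refine Finset.sum_congr rfl fun j _ => ?_
      rw [mul_pow, mul_pow]; ring
    rw [h1]
    simp_rw [h2]
    rw [integral_finsetSum _ fun j _ => (integrable_coord_pow hg hM _ _).const_mul _,
      eval_finsetSum]
    refine Finset.sum_congr rfl fun j _ => ?_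
    rw [integral_const_mul]
    simp only [eval_mul, eval_C, eval_pow, eval_sub, eval_one, eval_X]
    change _ * c j (k - j) = _
    rcases Nat.even_or_odd (k - j) with he | ho
    · have : u ^ (k - j) = (1 - s ^ 2) ^ ((k - j) / 2) := by
        rw [← hu, ← pow_mul, Nat.two_mul_div_two_of_even he]
      rw [this]; ring
    · have : c j (k - j) = 0 := integral_coord_pow_eq_zero g _ _ ho
      rw [this]; ring

lemma integrable_eval_dot_mul {g : ℝ → ℝ} (hg : Measurable g) {M : ℝ} (hM : ∀ z, |g z| ≤ M)
    (q : ℝ[X]) (x z : S2) :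
    Integrable (fun y => q.eval (dot x y) * g (dot y z)) surf := by
  obtain ⟨C, hC⟩ := exists_bound_eval_dot q
  refine integrable_of_bounded (M := C * M) ?_ fun y => ?_
  · exact (q.continuous.measurable.comp (measurable_dot_left x)).mul
      (hg.comp (measurable_dot.comp (measurable_id.prodMk measurable_const)))
  · rw [abs_mul]
    exact mul_le_mul (hC _ _) (hM _) (abs_nonneg _) ((abs_nonneg _).trans (hC x y))

open Polynomial in
lemma exists_polynomial_integral_eval {g : ℝ → ℝ} (hg : Measurable g) {M : ℝ}
    (hM : ∀ z, |g z| ≤ M) (q : ℝ[X]) :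
    ∃ h : ℝ[X], h.natDegree ≤ q.natDegree ∧
      ∀ x z : S2, ∫ y, q.eval (dot x y) * g (dot y z) ∂surf = h.eval (dot x z) := by
  choose h hd hh using exists_polynomial_integral_pow hg hM
  refine ⟨∑ k ∈ Finset.range (q.natDegree + 1), C (q.coeff k) * h k, ?_, fun x z => ?_⟩
  · refine natDegree_sum_le_of_forall_le _ _ fun k hk => ?_
    exact (natDegree_C_mul_le _ _).trans ((hd k).trans (by simpa [Nat.lt_succ_iff] using hk))
  · simp_rw [eval_eq_sum_range (p := q), Finset.sum_mul, mul_assoc]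
    rw [integral_finsetSum, eval_finsetSum]
    · refine Finset.sum_congr rfl fun k _ => ?_
      rw [integral_const_mul, hh, eval_mul, eval_C]
    · intro k _
      refine Integrable.const_mul ?_ _
      simpa using integrable_eval_dot_mul hg hM (X ^ k) x z

/-- The Funk–Hecke formula for zonal functions. -/
lemma funkHecke_zonal {g : ℝ → ℝ} (hg : Measurable g) {M : ℝ} (hM : ∀ z, |g z| ≤ M)
    (l : ℕ) (x z : S2) :
    ∫ y, (legendreP l).eval (dot x y) * g (dot y z) ∂surf =
      legendreCoeff g l * (legendreP l).eval (dot x z) := by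
  obtain ⟨h, hd, hh⟩ := exists_polynomial_integral_eval hg hM (legendreP l)
  have h1 : h.eval 1 = legendreCoeff g l := by
    rw [← dot_self north, ← hh, legendreCoeff]
    have := integral_comp_dot (g := fun t => (legendreP l).eval t * g t) north
      ((legendreP l).continuous.measurable.mul hg).aestronglyMeasurable
    simp_rw [mul_comm ((legendreP l).eval _)] at this
    rw [← this]
    simp_rw [dot_comm _ north, mul_comm]
  -- Convolution with `g` is symmetric and does not raise degrees, so the image of `P_l` has degree
  -- at most `l` and is still orthogonal to all lower degrees. Fubini transfers the operator onto
  -- the test polynomial.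
  have h2 : h = Polynomial.C (h.eval 1) * legendreP l := by
    refine eq_C_mul_legendreP_of_orthogonal (hd.trans (natDegree_legendreP_le l)) fun q hq => ?_
    have hpi := Real.pi_pos
    have h3 := integral_comp_dot (g := fun t => h.eval t * q.eval t) north (by fun_prop)
    refine (mul_eq_zero.1 (h3.symm.trans ?_)).resolve_left (by positivity)
    obtain ⟨h', hd', hh'⟩ := exists_polynomial_integral_eval hg hM q
    obtain ⟨C₁, hC₁⟩ := exists_bound_eval_dot (legendreP l)
    obtain ⟨C₂, hC₂⟩ := exists_bound_eval_dot q
    calc ∫ z, h.eval (dot north z) * q.eval (dot north z) ∂surf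
        = ∫ z, ∫ y, (legendreP l).eval (dot north y) * g (dot y z) * q.eval (dot north z) ∂surf
            ∂surf := by simp_rw [integral_mul_const, hh]
      _ = ∫ y, ∫ z, (legendreP l).eval (dot north y) * g (dot y z) * q.eval (dot north z) ∂surf
            ∂surf := by
        refine integral_integral_swap (Integrable.of_bound (C := C₁ * M * C₂) ?_ ?_)
        · refine Measurable.aestronglyMeasurable ?_
          refine ((((legendreP l).continuous.measurable.comp (measurable_dot_left north)).comp
            measurable_snd).mul (hg.comp (measurable_dot.comp measurable_swap))).mul
            ((q.continuous.measurable.comp (measurable_dot_left north)).comp measurable_fst)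
        · refine Eventually.of_forall fun w => ?_
          simp only [Function.uncurry, norm_mul, Real.norm_eq_abs]
          have := (abs_nonneg _).trans (hC₁ north north)
          have := (abs_nonneg _).trans (hM 0)
          gcongr
          · exact hC₁ _ _
          · exact hM _
          · exact hC₂ _ _
      _ = ∫ y, (legendreP l).eval (dot north y) * h'.eval (dot north y) ∂surf := by
        congr 1; ext y
        simp_rw [mul_assoc]
        rw [integral_const_mul, ← hh']
        simp_rw [dot_comm y, mul_comm]
      _ = 2 * Real.pi * ∫ t in (-1 : ℝ)..1, (legendreP l).eval t * h'.eval t :=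
        integral_comp_dot (g := fun t => (legendreP l).eval t * h'.eval t) north (by fun_prop)
      _ = 0 := by
        rw [integral_legendreP_mul_of_natDegree_lt (hd'.trans_lt hq), mul_zero]
  rw [hh, h2, Polynomial.eval_mul, Polynomial.eval_C, h1]

/-- The zonal function `y ↦ P_ℓ(⟨x,y⟩)`. -/
def zonal (l : ℕ) (x : S2) : C(S2, ℝ) := ⟨fun y => (legendreP l).eval (dot x y), by fun_prop⟩

/-- The space of spherical harmonics of degree `l`. -/
def harmonicSpace (l : ℕ) : Submodule ℝ C(S2, ℝ) := Submodule.span ℝ (range (zonal l))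

/-- Zonal functions are polynomials of degree at most `l` in the three coordinate functions, so they
lie in the sum of the powers `M ^ k`, `k ≤ l`, of a finitely generated space. -/
lemma finiteDimensional_harmonicSpace (l : ℕ) : FiniteDimensional ℝ (harmonicSpace l) := by
  set c : Fin 3 → C(S2, ℝ) := fun i => ⟨fun y => y.1 i, by fun_prop⟩
  set M : Submodule ℝ C(S2, ℝ) := Submodule.span ℝ (range c)
  have hM : M.FG := Submodule.fg_span (finite_range c)
  set W : Submodule ℝ C(S2, ℝ) := ⨆ k ∈ Finset.range (l + 1), M ^ k
  have hW : W.FG := Submodule.fg_biSup _ _ fun k _ => hM.pow k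
  have : FiniteDimensional ℝ W := Module.Finite.iff_fg.2 hW
  refine Submodule.finiteDimensional_of_le (S₂ := W) (Submodule.span_le.2 ?_)
  rintro _ ⟨x, rfl⟩
  have hx : (∑ i, x.1 i • c i) ∈ M :=
    Submodule.sum_mem _ fun i _ => Submodule.smul_mem _ _ (Submodule.subset_span ⟨i, rfl⟩)
  have h1 : zonal l x = ∑ k ∈ Finset.range (l + 1),
      (legendreP l).coeff k • (∑ i, x.1 i • c i) ^ k := by
    ext y
    simp only [zonal, ContinuousMap.coe_mk, ContinuousMap.coe_sum, Finset.sum_apply,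
      ContinuousMap.coe_smul, Pi.smul_apply, ContinuousMap.coe_pow, Pi.pow_apply, smul_eq_mul, c]
    rw [Polynomial.eval_eq_sum_range' (Nat.lt_succ_of_le (natDegree_legendreP_le l)), dot_eq_sum]
  rw [SetLike.mem_coe, h1]
  refine Submodule.sum_mem _ fun k hk => Submodule.smul_mem _ _ ?_
  exact (le_biSup (fun k => M ^ k) hk) (Submodule.pow_mem_pow _ hx k)

lemma integrable_continuousMap (f : C(S2, ℝ)) : Integrable f surf :=
  f.continuous.integrable_of_hasCompactSupport (HasCompactSupport.of_compactSpace _)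

/-- The Funk–Hecke formula. -/
lemma funkHecke {g : ℝ → ℝ} (hg : Measurable g) {M : ℝ} (hM : ∀ z, |g z| ≤ M)
    {l : ℕ} {Y : C(S2, ℝ)} (hY : Y ∈ harmonicSpace l) (x : S2) :
    ∫ y, g (dot x y) * Y y ∂surf = legendreCoeff g l * Y x := by
  have hint : ∀ Y : C(S2, ℝ), Integrable (fun y => g (dot x y) * Y y) surf := fun Y =>
    (integrable_continuousMap Y).bdd_mul
      (hg.comp (measurable_dot_left x)).aestronglyMeasurable (Eventually.of_forall fun y => hM _)
  induction hY using Submodule.span_induction with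
  | mem Y h =>
    obtain ⟨z, rfl⟩ := h
    simp only [zonal, ContinuousMap.coe_mk]
    rw [dot_comm z x, dot_comm x z, ← funkHecke_zonal hg hM]
    congr 1; ext y
    rw [dot_comm y x, mul_comm]
  | zero => simp
  | add Y Y' _ _ h h' =>
    simp only [ContinuousMap.add_apply, mul_add]
    rw [integral_add (hint Y) (hint Y'), h, h']
  | smul c Y _ h =>
    simp only [ContinuousMap.smul_apply, smul_eq_mul, mul_left_comm _ c]
    rw [integral_const_mul, h]

lemma legendreCoeff_legendreP (l m : ℕ) :
    legendreCoeff (fun z => (legendreP l).eval z) m =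
      if l = m then 4 * Real.pi / (2 * m + 1) else 0 := by
  rw [legendreCoeff]
  split_ifs with h
  · subst h; rw [integral_legendreP_sq]; ring
  · rw [integral_legendreP_mul_legendreP_of_ne h, mul_zero]

/-- A polynomial is unbounded on the line, so it is cut off outside `[-1,1]`, which affects neither
side. -/
lemma funkHecke_polynomial (q : ℝ[X]) {l : ℕ} {Y : C(S2, ℝ)} (hY : Y ∈ harmonicSpace l) (x : S2) :
    ∫ y, q.eval (dot x y) * Y y ∂surf = legendreCoeff (fun z => q.eval z) l * Y x := by
  obtain ⟨C, hC⟩ := isCompact_Icc.exists_bound_of_continuousOn (s := Icc (-1 : ℝ) 1)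
    q.continuous.continuousOn
  have h := funkHecke (g := (Icc (-1 : ℝ) 1).indicator fun z => q.eval z)
    (q.continuous.measurable.indicator measurableSet_Icc) (M := C) (fun z => by
      by_cases hz : z ∈ Icc (-1 : ℝ) 1
      · simpa [hz] using hC z hz
      · simpa [hz] using (norm_nonneg _).trans (hC 0 (by simp))) hY x
  simp_rw [indicator_of_mem (dot_mem_Icc _ _)] at h
  rw [h, legendreCoeff, legendreCoeff]
  congr 2
  refine intervalIntegral.integral_congr fun z hz => ?_
  rw [uIcc_of_le (by norm_num)] at hz
  simp only [indicator_of_mem hz]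

/-- On a zonal generator of degree `l`, Funk–Hecke produces the `m`-th Legendre coefficient of
`P_l`, which is zero; the rest is linearity. -/
lemma integral_mul_eq_zero_of_ne {l m : ℕ} (hlm : l ≠ m) {Y Y' : C(S2, ℝ)}
    (hY : Y ∈ harmonicSpace l) (hY' : Y' ∈ harmonicSpace m) : ∫ y, Y y * Y' y ∂surf = 0 := by
  have hint : ∀ Y : C(S2, ℝ), Integrable (fun y => Y y * Y' y) surf := fun Y =>
    integrable_continuousMap (Y * Y')
  induction hY using Submodule.span_induction with
  | mem Y h =>
    obtain ⟨z, rfl⟩ := h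
    simp only [zonal, ContinuousMap.coe_mk]
    rw [funkHecke_polynomial _ hY', legendreCoeff_legendreP, if_neg hlm, zero_mul]
  | zero => simp
  | add Y Y' _ _ h h' =>
    simp only [ContinuousMap.add_apply, add_mul]
    rw [integral_add (hint _) (hint _), h, h', add_zero]
  | smul c Y _ h =>
    simp only [ContinuousMap.smul_apply, smul_eq_mul, mul_assoc]
    rw [integral_const_mul, h, mul_zero]

/-- A real orthonormal basis of the spherical harmonics of degree `l`, with the addition
formula. -/
lemma exists_orthonormal_harmonics (l : ℕ) :
    ∃ Y : Fin (2 * l + 1) → C(S2, ℝ), (∀ m, Y m ∈ harmonicSpace l) ∧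
      (∀ m m', ∫ y, Y m y * Y m' y ∂surf = if m = m' then 1 else 0) ∧
      ∀ x y, ∑ m, Y m x * Y m y = (2 * l + 1) / (4 * Real.pi) * (legendreP l).eval (dot x y) := by
  have hpi := Real.pi_pos
  have := finiteDimensional_harmonicSpace l
  set ι := (ContinuousMap.toLp (E := ℝ) 2 surf ℝ : C(S2, ℝ) →L[ℝ] Lp ℝ 2 surf) with hι
  have hinj : Function.Injective ι := ContinuousMap.toLp_injective surf
  set V := (harmonicSpace l).map (ι : C(S2, ℝ) →ₗ[ℝ] Lp ℝ 2 surf) with hV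
  set b := stdOrthonormalBasis ℝ V
  have hb : ∀ m, ∃ Y ∈ harmonicSpace l, ι Y = b m := fun m => (b m).2
  choose Y hY hYb using hb
  have hinner : ∀ f g : C(S2, ℝ), inner ℝ (ι f) (ι g) = ∫ y, f y * g y ∂surf := fun f g => by
    rw [hι, ContinuousMap.inner_toLp]
    simp [mul_comm]
  have horth : ∀ m m', ∫ y, Y m y * Y m' y ∂surf = if m = m' then 1 else 0 := fun m m' => by
    rw [← hinner, hYb, hYb, ← Submodule.coe_inner]
    exact orthonormal_iff_ite.1 b.orthonormal m m'
  have hadd : ∀ x y, ∑ m, Y m x * Y m y =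
      (2 * l + 1) / (4 * Real.pi) * (legendreP l).eval (dot x y) := fun x y => by
    have hz : zonal l x ∈ harmonicSpace l := Submodule.subset_span ⟨x, rfl⟩
    -- Reproducing property: by Funk–Hecke the inner product of the zonal function with `Y m` is a
    -- multiple of `Y m x`, so its expansion in the basis is already the addition formula.
    have h1 : zonal l x = ∑ m, (4 * Real.pi / (2 * l + 1) * Y m x) • Y m := by
      apply hinj
      have h2 := congrArg Subtype.val (b.sum_repr' ⟨ι (zonal l x), Submodule.mem_map_of_mem hz⟩)
      rw [map_sum]
      simp only [map_smul, hYb]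
      refine h2.symm.trans ?_
      rw [Submodule.coe_sum]
      refine Finset.sum_congr rfl fun m _ => ?_
      rw [Submodule.coe_smul, Submodule.coe_inner, ← hYb, hinner]
      congr 1
      have := funkHecke_polynomial (legendreP l) (hY m) x
      rw [legendreCoeff_legendreP, if_pos rfl] at this
      rw [← this]
      simp only [zonal, ContinuousMap.coe_mk, mul_comm]
    have h3 := congrArg (fun f : C(S2, ℝ) => f y) h1
    simp only [zonal, ContinuousMap.coe_mk, ContinuousMap.coe_sum, Finset.sum_apply,
      ContinuousMap.coe_smul, Pi.smul_apply, smul_eq_mul, mul_assoc] at h3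
    rw [← Finset.mul_sum] at h3
    rw [h3]
    field_simp
  -- The dimension follows from integrating the addition formula over the diagonal: the left side
  -- counts the basis, the right side is constant with total mass `2l+1`.
  have hdim : Module.finrank ℝ V = 2 * l + 1 := by
    have h1 : ∫ x, ∑ m, Y m x * Y m x ∂surf = Module.finrank ℝ V := by
      rw [integral_finsetSum]
      · simp [horth]
      · exact fun m _ => integrable_continuousMap (Y m * Y m)
    simp only [hadd, dot_self, eval_one_legendreP, integral_const, surf_real_univ, smul_eq_mul]
      at h1
    have h2 : ((Module.finrank ℝ V : ℕ) : ℝ) = ((2 * l + 1 : ℕ) : ℝ) := by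
      rw [← h1]; push_cast; field_simp
    exact_mod_cast h2
  refine ⟨fun m => Y (finCongr hdim.symm m), fun m => hY _, fun m m' => ?_, fun x y => ?_⟩
  · rw [horth]; simp
  · rw [← hadd]
    exact Equiv.sum_comp (finCongr hdim.symm) fun m => Y m x * Y m y

/-! ### Gaussian Hilbert spaces -/

section GaussianSpace

variable {Ω : Type*} [mΩ : MeasurableSpace Ω] {P : Measure Ω}

lemma norm_sq_eq_integral (f : Lp ℝ 2 P) : ‖f‖ ^ 2 = ∫ ω, f ω ^ 2 ∂P := by
  rw [← real_inner_self_eq_norm_sq, L2.inner_def]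
  simp [sq]

lemma inner_eq_integral (f g : Lp ℝ 2 P) : inner ℝ f g = ∫ ω, f ω * g ω ∂P := by
  rw [L2.inner_def]; simp [mul_comm]

lemma MemLp.integrable_four {f : Ω → ℝ} (hf : MemLp f 4 P) : Integrable (fun ω => f ω ^ 4) P := by
  have := hf.integrable_norm_pow (p := 4) (by norm_num)
  simpa [Even.pow_abs (show Even 4 by decide)] using this

lemma MemLp.integrable_sq_mul_sq {f g : Ω → ℝ} (hf : MemLp f 4 P) (hg : MemLp g 4 P) :
    Integrable (fun ω => f ω ^ 2 * g ω ^ 2) P := by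
  refine ((MemLp.integrable_four hf).add (MemLp.integrable_four hg)).mono'
    ((hf.1.pow 2).mul (hg.1.pow 2)) (Eventually.of_forall fun ω => ?_)
  rw [Real.norm_of_nonneg (by positivity)]
  simp only [Pi.add_apply]
  nlinarith [sq_nonneg (f ω ^ 2 - g ω ^ 2), sq_nonneg (f ω ^ 2), sq_nonneg (g ω ^ 2)]

variable [IsProbabilityMeasure P]

/-- All elements of `H` are centered Gaussian random variables. -/
def IsGaussianSpace (H : Submodule ℝ (Lp ℝ 2 P)) : Prop :=
  ∀ f ∈ H, ∀ u : ℝ, ∫ ω, Complex.exp ((u * f ω : ℝ) * Complex.I) ∂P =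
    Complex.exp ((-(u ^ 2 * ‖f‖ ^ 2 / 2) : ℝ))

lemma norm_exp_mul_I_sub_le (a b : ℝ) :
    ‖Complex.exp (a * Complex.I) - Complex.exp (b * Complex.I)‖ ≤ |a - b| := by
  have h : Complex.exp (a * Complex.I) - Complex.exp (b * Complex.I) =
      Complex.exp (b * Complex.I) * (Complex.exp (Complex.I * (a - b : ℝ)) - 1) := by
    rw [mul_sub, ← Complex.exp_add, mul_one]; congr 2; push_cast; ring
  rw [h, norm_mul, Complex.norm_exp_ofReal_mul_I, one_mul]
  exact Real.norm_exp_I_mul_ofReal_sub_one_le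

/-- Nonnegativity of the variance of `|f|`, since `P` has mass one. -/
lemma integral_abs_le_norm (f : Lp ℝ 2 P) : ∫ ω, |f ω| ∂P ≤ ‖f‖ := by
  have hf : MemLp f 2 P := Lp.memLp f
  have h := variance_nonneg (fun ω => |f ω|) P
  rw [variance_eq_sub (X := fun ω => |f ω|) hf.abs] at h
  simp only [Pi.pow_apply, sq_abs] at h
  rw [← norm_sq_eq_integral] at h
  exact abs_le_of_sq_le_sq' (by linarith) (norm_nonneg _) |>.2

lemma integrable_exp_mul_I {X : Ω → ℝ} (hX : AEStronglyMeasurable X P) :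
    Integrable (fun ω => Complex.exp ((X ω : ℝ) * Complex.I)) P := by
  refine Integrable.of_bound (C := 1) ?_ (Eventually.of_forall fun ω => ?_)
  · exact Complex.continuous_exp.comp_aestronglyMeasurable
      ((Complex.continuous_ofReal.comp_aestronglyMeasurable hX).mul_const _)
  · rw [Complex.norm_exp_ofReal_mul_I]

/-- The map `x ↦ exp (i u x)` is `|u|`-Lipschitz and the `L¹` norm is at most the `L²` norm. This
makes being centered Gaussian a closed condition in `L²`, so Gaussian spaces may be closed up. -/
lemma continuous_integral_exp (u : ℝ) : Continuous fun f : Lp ℝ 2 P =>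
    ∫ ω, Complex.exp ((u * f ω : ℝ) * Complex.I) ∂P := by
  refine LipschitzWith.continuous (K := ⟨|u|, abs_nonneg _⟩) (LipschitzWith.of_dist_le_mul fun f g => ?_)
  have hm : ∀ f : Lp ℝ 2 P, AEStronglyMeasurable (fun ω => u * f ω) P := fun f =>
    (Lp.aestronglyMeasurable f).const_mul u
  rw [dist_eq_norm, dist_eq_norm, ← integral_sub (integrable_exp_mul_I (hm f))
    (integrable_exp_mul_I (hm g))]
  calc _ ≤ ∫ ω, |u| * |(f - g : Lp ℝ 2 P) ω| ∂P := by
        refine norm_integral_le_of_norm_le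
          (((Lp.memLp (f - g)).integrable (by norm_num)).abs.const_mul _) ?_
        filter_upwards [Lp.coeFn_sub f g] with ω hω
        refine (norm_exp_mul_I_sub_le _ _).trans ?_
        rw [← mul_sub, abs_mul, hω, Pi.sub_apply]
    _ ≤ |u| * ‖f - g‖ := by
        rw [integral_const_mul]
        exact mul_le_mul_of_nonneg_left (integral_abs_le_norm _) (abs_nonneg _)

lemma IsGaussianSpace.topologicalClosure {H : Submodule ℝ (Lp ℝ 2 P)} (hH : IsGaussianSpace H) :
    IsGaussianSpace H.topologicalClosure := by
  intro f hf u
  have hclosed : IsClosed {f : Lp ℝ 2 P | ∫ ω, Complex.exp ((u * f ω : ℝ) * Complex.I) ∂P =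
      Complex.exp ((-(u ^ 2 * ‖f‖ ^ 2 / 2) : ℝ))} :=
    isClosed_eq (continuous_integral_exp u) (by fun_prop)
  exact closure_minimal (fun g hg => hH g hg u) hclosed hf

lemma IsGaussianSpace.map_eq {H : Submodule ℝ (Lp ℝ 2 P)} (hH : IsGaussianSpace H)
    {f : Lp ℝ 2 P} (hf : f ∈ H) : P.map f = gaussianReal 0 (‖f‖ ^ 2).toNNReal := by
  have hm : AEMeasurable f P := (Lp.aestronglyMeasurable f).aemeasurable
  have := Measure.isProbabilityMeasure_map (μ := P) hm
  refine Measure.ext_of_charFun ?_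
  ext u
  rw [charFun_gaussianReal, charFun_apply_real, integral_map hm (by fun_prop)]
  have := hH f hf u
  push_cast at this ⊢
  rw [this, Real.coe_toNNReal _ (by positivity)]
  congr 1
  simp
  ring

/-- Fourth derivative at zero of the moment generating function; `hd` differentiates a polynomial
times the Gaussian exponential symbolically. -/
lemma integral_pow_four_gaussianReal (v : NNReal) :
    ∫ x, x ^ 4 ∂gaussianReal 0 v = 3 * (v : ℝ) ^ 2 := by
  have h := iteratedDeriv_mgf_zero (X := id) (μ := gaussianReal 0 v)
    (by rw [integrableExpSet_id_gaussianReal]; simp) 4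
  have hd : ∀ q : ℝ[X], deriv (fun t : ℝ => q.eval t * Real.exp (v * t ^ 2 / 2)) =
      fun t => (Polynomial.derivative q + Polynomial.C (v : ℝ) * Polynomial.X * q).eval t *
        Real.exp (v * t ^ 2 / 2) := fun q => by
    ext t
    have h1 : HasDerivAt (fun t : ℝ => (v : ℝ) * t ^ 2 / 2) (v * t) t := by
      have := ((hasDerivAt_pow 2 t).const_mul (v : ℝ)).div_const 2
      convert! this using 1
      simp; ring
    have h2 := (q.hasDerivAt t).mul h1.exp
    refine h2.deriv.trans ?_
    simp; ring
  have h0 : mgf id (gaussianReal 0 v) = fun t : ℝ =>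
      (1 : ℝ[X]).eval t * Real.exp (v * t ^ 2 / 2) := by
    rw [mgf_id_gaussianReal]; simp
  rw [h0] at h
  simp only [iteratedDeriv_succ, iteratedDeriv_zero, hd] at h
  simp at h
  rw [← h]; ring

lemma IsGaussianSpace.integrable_pow_four {H : Submodule ℝ (Lp ℝ 2 P)} (hH : IsGaussianSpace H)
    {f : Lp ℝ 2 P} (hf : f ∈ H) : MemLp f 4 P := by
  have hm : AEMeasurable f P := (Lp.aestronglyMeasurable f).aemeasurable
  have h := memLp_id_gaussianReal' (μ := 0) (v := (‖f‖ ^ 2).toNNReal) 4 (by norm_num)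
  rw [← hH.map_eq hf] at h
  exact (memLp_map_measure_iff (by fun_prop) hm).1 h

lemma IsGaussianSpace.integral_pow_four {H : Submodule ℝ (Lp ℝ 2 P)} (hH : IsGaussianSpace H)
    {f : Lp ℝ 2 P} (hf : f ∈ H) : ∫ ω, f ω ^ 4 ∂P = 3 * ‖f‖ ^ 4 := by
  have hm : AEMeasurable f P := (Lp.aestronglyMeasurable f).aemeasurable
  have h := integral_pow_four_gaussianReal (‖f‖ ^ 2).toNNReal
  rw [← hH.map_eq hf, integral_map hm (by fun_prop)] at h
  rw [h, Real.coe_toNNReal _ (by positivity)]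
  ring

/-- Isserlis' formula by polarization: `(f+g)⁴ + (f-g)⁴ = 2f⁴ + 12f²g² + 2g⁴`, and all four fourth
powers are of single elements of the Gaussian space. -/
lemma IsGaussianSpace.integral_sq_mul_sq {H : Submodule ℝ (Lp ℝ 2 P)} (hH : IsGaussianSpace H)
    {f g : Lp ℝ 2 P} (hf : f ∈ H) (hg : g ∈ H) :
    ∫ ω, f ω ^ 2 * g ω ^ 2 ∂P = ‖f‖ ^ 2 * ‖g‖ ^ 2 + 2 * inner ℝ f g ^ 2 := by
  have h1 := hH.integral_pow_four (H.add_mem hf hg)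
  have h2 := hH.integral_pow_four (H.sub_mem hf hg)
  have h3 := hH.integral_pow_four hf
  have h4 := hH.integral_pow_four hg
  have i1 := MemLp.integrable_four (hH.integrable_pow_four (H.add_mem hf hg))
  have i2 := MemLp.integrable_four (hH.integrable_pow_four (H.sub_mem hf hg))
  have i3 := MemLp.integrable_four (hH.integrable_pow_four hf)
  have i4 := MemLp.integrable_four (hH.integrable_pow_four hg)
  have n1 := norm_add_sq_real f g
  have n2 := norm_sub_sq_real f g
  have h5 : ∫ ω, f ω ^ 2 * g ω ^ 2 ∂P = (1 / 12) * (∫ ω, (f + g : Lp ℝ 2 P) ω ^ 4 ∂P +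
      ∫ ω, (f - g : Lp ℝ 2 P) ω ^ 4 ∂P - 2 * ∫ ω, f ω ^ 4 ∂P - 2 * ∫ ω, g ω ^ 4 ∂P) := by
    rw [← integral_const_mul 2, ← integral_const_mul 2, ← integral_add i1 i2]
    erw [← integral_sub (i1.add i2) (i3.const_mul 2),
      ← integral_sub ((i1.add i2).sub (i3.const_mul 2)) (i4.const_mul 2)]
    rw [← integral_const_mul]
    refine integral_congr_ae ?_
    filter_upwards [Lp.coeFn_sub f g, Lp.coeFn_add f g] with ω ha hb
    simp only [ha, hb, Pi.sub_apply, Pi.add_apply]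
    ring
  rw [h5, h1, h2, h3, h4]
  have e1 : ‖f + g‖ ^ 4 = (‖f‖ ^ 2 + 2 * inner ℝ f g + ‖g‖ ^ 2) ^ 2 := by rw [← n1]; ring
  have e2 : ‖f - g‖ ^ 4 = (‖f‖ ^ 2 - 2 * inner ℝ f g + ‖g‖ ^ 2) ^ 2 := by rw [← n2]; ring
  rw [e1, e2]
  ring

/-- For fixed `m` each distance occurs at most once among `n ≤ m` and once among `n > m`; hence the
factor 2. -/
lemma sum_sum_dist_le (c : ℕ → ℝ) (hc : ∀ k, 0 ≤ c k) (N : ℕ) :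
    ∑ m ∈ Finset.range N, ∑ n ∈ Finset.range N, c (Int.natAbs ((m : ℤ) - n)) ≤
      N * (2 * ∑ k ∈ Finset.range N, c k) := by
  rw [← nsmul_eq_mul, ← Finset.card_range N]
  simp only [Finset.card_range]
  conv_rhs => rw [← Finset.card_range N]
  refine (Finset.sum_le_card_nsmul _ _ _ fun m hm => ?_)
  simp only [Finset.card_range]
  rw [← Finset.sum_filter_add_sum_filter_not _ (fun n => n ≤ m), two_mul]
  have key : ∀ s : Finset ℕ, s ⊆ Finset.range N →
      Set.InjOn (fun n : ℕ => Int.natAbs ((m : ℤ) - n)) s →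
      ∑ n ∈ s, c (Int.natAbs ((m : ℤ) - n)) ≤ ∑ k ∈ Finset.range N, c k := fun s hs hinj => by
    rw [← Finset.sum_image (f := c) (g := fun n : ℕ => Int.natAbs ((m : ℤ) - n)) hinj]
    refine Finset.sum_le_sum_of_subset_of_nonneg (fun k hk => ?_) fun k _ _ => hc k
    obtain ⟨n, hn, rfl⟩ := Finset.mem_image.1 hk
    have := hs hn
    simp only [Finset.mem_range] at *
    omega
  refine add_le_add (key _ (Finset.filter_subset _ _) ?_) (key _ (Finset.filter_subset _ _) ?_)
  · intro a ha b hb hab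
    simp at ha hb hab; omega
  · intro a ha b hb hab
    simp at ha hb hab; omega

lemma tendstoInMeasure_of_tendsto_integral_sq {X : ℕ → Ω → ℝ}
    (hi : ∀ n, Integrable (fun ω => X n ω ^ 2) P)
    (h : Tendsto (fun n => ∫ ω, X n ω ^ 2 ∂P) atTop (𝓝 0)) :
    TendstoInMeasure P X atTop 0 := by
  rw [tendstoInMeasure_iff_measureReal_norm]
  intro ε hε
  have h2 : Tendsto (fun n => (∫ ω, X n ω ^ 2 ∂P) / ε ^ 2) atTop (𝓝 0) := by
    simpa using h.div_const (ε ^ 2)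
  refine tendsto_of_tendsto_of_tendsto_of_le_of_le tendsto_const_nhds h2
    (fun n => measureReal_nonneg) fun n => ?_
  have h3 := mul_meas_ge_le_integral_of_nonneg
    (Eventually.of_forall fun ω => sq_nonneg (X n ω)) (hi n) (ε ^ 2)
  rw [le_div_iff₀ (by positivity), mul_comm]
  refine le_trans (mul_le_mul_of_nonneg_left (measureReal_mono fun ω hω => ?_) (by positivity)) h3
  simp only [mem_ofPred_eq, Pi.zero_apply, sub_zero, Real.norm_eq_abs] at hω ⊢
  rw [← sq_abs (X n ω)]
  exact pow_le_pow_left₀ hε.le hω 2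

/-- The law of large numbers for the squares of a stationary Gaussian sequence whose
autocovariance function tends to zero. -/
lemma IsGaussianSpace.tendsto_average_sq {H : Submodule ℝ (Lp ℝ 2 P)} (hH : IsGaussianSpace H)
    {f : ℕ → Lp ℝ 2 P} (hf : ∀ n, f n ∈ H) {ρ : ℤ → ℝ}
    (hρ : ∀ m n : ℕ, inner ℝ (f m) (f n) = ρ (m - n))
    (hlim : Tendsto (fun n : ℕ => ρ n) atTop (𝓝 0)) :
    TendstoInMeasure P (fun (N : ℕ) ω => (N : ℝ)⁻¹ * ∑ n ∈ Finset.range N, (f n ω ^ 2 - ρ 0)) atTop 0 := by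
  have hnorm : ∀ n, ‖f n‖ ^ 2 = ρ 0 := fun n => by
    rw [← real_inner_self_eq_norm_sq, hρ]; simp
  have h4 := fun n => hH.integrable_pow_four (hf n)
  have hsq : ∀ n, Integrable (fun ω => f n ω ^ 2) P := fun n => (Lp.memLp (f n)).integrable_sq
  have hprod : ∀ m n, Integrable (fun ω => (f m ω ^ 2 - ρ 0) * (f n ω ^ 2 - ρ 0)) P := fun m n => by
    have := (((MemLp.integrable_sq_mul_sq (h4 m) (h4 n)).sub ((hsq m).const_mul (ρ 0))).sub
      ((hsq n).const_mul (ρ 0))).add (integrable_const (ρ 0 ^ 2))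
    refine this.congr (Eventually.of_forall fun ω => ?_)
    simp only [Pi.add_apply, Pi.sub_apply]; ring
  -- In Isserlis' formula the product of variances cancels against the centering.
  have hcov : ∀ m n, ∫ ω, (f m ω ^ 2 - ρ 0) * (f n ω ^ 2 - ρ 0) ∂P =
      2 * ρ (Int.natAbs ((m : ℤ) - n)) ^ 2 := fun m n => by
    have e : ∀ ω, (f m ω ^ 2 - ρ 0) * (f n ω ^ 2 - ρ 0) =
        f m ω ^ 2 * f n ω ^ 2 - ρ 0 * f m ω ^ 2 - ρ 0 * f n ω ^ 2 + ρ 0 ^ 2 := fun ω => by ring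
    simp_rw [e]
    rw [integral_add, integral_sub, integral_sub, integral_const_mul, integral_const_mul,
      ← norm_sq_eq_integral, ← norm_sq_eq_integral, hH.integral_sq_mul_sq (hf m) (hf n), hnorm,
      hnorm, integral_const, hρ]
    · have : ρ (Int.natAbs ((m : ℤ) - n)) = ρ (m - n) := by
        rcases le_total (n : ℤ) m with h | h
        · rw [Int.natAbs_of_nonneg (by omega)]
        · rw [Int.ofNat_natAbs_of_nonpos (by omega), neg_sub, ← hρ, ← hρ, real_inner_comm]
      rw [this]; simp; ring
    · exact MemLp.integrable_sq_mul_sq (h4 m) (h4 n)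
    · exact (hsq m).const_mul _
    · exact (MemLp.integrable_sq_mul_sq (h4 m) (h4 n)).sub ((hsq m).const_mul _)
    · exact (hsq n).const_mul _
    · exact ((MemLp.integrable_sq_mul_sq (h4 m) (h4 n)).sub ((hsq m).const_mul _)).sub
        ((hsq n).const_mul _)
    · exact integrable_const _
  have e : ∀ (N : ℕ) ω, ((N : ℝ)⁻¹ * ∑ n ∈ Finset.range N, (f n ω ^ 2 - ρ 0)) ^ 2 =
      (N : ℝ)⁻¹ ^ 2 * ∑ m ∈ Finset.range N, ∑ n ∈ Finset.range N,
        (f m ω ^ 2 - ρ 0) * (f n ω ^ 2 - ρ 0) := fun N ω => by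
    rw [mul_pow, sq (∑ n ∈ Finset.range N, _), Finset.sum_mul_sum]
  refine tendstoInMeasure_of_tendsto_integral_sq (fun N => ?_) ?_
  · simp_rw [e]
    exact (integrable_finsetSum _ fun m _ => integrable_finsetSum _ fun n _ =>
      hprod m n).const_mul _
  · have hval : ∀ N : ℕ, ∫ ω, ((N : ℝ)⁻¹ * ∑ n ∈ Finset.range N, (f n ω ^ 2 - ρ 0)) ^ 2 ∂P =
        (N : ℝ)⁻¹ ^ 2 * ∑ m ∈ Finset.range N, ∑ n ∈ Finset.range N,
          2 * ρ (Int.natAbs ((m : ℤ) - n)) ^ 2 := fun N => by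
      simp_rw [e]
      rw [integral_const_mul, integral_finsetSum _ fun m _ => integrable_finsetSum _ fun n _ =>
        hprod m n]
      congr 1
      refine Finset.sum_congr rfl fun m _ => ?_
      rw [integral_finsetSum _ fun n _ => hprod m n]
      exact Finset.sum_congr rfl fun n _ => hcov m n
    simp_rw [hval]
    -- The second moment of the average is bounded by a Cesàro mean of `ρ ^ 2`; the 4 is the 2 of
    -- Isserlis times the 2 of `sum_sum_dist_le`.
    have hces : Tendsto (fun N : ℕ => 4 * ((N : ℝ)⁻¹ * ∑ k ∈ Finset.range N, ρ k ^ 2)) atTop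
        (𝓝 0) := by
      have h1 : Tendsto (fun n : ℕ => ρ n ^ 2) atTop (𝓝 0) := by simpa using hlim.pow 2
      simpa using h1.cesaro.const_mul 4
    refine tendsto_of_tendsto_of_tendsto_of_le_of_le tendsto_const_nhds hces (fun N => ?_)
      fun N => ?_
    · exact mul_nonneg (by positivity) (Finset.sum_nonneg fun m _ => Finset.sum_nonneg fun n _ =>
        by positivity)
    · have := sum_sum_dist_le (fun k => 2 * ρ k ^ 2) (fun k => by positivity) N
      rcases Nat.eq_zero_or_pos N with rfl | hN
      · simp
      · have hN' : (0 : ℝ) < N := by exact_mod_cast hN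
        calc _ ≤ (N : ℝ)⁻¹ ^ 2 * (N * (2 * ∑ k ∈ Finset.range N, 2 * ρ k ^ 2)) := by gcongr
          _ = _ := by rw [← Finset.mul_sum]; field_simp; ring

end GaussianSpace

/-! ### Linear functionals of random fields -/

section RandomField

variable {Ω : Type*} [mΩ : MeasurableSpace Ω] {P : Measure Ω}

/-- The closed linear span of a family of square integrable random variables. -/
def closedSpan {ι : Type*} {X : ι → Ω → ℝ} (hX : ∀ i, MemLp (X i) 2 P) :
    Submodule ℝ (Lp ℝ 2 P) :=
  (Submodule.span ℝ (range fun i => (hX i).toLp (X i))).topologicalClosure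

/-- The closed span is the double orthogonal complement. Testing against orthogonal elements makes
Fubini available for integrals of the field. -/
lemma mem_closedSpan_of_forall_inner {ι : Type*} {X : ι → Ω → ℝ} (hX : ∀ i, MemLp (X i) 2 P)
    {f : Lp ℝ 2 P}
    (h : ∀ g : Lp ℝ 2 P, (∀ i, inner ℝ ((hX i).toLp (X i)) g = 0) → inner ℝ g f = 0) :
    f ∈ closedSpan hX := by
  rw [closedSpan, ← Submodule.orthogonal_orthogonal_eq_closure, Submodule.mem_orthogonal]
  intro g hg
  refine h g fun i => ?_
  exact (Submodule.mem_orthogonal _ _).1 hg _ (Submodule.subset_span ⟨i, rfl⟩)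

/-- The classes with an `m`-measurable representative form a closed subspace of `L²`, so it suffices
to check the generators. -/
lemma aestronglyMeasurable_of_mem_closedSpan {Ω : Type*} {m mΩ : MeasurableSpace Ω}
    {P : Measure Ω} {ι : Type*} {X : ι → Ω → ℝ} (hX : ∀ i, MemLp (X i) 2 P) (hm : m ≤ mΩ)
    (hXm : ∀ i, StronglyMeasurable[m] (X i)) {f : Lp ℝ 2 P} (hf : f ∈ closedSpan hX) :
    AEStronglyMeasurable[m] f P := by
  have hcl : IsClosed ((lpMeas ℝ ℝ m 2 P : Submodule ℝ (Lp ℝ 2 P)) : Set (Lp ℝ 2 P)) :=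
    isClosed_aestronglyMeasurable hm
  have : closedSpan hX ≤ lpMeas ℝ ℝ m 2 P := by
    refine Submodule.topologicalClosure_minimal _ (Submodule.span_le.2 ?_) hcl
    rintro _ ⟨i, rfl⟩
    exact ((hXm i).aestronglyMeasurable (μ := P)).congr (MemLp.coeFn_toLp (hX i)).symm
  exact mem_lpMeas_iff_aestronglyMeasurable.1 (this hf)

/-- Finite combinations of a Gaussian process are Gaussian, and for centered variables the variance
is the squared `L²` norm; limits are covered by closedness. -/
lemma isGaussianSpace_closedSpan [IsProbabilityMeasure P] {ι : Type*} {X : ι → Ω → ℝ}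
    (hX : ∀ i, MemLp (X i) 2 P) (hG : IsGaussianProcess X P) (h0 : ∀ i, ∫ ω, X i ω ∂P = 0) :
    IsGaussianSpace (closedSpan hX) := by
  refine IsGaussianSpace.topologicalClosure fun f hf u => ?_
  obtain ⟨c, rfl⟩ := (Finsupp.mem_span_range_iff_exists_finsupp).1 hf
  set g : Ω → ℝ := fun ω => ∑ i ∈ c.support, c i * X i ω with hg
  have hfg : ((c.sum fun i a => a • (hX i).toLp (X i) : Lp ℝ 2 P) : Ω → ℝ) =ᵐ[P] g := by
    rw [Finsupp.sum]
    refine (Lp.coeFn_finsetSum _ _).trans ?_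
    have : ∀ i ∈ c.support, ∀ᵐ ω ∂P, (c i • (hX i).toLp (X i) : Lp ℝ 2 P) ω = c i * X i ω := by
      intro i _
      filter_upwards [Lp.coeFn_smul (c i) ((hX i).toLp (X i)), MemLp.coeFn_toLp (hX i)] with ω h1 h2
      rw [h1, Pi.smul_apply, h2, smul_eq_mul]
    filter_upwards [(c.support.eventually_all).2 this] with ω hω
    rw [hg, Finset.sum_apply]
    exact Finset.sum_congr rfl fun i hi => hω i hi
  have hlaw : HasGaussianLaw g P := by
    have := (hG.smul c).hasGaussianLaw_fun_sum (I := c.support)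
    simpa [hg] using this
  have hmean : ∫ ω, g ω ∂P = 0 := by
    rw [hg, integral_finsetSum _ fun i _ => ((hX i).integrable (by norm_num)).const_mul _]
    simp [integral_const_mul, h0]
  have hvar : Var[g; P] = ‖(c.sum fun i a => a • (hX i).toLp (X i) : Lp ℝ 2 P)‖ ^ 2 := by
    rw [norm_sq_eq_integral, variance_of_integral_eq_zero hlaw.aemeasurable hmean]
    refine integral_congr_ae ?_
    filter_upwards [hfg] with ω h
    simp [h]
  have h1 := hlaw.map_eq_gaussianReal
  have h2 := charFun_gaussianReal (μ := 0) (v := Var[g; P].toNNReal) u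
  have h3 : P[g] = 0 := hmean
  rw [h3] at h1
  rw [← h1, charFun_apply_real, integral_map hlaw.aemeasurable (by fun_prop)] at h2
  calc _ = ∫ ω, Complex.exp (u * (g ω : ℂ) * Complex.I) ∂P := by
        refine integral_congr_ae ?_
        filter_upwards [hfg] with ω h
        rw [h]; push_cast; rfl
    _ = _ := h2
    _ = _ := by
      rw [← hvar, Real.coe_toNNReal _ (variance_nonneg _ _)]
      congr 1; push_cast; ring

variable {S : Type*} [MeasurableSpace S] {σ : Measure S} [IsFiniteMeasure σ]

lemma integrable_sq_prod [IsProbabilityMeasure P] {X : S → Ω → ℝ}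
    (hX : Measurable fun q : Ω × S => X q.2 q.1) {C : ℝ} (hi : ∀ s, MemLp (X s) 2 P)
    (hC : ∀ s, ∫ ω, X s ω ^ 2 ∂P ≤ C) :
    Integrable (fun q : Ω × S => X q.2 q.1 ^ 2) (P.prod σ) := by
  rw [integrable_prod_iff' (hX.pow_const 2).aestronglyMeasurable]
  refine ⟨Eventually.of_forall fun s => (hi s).integrable_sq, ?_⟩
  refine Integrable.of_bound (C := C) ?_ (Eventually.of_forall fun s => ?_)
  · have h : StronglyMeasurable fun q : S × Ω => ‖X q.1 q.2 ^ 2‖ :=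
      ((hX.comp measurable_swap).pow_const 2).norm.stronglyMeasurable
    exact h.integral_prod_right.aestronglyMeasurable
  · rw [Real.norm_of_nonneg (integral_nonneg fun _ => norm_nonneg _)]
    simpa using hC s

lemma ae_memLp_two [IsProbabilityMeasure P] {X : S → Ω → ℝ}
    (hX : Measurable fun q : Ω × S => X q.2 q.1) {C : ℝ} (hi : ∀ s, MemLp (X s) 2 P)
    (hC : ∀ s, ∫ ω, X s ω ^ 2 ∂P ≤ C) : ∀ᵐ ω ∂P, MemLp (fun s => X s ω) 2 σ := by
  filter_upwards [(integrable_sq_prod (σ := σ) hX hi hC).prod_right_ae] with ω hω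
  rw [memLp_two_iff_integrable_sq]
  · exact hω
  · exact (hX.comp (measurable_const.prodMk measurable_id)).aestronglyMeasurable

/-- Cauchy–Schwarz in `s` for almost every path, followed by integration over `Ω`. -/
lemma memLp_integral_mul [IsProbabilityMeasure P] {X : S → Ω → ℝ}
    (hX : Measurable fun q : Ω × S => X q.2 q.1) {C : ℝ} (hi : ∀ s, MemLp (X s) 2 P)
    (hC : ∀ s, ∫ ω, X s ω ^ 2 ∂P ≤ C) {Y : S → ℝ} (hY : Measurable Y) {M : ℝ}
    (hM : ∀ s, |Y s| ≤ M) : MemLp (fun ω => ∫ s, X s ω * Y s ∂σ) 2 P := by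
  have hm : AEStronglyMeasurable (fun ω => ∫ s, X s ω * Y s ∂σ) P := by
    have h : StronglyMeasurable fun q : Ω × S => X q.2 q.1 * Y q.2 :=
      (hX.mul (hY.comp measurable_snd)).stronglyMeasurable
    exact h.integral_prod_right.aestronglyMeasurable
  rw [memLp_two_iff_integrable_sq hm]
  have hi2 := (integrable_sq_prod (σ := σ) hX hi hC).integral_prod_left
  refine (hi2.const_mul (M ^ 2 * σ.real univ)).mono' (hm.pow 2) ?_
  filter_upwards [ae_memLp_two (σ := σ) hX hi hC] with ω hω
  rw [Real.norm_of_nonneg (by positivity)]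
  have hYL : MemLp Y 2 σ := MemLp.of_bound hY.aestronglyMeasurable M (Eventually.of_forall hM)
  have h1 : (∫ s, X s ω * Y s ∂σ) ^ 2 ≤ (∫ s, X s ω ^ 2 ∂σ) * ∫ s, Y s ^ 2 ∂σ := by
    have h2 := real_inner_mul_inner_self_le (hω.toLp _) (hYL.toLp _)
    rw [L2.inner_def, L2.inner_def, L2.inner_def] at h2
    have e1 : ∫ s, inner ℝ ((hω.toLp _ : Lp ℝ 2 σ) s) ((hYL.toLp _ : Lp ℝ 2 σ) s) ∂σ =
        ∫ s, X s ω * Y s ∂σ := by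
      refine integral_congr_ae ?_
      filter_upwards [hω.coeFn_toLp, hYL.coeFn_toLp] with s h3 h4
      rw [h3, h4]; simp [mul_comm]
    have e2 : ∫ s, inner ℝ ((hω.toLp _ : Lp ℝ 2 σ) s) ((hω.toLp _ : Lp ℝ 2 σ) s) ∂σ =
        ∫ s, X s ω ^ 2 ∂σ := by
      refine integral_congr_ae ?_
      filter_upwards [hω.coeFn_toLp] with s h3
      rw [h3]; simp
    have e3 : ∫ s, inner ℝ ((hYL.toLp _ : Lp ℝ 2 σ) s) ((hYL.toLp _ : Lp ℝ 2 σ) s) ∂σ =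
        ∫ s, Y s ^ 2 ∂σ := by
      refine integral_congr_ae ?_
      filter_upwards [hYL.coeFn_toLp] with s h3
      rw [h3]; simp
    rw [e1, e2, e3] at h2
    rw [sq]; exact h2
  have h2 : ∫ s, Y s ^ 2 ∂σ ≤ M ^ 2 * σ.real univ := by
    calc _ ≤ ∫ _, M ^ 2 ∂σ := by
          refine integral_mono hYL.integrable_sq (integrable_const _) fun s => ?_
          simp only [← sq_abs (Y s)]
          exact pow_le_pow_left₀ (abs_nonneg _) (hM s) 2
      _ = _ := by rw [integral_const, smul_eq_mul, mul_comm]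
  calc _ ≤ _ := h1
    _ ≤ (∫ s, X s ω ^ 2 ∂σ) * (M ^ 2 * σ.real univ) :=
      mul_le_mul_of_nonneg_left h2 (integral_nonneg fun _ => sq_nonneg _)
    _ = _ := mul_comm _ _

lemma integrable_mul_field [IsProbabilityMeasure P] {X : S → Ω → ℝ}
    (hX : Measurable fun q : Ω × S => X q.2 q.1) {C : ℝ} (hi : ∀ s, MemLp (X s) 2 P)
    (hC : ∀ s, ∫ ω, X s ω ^ 2 ∂P ≤ C) {Y : S → ℝ} (hY : Measurable Y) {M : ℝ}
    (hM : ∀ s, |Y s| ≤ M) {g : Ω → ℝ} (hg : MemLp g 2 P) :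
    Integrable (fun q : Ω × S => g q.1 * (X q.2 q.1 * Y q.2)) (P.prod σ) := by
  have h1 := integrable_sq_prod (σ := σ) hX hi hC
  have h2 : Integrable (fun q : Ω × S => g q.1 ^ 2) (P.prod σ) := hg.integrable_sq.comp_fst σ
  have hM0 : ∀ s, 0 ≤ M := fun s => (abs_nonneg _).trans (hM s)
  refine ((h1.add h2).const_mul M).mono' ?_ (Eventually.of_forall fun q => ?_)
  · exact hg.1.comp_fst.mul (hX.mul (hY.comp measurable_snd)).aestronglyMeasurable
  · simp only [norm_mul, Real.norm_eq_abs, Pi.add_apply]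
    have h3 : |g q.1| * |X q.2 q.1| ≤ X q.2 q.1 ^ 2 + g q.1 ^ 2 := by
      rw [← sq_abs (X q.2 q.1), ← sq_abs (g q.1)]
      nlinarith [sq_nonneg (|g q.1| - |X q.2 q.1|), sq_nonneg |g q.1|, sq_nonneg |X q.2 q.1|]
    calc _ = (|g q.1| * |X q.2 q.1|) * |Y q.2| := by ring
      _ ≤ (X q.2 q.1 ^ 2 + g q.1 ^ 2) * M := by
        gcongr
        exact hM _
      _ = _ := mul_comm _ _

lemma integral_mul_integral_field [IsProbabilityMeasure P] {X : S → Ω → ℝ}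
    (hX : Measurable fun q : Ω × S => X q.2 q.1) {C : ℝ} (hi : ∀ s, MemLp (X s) 2 P)
    (hC : ∀ s, ∫ ω, X s ω ^ 2 ∂P ≤ C) {Y : S → ℝ} (hY : Measurable Y) {M : ℝ}
    (hM : ∀ s, |Y s| ≤ M) {g : Ω → ℝ} (hg : MemLp g 2 P) :
    ∫ ω, g ω * ∫ s, X s ω * Y s ∂σ ∂P = ∫ s, (∫ ω, g ω * X s ω ∂P) * Y s ∂σ := by
  have h := integral_integral_swap (f := fun ω s => g ω * (X s ω * Y s))
    (integrable_mul_field (σ := σ) hX hi hC hY hM hg)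
  simp_rw [integral_const_mul] at h
  rw [h]
  simp_rw [← mul_assoc, integral_mul_const]

/-- A linear functional of a random field belongs to the closed linear span of the field. -/
lemma integral_mul_mem_closedSpan [IsProbabilityMeasure P] {ι : Type*} {X' : ι → Ω → ℝ}
    (hX' : ∀ i, MemLp (X' i) 2 P) {e : S → ι} {X : S → Ω → ℝ} (he : ∀ s, X s = X' (e s))
    (hX : Measurable fun q : Ω × S => X q.2 q.1) {C : ℝ} (hi : ∀ s, MemLp (X s) 2 P)
    (hC : ∀ s, ∫ ω, X s ω ^ 2 ∂P ≤ C) {Y : S → ℝ} (hY : Measurable Y) {M : ℝ}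
    (hM : ∀ s, |Y s| ≤ M) :
    (memLp_integral_mul (σ := σ) hX hi hC hY hM).toLp _ ∈ closedSpan hX' := by
  refine mem_closedSpan_of_forall_inner hX' fun g hg => ?_
  rw [inner_eq_integral]
  have h1 : ∫ ω, g ω * ((memLp_integral_mul (σ := σ) hX hi hC hY hM).toLp _ : Lp ℝ 2 P) ω ∂P =
      ∫ ω, g ω * ∫ s, X s ω * Y s ∂σ ∂P := by
    refine integral_congr_ae ?_
    filter_upwards [(memLp_integral_mul (σ := σ) hX hi hC hY hM).coeFn_toLp] with ω h
    rw [h]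
  rw [h1, integral_mul_integral_field hX hi hC hY hM (Lp.memLp g)]
  refine integral_eq_zero_of_ae (Eventually.of_forall fun s => ?_)
  have h2 := hg (e s)
  rw [inner_eq_integral] at h2
  have h3 : ∫ ω, g ω * X s ω ∂P = 0 := by
    rw [← h2]
    refine integral_congr_ae ?_
    filter_upwards [(hX' (e s)).coeFn_toLp] with ω h
    rw [h, he, mul_comm]
  simp [h3]

end RandomField

/-! ### A central limit theorem for conditionally Gaussian martingale differences -/

section CLT

/-- Conditional characteristic function of a Gaussian vector independent of the past. -/
lemma integral_mul_exp_of_indep {Ω I : Type*} [Fintype I] {m mΩ : MeasurableSpace Ω}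
    {P : Measure Ω} [IsProbabilityMeasure P] (hm : m ≤ mΩ) {ξ : Ω → I → ℝ} (hξ : Measurable ξ)
    (hind : Indep m (MeasurableSpace.comap ξ inferInstance) P) {d : I → ℝ}
    (hchar : ∀ c : I → ℝ, ∫ ω, Complex.exp ((∑ i, c i * ξ ω i : ℝ) * Complex.I) ∂P =
      Complex.exp ((-(∑ i, d i * c i ^ 2) / 2 : ℝ)))
    {D : Ω → ℂ} (hD : Measurable[m] D) {C : ℝ} (hC : ∀ ω, ‖D ω‖ ≤ C) {w : Ω → I → ℝ}
    (hw : Measurable[m] w) :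
    ∫ ω, D ω * Complex.exp ((∑ i, w ω i * ξ ω i : ℝ) * Complex.I) ∂P =
      ∫ ω, D ω * Complex.exp ((-(∑ i, d i * w ω i ^ 2) / 2 : ℝ)) ∂P := by
  set U : Ω → ℂ × (I → ℝ) := fun ω => (D ω, w ω)
  have hUm : Measurable[m] U := hD.prodMk hw
  have hU : Measurable U := hUm.mono hm le_rfl
  have hUξ : IndepFun U ξ P := by
    rw [IndepFun_iff_Indep]
    exact indep_of_indep_of_le_left hind hUm.comap_le
  -- The joint law of `(D, w)` and `ξ` is a product, so `ξ` can be integrated out with `w` frozen.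
  have hprod := (indepFun_iff_map_prod_eq_prod_map_map hU.aemeasurable hξ.aemeasurable).1 hUξ
  set F : (ℂ × (I → ℝ)) × (I → ℝ) → ℂ := fun q =>
    q.1.1 * Complex.exp ((∑ i, q.1.2 i * q.2 i : ℝ) * Complex.I)
  have hF : Measurable F := by
    have : Continuous F := by fun_prop
    exact this.measurable
  have hint : Integrable (fun ω => F (U ω, ξ ω)) P := by
    refine Integrable.of_bound (C := C) (hF.comp (hU.prodMk hξ)).aestronglyMeasurable
      (Eventually.of_forall fun ω => ?_)
    simp only [F, U, norm_mul, Complex.norm_exp_ofReal_mul_I, mul_one]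
    exact hC ω
  have hint' : Integrable F ((P.map U).prod (P.map ξ)) := by
    rw [← hprod]
    exact (integrable_map_measure hF.aestronglyMeasurable (hU.prodMk hξ).aemeasurable).2 hint
  have := Measure.isProbabilityMeasure_map (μ := P) hξ.aemeasurable
  calc ∫ ω, F (U ω, ξ ω) ∂P = ∫ q, F q ∂(P.map fun ω => (U ω, ξ ω)) :=
        (integral_map (hU.prodMk hξ).aemeasurable hF.aestronglyMeasurable).symm
    _ = ∫ u, ∫ x, F (u, x) ∂(P.map ξ) ∂(P.map U) := by rw [hprod, integral_prod _ hint']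
    _ = ∫ u : ℂ × (I → ℝ), u.1 * Complex.exp ((-(∑ i, d i * u.2 i ^ 2) / 2 : ℝ)) ∂(P.map U) := by
        congr 1; ext u
        simp only [F]
        rw [← hchar, integral_const_mul, integral_map hξ.aemeasurable]
        have : Continuous fun x : I → ℝ =>
            Complex.exp ((∑ i, u.2 i * x i : ℝ) * Complex.I) := by fun_prop
        exact this.measurable.aestronglyMeasurable
    _ = _ := by
        rw [integral_map hU.aemeasurable]
        have : Continuous fun u : ℂ × (I → ℝ) =>
          u.1 * Complex.exp ((-(∑ i, d i * u.2 i ^ 2) / 2 : ℝ)) := by fun_prop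
        exact this.measurable.aestronglyMeasurable

variable {Ω I : Type*} [Fintype I] [mΩ : MeasurableSpace Ω] {P : Measure Ω}
  [IsProbabilityMeasure P]

/-- The exponential martingale of a conditionally Gaussian martingale with bounded quadratic
variation has constant expectation. -/
lemma integral_exp_martingale {m : ℕ → MeasurableSpace Ω} (hm : ∀ n, m n ≤ mΩ) (hmono : Monotone m)
    {ξ w : ℕ → Ω → I → ℝ} (hξ : ∀ n, Measurable[m (n + 1)] (ξ n)) (hw : ∀ n, Measurable[m n] (w n))
    (hind : ∀ n, Indep (m n) (MeasurableSpace.comap (ξ n) inferInstance) P) {d : I → ℝ}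
    (hchar : ∀ n, ∀ c : I → ℝ, ∫ ω, Complex.exp ((∑ i, c i * ξ n ω i : ℝ) * Complex.I) ∂P =
      Complex.exp ((-(∑ i, d i * c i ^ 2) / 2 : ℝ)))
    {M : ℝ} (hM : ∀ n ω, ∑ k ∈ Finset.range n, ∑ i, d i * w k ω i ^ 2 ≤ M) (n : ℕ) :
    ∫ ω, Complex.exp ((∑ k ∈ Finset.range n, ∑ i, w k ω i * ξ k ω i : ℝ) * Complex.I) *
      Complex.exp (((∑ k ∈ Finset.range n, ∑ i, d i * w k ω i ^ 2) / 2 : ℝ)) ∂P = 1 := by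
  induction n with
  | zero => simp
  | succ n ih =>
    have hsm : Measurable[m n] fun ω => (∑ k ∈ Finset.range n, ∑ i, w k ω i * ξ k ω i : ℝ) := by
      refine Finset.measurable_sum _ fun k hk => Finset.measurable_sum _ fun i _ => ?_
      have hk' : k < n := by simpa using hk
      exact ((measurable_pi_apply i).comp ((hw k).mono (hmono hk'.le) le_rfl)).mul
        ((measurable_pi_apply i).comp ((hξ k).mono (hmono hk') le_rfl))
    have hqm : Measurable[m n] fun ω =>
        (∑ k ∈ Finset.range (n + 1), ∑ i, d i * w k ω i ^ 2 : ℝ) := by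
      refine Finset.measurable_sum _ fun k hk => Finset.measurable_sum _ fun i _ => ?_
      have hk' : k ≤ n := by simpa [Nat.lt_succ_iff] using hk
      exact (((measurable_pi_apply i).comp ((hw k).mono (hmono hk') le_rfl)).pow_const 2).const_mul _
    -- The compensator already includes time `n`, because the weights are predictable; integrating
    -- out `ξ n` cancels precisely its last term.
    set D : Ω → ℂ := fun ω =>
      Complex.exp ((∑ k ∈ Finset.range n, ∑ i, w k ω i * ξ k ω i : ℝ) * Complex.I) *
      Complex.exp (((∑ k ∈ Finset.range (n + 1), ∑ i, d i * w k ω i ^ 2) / 2 : ℝ)) with hD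
    have hDm : Measurable[m n] D := by
      have h1 : Measurable fun x : ℝ × ℝ => Complex.exp (x.1 * Complex.I) *
          Complex.exp ((x.2 / 2 : ℝ)) := by
        have : Continuous fun x : ℝ × ℝ => Complex.exp (x.1 * Complex.I) *
          Complex.exp ((x.2 / 2 : ℝ)) := by fun_prop
        exact this.measurable
      exact h1.comp (hsm.prodMk hqm)
    have hDb : ∀ ω, ‖D ω‖ ≤ Real.exp (M / 2) := fun ω => by
      rw [hD]
      simp only [norm_mul, Complex.norm_exp_ofReal_mul_I, one_mul, Complex.norm_exp_ofReal]
      exact Real.exp_le_exp.2 (by linarith [hM (n + 1) ω])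
    have h := integral_mul_exp_of_indep (hm n) ((hξ n).mono (hm _) le_rfl) (hind n) (hchar n)
      hDm hDb (hw n)
    calc _ = ∫ ω, D ω * Complex.exp ((∑ i, w n ω i * ξ n ω i : ℝ) * Complex.I) ∂P := by
          congr 1; ext ω
          rw [hD, Finset.sum_range_succ (fun k => ∑ i, w k ω i * ξ k ω i)]
          push_cast
          rw [add_mul, Complex.exp_add]
          ring
      _ = _ := h
      _ = 1 := by
          rw [← ih]
          congr 1; ext ω
          rw [hD, mul_assoc, ← Complex.exp_add, ← Complex.ofReal_add, Finset.sum_range_succ]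
          congr 3
          ring

/-- For negative `y` the bound is `1 - exp (-ε) ≤ exp ε - 1`, which is `cosh ε ≥ 1`. -/
lemma norm_sub_mul_exp_le {z : ℂ} (hz : ‖z‖ = 1) {y ε : ℝ} (hy : |y| ≤ ε) :
    ‖z - z * Complex.exp (y : ℝ)‖ ≤ Real.exp ε - 1 := by
  have h1 : z - z * Complex.exp (y : ℝ) = z * ((1 - Real.exp y : ℝ) : ℂ) := by push_cast; ring
  rw [h1, norm_mul, hz, one_mul, Complex.norm_real, Real.norm_eq_abs, abs_le]
  have h2 := Real.exp_le_exp.2 (abs_le.1 hy).2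
  have h3 := Real.exp_le_exp.2 (abs_le.1 hy).1
  have h4 : 2 ≤ Real.exp ε + Real.exp (-ε) := by
    have := Real.one_le_cosh ε
    rw [Real.cosh_eq] at this; linarith
  constructor <;> linarith

/-- Central limit theorem for a martingale with conditionally Gaussian increments, in terms of
characteristic functions. -/
theorem tendsto_integral_exp_of_indep_gaussian {m : ℕ → MeasurableSpace Ω} (hm : ∀ n, m n ≤ mΩ)
    (hmono : Monotone m) {ξ v : ℕ → Ω → I → ℝ} (hξ : ∀ n, Measurable[m (n + 1)] (ξ n))
    (hv : ∀ n, Measurable[m n] (v n))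
    (hind : ∀ n, Indep (m n) (MeasurableSpace.comap (ξ n) inferInstance) P) {d : I → ℝ}
    (hd : ∀ i, 0 ≤ d i)
    (hchar : ∀ n, ∀ c : I → ℝ, ∫ ω, Complex.exp ((∑ i, c i * ξ n ω i : ℝ) * Complex.I) ∂P =
      Complex.exp ((-(∑ i, d i * c i ^ 2) / 2 : ℝ)))
    {s : ℝ} (hs : 0 ≤ s)
    (hlln : TendstoInMeasure P (fun (N : ℕ) ω => (N : ℝ)⁻¹ *
      ∑ n ∈ Finset.range N, ∑ i, d i * v n ω i ^ 2) atTop (fun _ => s)) :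
    Tendsto (fun N : ℕ => ∫ ω, Complex.exp (((√N)⁻¹ *
      ∑ n ∈ Finset.range N, ∑ i, v n ω i * ξ n ω i : ℝ) * Complex.I) ∂P) atTop
      (𝓝 (Complex.exp ((-s / 2 : ℝ)))) := by
  set q : ℕ → Ω → ℝ := fun n ω => ∑ i, d i * v n ω i ^ 2 with hq
  have hq0 : ∀ n ω, 0 ≤ q n ω := fun n ω => Finset.sum_nonneg fun i _ => mul_nonneg (hd i) (sq_nonneg _)
  set S : ℕ → Ω → ℝ := fun n ω => ∑ k ∈ Finset.range n, q k ω with hS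
  have hSmono : ∀ ω, Monotone fun n => S n ω := fun ω =>
    monotone_nat_of_le_succ fun n => by
      simp only [hS, Finset.sum_range_succ]; linarith [hq0 n ω]
  have hvm : ∀ n i, Measurable[m n] fun ω => v n ω i := fun n i => (measurable_pi_apply i).comp (hv n)
  have hqm : ∀ n, Measurable[m n] (q n) := fun n =>
    Finset.measurable_sum _ fun i _ => ((hvm n i).pow_const 2).const_mul _
  have hSm : ∀ n, Measurable[m n] (S (n + 1)) := fun n =>
    Finset.measurable_sum _ fun k hk =>
      (hqm k).mono (hmono (by simpa [Nat.lt_succ_iff] using hk)) le_rfl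
  -- Truncation level: increments are dropped once the accumulated quadratic variation exceeds `N *
  -- (s + 1)`. The rule is predictable, as `S (n + 1)` involves only `v` up to `n`, and it is
  -- inactive when the normalized variation is within `ε ≤ 1` of `s`.
  set M := s + 1 with hM
  set w : ℕ → ℕ → Ω → I → ℝ := fun N n ω i =>
    if S (n + 1) ω ≤ N * M then (√N)⁻¹ * v n ω i else 0 with hw
  have hwm : ∀ N n, Measurable[m n] (w N n) := fun N n => by
    refine @measurable_pi_lambda _ _ _ (m n) _ _ fun i => ?_
    have h1 : Measurable fun x : ℝ × ℝ => if x.1 ≤ N * M then (√N)⁻¹ * x.2 else 0 :=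
      Measurable.ite (measurableSet_le measurable_fst measurable_const)
        (measurable_snd.const_mul _) measurable_const
    exact h1.comp ((hSm n).prodMk (hvm n i))
  have hwq : ∀ N n ω, ∑ i, d i * w N n ω i ^ 2 =
      if S (n + 1) ω ≤ N * M then (N : ℝ)⁻¹ * q n ω else 0 := fun N n ω => by
    simp only [hw, hq]
    split_ifs with h
    · rw [Finset.mul_sum]
      refine Finset.sum_congr rfl fun i _ => ?_
      rw [mul_pow, inv_pow, Real.sq_sqrt (by positivity)]; ring
    · simp
  have hM0 : 0 ≤ M := by linarith
  have hbound : ∀ (N : ℕ) n ω, ∑ k ∈ Finset.range n, ∑ i, d i * w N k ω i ^ 2 ≤ M := by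
    intro N n ω
    simp_rw [hwq]
    -- The second bound is carried along for the induction: when the last term is kept, the sum is
    -- at most `S (n + 1) / N`, hence at most `M`.
    have : ∑ k ∈ Finset.range n, (if S (k + 1) ω ≤ N * M then (N : ℝ)⁻¹ * q k ω else 0) ≤ M ∧
        ∑ k ∈ Finset.range n, (if S (k + 1) ω ≤ N * M then (N : ℝ)⁻¹ * q k ω else 0) ≤
          (N : ℝ)⁻¹ * S n ω := by
      induction n with
      | zero => simp [hS, hM0]
      | succ n ih =>
        have h1 : (N : ℝ)⁻¹ * S (n + 1) ω = (N : ℝ)⁻¹ * S n ω + (N : ℝ)⁻¹ * q n ω := by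
          simp only [hS, Finset.sum_range_succ]; ring
        have h2 : 0 ≤ (N : ℝ)⁻¹ * q n ω := mul_nonneg (by positivity) (hq0 n ω)
        rw [Finset.sum_range_succ]
        split_ifs with h
        · have h3 : (N : ℝ)⁻¹ * S (n + 1) ω ≤ M := by
            rcases Nat.eq_zero_or_pos N with rfl | hN
            · simpa using hM0
            · rw [inv_mul_le_iff₀ (by exact_mod_cast hN)]; exact h
          constructor <;> linarith [ih.2]
        · constructor <;> linarith [ih.1, ih.2]
    exact this.1
  set X : ℕ → Ω → ℂ := fun N ω => Complex.exp (((√N)⁻¹ *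
      ∑ n ∈ Finset.range N, ∑ i, v n ω i * ξ n ω i : ℝ) * Complex.I) with hX
  set X' : ℕ → Ω → ℂ := fun N ω => Complex.exp
    ((∑ n ∈ Finset.range N, ∑ i, w N n ω i * ξ n ω i : ℝ) * Complex.I) with hX'
  set Q : ℕ → Ω → ℝ := fun N ω => ∑ k ∈ Finset.range N, ∑ i, d i * w N k ω i ^ 2 with hQ
  have hξm : ∀ n i, Measurable fun ω => ξ n ω i := fun n i =>
    (measurable_pi_apply i).comp ((hξ n).mono (hm _) le_rfl)
  have hvm' : ∀ n i, Measurable fun ω => v n ω i := fun n i => (hvm n i).mono (hm _) le_rfl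
  have hwm' : ∀ N n i, Measurable fun ω => w N n ω i := fun N n i =>
    (measurable_pi_apply i).comp ((hwm N n).mono (hm _) le_rfl)
  have hexp : Measurable fun x : ℝ => Complex.exp (x * Complex.I) := by
    have : Continuous fun x : ℝ => Complex.exp (x * Complex.I) := by fun_prop
    exact this.measurable
  have hexp' : Measurable fun x : ℝ => Complex.exp ((x : ℝ) : ℂ) := by
    have : Continuous fun x : ℝ => Complex.exp ((x : ℝ) : ℂ) := by fun_prop
    exact this.measurable
  have hXm : ∀ N, Measurable (X N) := fun N => hexp.comp
    ((Finset.measurable_sum _ fun n _ => Finset.measurable_sum _ fun i _ =>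
      (hvm' n i).mul (hξm n i)).const_mul _)
  have hX'm : ∀ N, Measurable (X' N) := fun N => hexp.comp
    (Finset.measurable_sum _ fun n _ => Finset.measurable_sum _ fun i _ =>
      (hwm' N n i).mul (hξm n i))
  have hQm : ∀ N, Measurable (Q N) := fun N =>
    Finset.measurable_sum _ fun n _ => Finset.measurable_sum _ fun i _ =>
      ((hwm' N n i).pow_const 2).const_mul _
  have hX1 : ∀ N ω, ‖X N ω‖ = 1 := fun N ω => Complex.norm_exp_ofReal_mul_I _
  have hX'1 : ∀ N ω, ‖X' N ω‖ = 1 := fun N ω => Complex.norm_exp_ofReal_mul_I _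
  have hmart : ∀ N, ∫ ω, X' N ω * Complex.exp ((Q N ω / 2 : ℝ)) ∂P = 1 := fun N =>
    integral_exp_martingale hm hmono hξ (hwm N) hind hchar (hbound N) N
  -- The subtracted term has expectation exactly `exp (-s / 2)` by the exponential martingale, so
  -- the claim is that `R` tends to zero in mean. It is uniformly bounded, and small wherever the
  -- quadratic variation is close to `s`.
  set R : ℕ → Ω → ℂ := fun N ω => X N ω - X' N ω * Complex.exp (((Q N ω - s) / 2 : ℝ)) with hR
  have hexpb : ∀ N ω, ‖Complex.exp (((Q N ω - s) / 2 : ℝ))‖ ≤ Real.exp (M / 2) := fun N ω => by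
    rw [Complex.norm_exp_ofReal]
    have : Q N ω ≤ M := hbound N N ω
    exact Real.exp_le_exp.2 (by linarith)
  have hRb : ∀ N ω, ‖R N ω‖ ≤ 1 + Real.exp (M / 2) := fun N ω => by
    refine (norm_sub_le _ _).trans ?_
    rw [hX1, norm_mul, hX'1, one_mul]
    linarith [hexpb N ω]
  have hXi : ∀ N, Integrable (X N) P := fun N =>
    Integrable.of_bound (hXm N).aestronglyMeasurable 1 (Eventually.of_forall fun ω => (hX1 N ω).le)
  have hX'm2 : ∀ N, Measurable fun ω => X' N ω * Complex.exp (((Q N ω - s) / 2 : ℝ)) := fun N =>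
    (hX'm N).mul (hexp'.comp (((hQm N).sub_const s).div_const 2))
  have hX'i : ∀ N, Integrable (fun ω => X' N ω * Complex.exp (((Q N ω - s) / 2 : ℝ))) P := fun N =>
    Integrable.of_bound (hX'm2 N).aestronglyMeasurable (Real.exp (M / 2))
      (Eventually.of_forall fun ω => by rw [norm_mul, hX'1, one_mul]; exact hexpb N ω)
  have hRint : ∀ N, ∫ ω, R N ω ∂P = ∫ ω, X N ω ∂P - Complex.exp ((-s / 2 : ℝ)) := fun N => by
    rw [integral_sub (hXi N) (hX'i N)]
    congr 1
    calc _ = ∫ ω, Complex.exp ((-s / 2 : ℝ)) * (X' N ω * Complex.exp ((Q N ω / 2 : ℝ))) ∂P := by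
          congr 1; ext ω
          have : Complex.exp (((Q N ω - s) / 2 : ℝ)) =
              Complex.exp ((-s / 2 : ℝ)) * Complex.exp ((Q N ω / 2 : ℝ)) := by
            rw [← Complex.exp_add, ← Complex.ofReal_add]
            congr 2; ring
          rw [this]; ring
      _ = _ := by rw [integral_const_mul, hmart, mul_one]
  have hRsmall : ∀ (N : ℕ) ω (ε : ℝ), 0 < N → ε ≤ 1 → |(N : ℝ)⁻¹ * S N ω - s| < ε →
      ‖R N ω‖ ≤ Real.exp (ε / 2) - 1 := by
    intro N ω ε hN hε h
    have hN' : (0 : ℝ) < N := by exact_mod_cast hN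
    have h1 : S N ω ≤ N * M := by
      have := (abs_lt.1 h).2
      rw [← inv_mul_le_iff₀ hN']; linarith
    have h2 : ∀ n ∈ Finset.range N, S (n + 1) ω ≤ N * M := fun n hn =>
      (hSmono ω (show n + 1 ≤ N by simpa [Nat.succ_le_iff] using hn)).trans h1
    have h3 : X N ω = X' N ω := by
      change Complex.exp _ = Complex.exp _
      congr 3
      rw [Finset.mul_sum]
      refine Finset.sum_congr rfl fun n hn => ?_
      rw [Finset.mul_sum]
      refine Finset.sum_congr rfl fun i _ => ?_
      simp only [hw, if_pos (h2 n hn)]; ring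
    have h4 : Q N ω = (N : ℝ)⁻¹ * S N ω := by
      simp only [hQ, hwq, hS, Finset.mul_sum]
      exact Finset.sum_congr rfl fun n hn => if_pos (h2 n hn)
    change ‖X N ω - X' N ω * Complex.exp (((Q N ω - s) / 2 : ℝ))‖ ≤ _
    rw [h3, h4]
    refine norm_sub_mul_exp_le (hX'1 N ω) ?_
    rw [abs_div, abs_two]; linarith
  rw [tendsto_iff_norm_sub_tendsto_zero]
  suffices h : Tendsto (fun N => ‖∫ ω, R N ω ∂P‖) atTop (𝓝 0) by
    refine h.congr fun N => ?_
    rw [hRint]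
  rw [Metric.tendsto_atTop]
  intro η hη
  obtain ⟨ε, hε0, hε1, hεη⟩ : ∃ ε > 0, ε ≤ 1 ∧ Real.exp (ε / 2) - 1 < η / 2 := by
    have hc : Tendsto (fun ε : ℝ => Real.exp (ε / 2) - 1) (𝓝[>] 0) (𝓝 0) := by
      have : Continuous fun ε : ℝ => Real.exp (ε / 2) - 1 := by fun_prop
      have h := this.tendsto 0
      simp only [zero_div, Real.exp_zero, sub_self] at h
      exact h.mono_left nhdsWithin_le_nhds
    have h1 := hc.eventually (gt_mem_nhds (show 0 < η / 2 by linarith))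
    have h2 : ∀ᶠ ε : ℝ in 𝓝[>] 0, ε ∈ Ioc (0 : ℝ) 1 := Ioc_mem_nhdsGT one_pos
    obtain ⟨ε, h3, h4⟩ := (h1.and h2).exists
    exact ⟨ε, h4.1, h4.2, h3⟩
  have hB := (tendstoInMeasure_iff_measureReal_norm.1 hlln) ε hε0
  have hB' : Tendsto (fun N : ℕ => (1 + Real.exp (M / 2)) *
      P.real {ω | ε ≤ ‖(N : ℝ)⁻¹ * S N ω - s‖}) atTop (𝓝 0) := by
    simpa using hB.const_mul (1 + Real.exp (M / 2))
  obtain ⟨N₀, hN₀⟩ := (Metric.tendsto_atTop.1 hB') (η / 2) (by linarith)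
  refine ⟨max N₀ 1, fun N hN => ?_⟩
  have hN1 : 0 < N := by have := le_max_right N₀ 1; omega
  have hB2 := hN₀ N (le_trans (le_max_left _ _) hN)
  rw [Real.dist_0_eq_abs, abs_of_nonneg (by positivity)] at hB2
  rw [Real.dist_0_eq_abs, abs_of_nonneg (norm_nonneg _)]
  set B : Set Ω := {ω | ε ≤ ‖(N : ℝ)⁻¹ * S N ω - s‖} with hBdef
  have hSm' : Measurable (S N) := Finset.measurable_sum _ fun k _ => (hqm k).mono (hm _) le_rfl
  have hBm : MeasurableSet B :=
    measurableSet_le measurable_const ((hSm'.const_mul _).sub_const _).norm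
  have hle : ∀ ω, ‖R N ω‖ ≤ (Real.exp (ε / 2) - 1) +
      B.indicator (fun _ => 1 + Real.exp (M / 2)) ω := fun ω => by
    have h0 : 0 ≤ Real.exp (ε / 2) - 1 := by
      have := Real.one_le_exp (show 0 ≤ ε / 2 by linarith); linarith
    by_cases hω : ω ∈ B
    · rw [indicator_of_mem hω]; linarith [hRb N ω]
    · rw [indicator_of_notMem hω, add_zero]
      refine hRsmall N ω ε hN1 hε1 ?_
      simpa [hBdef] using hω
  have hii : Integrable (B.indicator fun _ => 1 + Real.exp (M / 2)) P :=
    (integrable_const _).indicator hBm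
  calc ‖∫ ω, R N ω ∂P‖ ≤ ∫ ω, ((Real.exp (ε / 2) - 1) +
        B.indicator (fun _ => 1 + Real.exp (M / 2)) ω) ∂P :=
        norm_integral_le_of_norm_le ((integrable_const _).add hii) (Eventually.of_forall hle)
    _ = (Real.exp (ε / 2) - 1) + (1 + Real.exp (M / 2)) * P.real B := by
        rw [integral_add (integrable_const _) hii, integral_indicator_const _ hBm]
        simp [mul_comm]
    _ < η := by linarith

end CLT

/-! ### Autoregressive recursions -/

section Autoregression

/-- The companion matrix of the autoregressive polynomial with coefficients `φ`. -/
def companion {R : Type*} [Zero R] [One R] {p : ℕ} (φ : Fin p → R) : Matrix (Fin p) (Fin p) R :=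
  Matrix.of fun i j => if (i : ℕ) = 0 then φ j else if (j : ℕ) + 1 = i then 1 else 0

lemma companion_mulVec_pos {p : ℕ} (φ : Fin p → ℂ) (v : Fin p → ℂ) {i j : Fin p}
    (h : (j : ℕ) + 1 = i) : (companion φ).mulVec v i = v j := by
  rw [Matrix.mulVec, dotProduct, Finset.sum_eq_single j]
  · simp [companion, h, show (i : ℕ) ≠ 0 by omega]
  · intro k _ hk
    have : ¬ (k : ℕ) + 1 = i := fun h' => hk (Fin.ext (by omega))
    simp [companion, this, show (i : ℕ) ≠ 0 by omega]
  · simp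

/-- An eigenvector for `μ ≠ 0` is geometric with ratio `u = μ⁻¹`, because the lower rows are shifts;
the first row then makes `u` a root of the autoregressive polynomial. For `‖μ‖ ≥ 1` this root would
lie in the closed unit disk. -/
lemma norm_lt_one_of_mem_spectrum_companion {p : ℕ} {φ : Fin p → ℂ}
    (h : ∀ z : ℂ, ‖z‖ ≤ 1 → 1 - ∑ j, φ j * z ^ ((j : ℕ) + 1) ≠ 0) {μ : ℂ}
    (hμ : μ ∈ spectrum ℂ (companion φ)) : ‖μ‖ < 1 := by
  rw [← Matrix.spectrum_toLin', ← Module.End.hasEigenvalue_iff_mem_spectrum] at hμ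
  obtain ⟨v, hv⟩ := hμ.exists_hasEigenvector
  have hv1 := hv.apply_eq_smul
  rw [Matrix.toLin'_apply] at hv1
  by_contra! hle
  have hμ0 : μ ≠ 0 := by rintro rfl; simp at hle; linarith
  set u := μ⁻¹ with hu
  have hu1 : ‖u‖ ≤ 1 := by rw [hu, norm_inv]; exact inv_le_one_of_one_le₀ hle
  rcases Nat.eq_zero_or_pos p with rfl | hp
  · exact hv.2 (Subsingleton.elim _ _)
  set o : Fin p := ⟨0, hp⟩
  have hpow : ∀ n (hn : n < p), v ⟨n, hn⟩ = u ^ n * v o := by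
    intro n
    induction n with
    | zero => intro hn; simp [o]
    | succ n ih =>
      intro hn
      have h1 := congrFun hv1 ⟨n + 1, hn⟩
      rw [companion_mulVec_pos φ v (j := ⟨n, by omega⟩) (by simp), ih, Pi.smul_apply,
        smul_eq_mul] at h1
      have huμ : u * μ = 1 := inv_mul_cancel₀ hμ0
      calc v ⟨n + 1, hn⟩ = u * (μ * v ⟨n + 1, hn⟩) := by rw [← mul_assoc, huμ, one_mul]
        _ = u ^ (n + 1) * v o := by rw [← h1]; ring
  have h0 := congrFun hv1 o
  have h2 : (companion φ).mulVec v o = (∑ j, φ j * u ^ (j : ℕ)) * v o := by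
    rw [Matrix.mulVec, dotProduct, Finset.sum_mul]
    refine Finset.sum_congr rfl fun j _ => ?_
    rw [show v j = u ^ (j : ℕ) * v o from hpow j j.2]
    simp [companion, o, mul_assoc]
  rw [h2, Pi.smul_apply, smul_eq_mul] at h0
  have h3 : (1 - ∑ j, φ j * u ^ ((j : ℕ) + 1)) * v o = 0 := by
    have : ∑ j, φ j * u ^ ((j : ℕ) + 1) = u * ∑ j, φ j * u ^ (j : ℕ) := by
      rw [Finset.mul_sum]; exact Finset.sum_congr rfl fun j _ => by ring
    rw [this, sub_mul, mul_assoc, h0, hu]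
    field_simp; ring
  have h4 := (mul_eq_zero.1 h3).resolve_left (h u hu1)
  refine hv.2 (funext fun i => ?_)
  rw [show v i = u ^ (i : ℕ) * v o from hpow i i.2, h4]; simp

/-- Gelfand's formula bounds the powers eventually by `c ^ n` for some `c` between the spectral
radius and 1. -/
lemma tendsto_pow_of_spectralRadius_lt_one {A : Type*} [NormedRing A] [NormedAlgebra ℂ A]
    [CompleteSpace A] {a : A} (h : spectralRadius ℂ a < 1) :
    Tendsto (fun n : ℕ => ‖a ^ n‖) atTop (𝓝 0) := by
  obtain ⟨c, hc1, hc2⟩ := ENNReal.lt_iff_exists_nnreal_btwn.1 h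
  have hc : (c : ℝ) < 1 := by exact_mod_cast hc2
  have h1 := (spectrum.pow_norm_pow_one_div_tendsto_nhds_spectralRadius a).eventually
    (gt_mem_nhds hc1)
  have h2 : Tendsto (fun n : ℕ => (c : ℝ) ^ n) atTop (𝓝 0) :=
    tendsto_pow_atTop_nhds_zero_of_lt_one c.2 hc
  refine squeeze_zero' (Eventually.of_forall fun n => norm_nonneg _) ?_ h2
  filter_upwards [h1, eventually_gt_atTop 0] with n hn hn0
  have h3 : ‖a ^ n‖ ^ (1 / (n : ℝ)) < c := by
    rw [ENNReal.ofReal_lt_iff_lt_toReal (by positivity) (by simp)] at hn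
    simpa using hn
  calc ‖a ^ n‖ = (‖a ^ n‖ ^ (1 / (n : ℝ))) ^ n := by
        rw [one_div, Real.rpow_inv_natCast_pow (norm_nonneg _) (by omega)]
    _ ≤ _ := pow_le_pow_left₀ (by positivity) h3.le n

attribute [local instance] Matrix.linftyOpNormedAddCommGroup Matrix.linftyOpNormedRing
  Matrix.linftyOpNormedAlgebra in
lemma tendsto_companion_pow_complex {p : ℕ} {φ : Fin p → ℂ}
    (h : ∀ z : ℂ, ‖z‖ ≤ 1 → 1 - ∑ j, φ j * z ^ ((j : ℕ) + 1) ≠ 0) (i j : Fin p) :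
    Tendsto (fun n : ℕ => ‖(companion φ ^ n) i j‖) atTop (𝓝 0) := by
  have : Nonempty (Fin p) := ⟨i⟩
  have : CompleteSpace (Matrix (Fin p) (Fin p) ℂ) := FiniteDimensional.complete ℂ _
  have h1 : spectralRadius ℂ (companion φ) < 1 := by
    have := spectrum.spectralRadius_lt_of_forall_lt (companion φ) (r := 1) fun μ hμ => by
      have := norm_lt_one_of_mem_spectrum_companion h hμ
      exact_mod_cast this
    simpa using this
  refine squeeze_zero (fun n => norm_nonneg _) (fun n => ?_) (tendsto_pow_of_spectralRadius_lt_one h1)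
  have h2 : ∀ A : Matrix (Fin p) (Fin p) ℂ, ‖A i j‖₊ ≤ ‖A‖₊ := fun A => by
    rw [Matrix.linfty_opNNNorm_def]
    refine le_trans ?_ (Finset.le_sup (f := fun i => ∑ j, ‖A i j‖₊) (Finset.mem_univ i))
    exact Finset.single_le_sum (f := fun j => ‖A i j‖₊) (fun _ _ => zero_le) (Finset.mem_univ j)
  exact_mod_cast h2 (companion φ ^ n)

lemma tendsto_companion_pow {p : ℕ} {φ : Fin p → ℝ}
    (h : ∀ z : ℂ, ‖z‖ ≤ 1 → 1 - ∑ j, (φ j : ℂ) * z ^ ((j : ℕ) + 1) ≠ 0) (i j : Fin p) :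
    Tendsto (fun n : ℕ => (companion φ ^ n) i j) atTop (𝓝 0) := by
  have h1 := tendsto_companion_pow_complex h i j
  have h2 : companion (fun j => (φ j : ℂ)) = (companion φ).map Complex.ofRealHom := by
    ext a b
    simp only [companion, Matrix.map_apply, Matrix.of_apply]
    split_ifs <;> simp
  have h3 : ∀ n, companion (fun j => (φ j : ℂ)) ^ n = (companion φ ^ n).map Complex.ofRealHom :=
    fun n => by rw [h2, Matrix.map_pow]
  simp only [h3, Matrix.map_apply, Complex.ofRealHom_eq_coe, Complex.norm_real] at h1
  exact tendsto_zero_iff_norm_tendsto_zero.2 h1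

/-- The coefficients of the remainder in the `n`-fold iterated autoregressive recursion. -/
def arRemainder {p : ℕ} (φ : Fin p → ℝ) (n : ℕ) : Fin p → ℝ := Matrix.vecMul φ (companion φ ^ n)

lemma tendsto_arRemainder {p : ℕ} {φ : Fin p → ℝ}
    (h : ∀ z : ℂ, ‖z‖ ≤ 1 → 1 - ∑ j, (φ j : ℂ) * z ^ ((j : ℕ) + 1) ≠ 0) (k : Fin p) :
    Tendsto (fun n => arRemainder φ n k) atTop (𝓝 0) := by
  have : Tendsto (fun n => ∑ i, φ i * (companion φ ^ n) i k) atTop (𝓝 (∑ i, φ i * 0)) :=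
    tendsto_finsetSum _ fun i _ => (tendsto_companion_pow h i k).const_mul _
  simpa [arRemainder, Matrix.vecMul, dotProduct] using this

variable {V : Type*} [AddCommGroup V] [Module ℝ V]

/-- The innovation of the sequence `a` with respect to the autoregression with coefficients `φ`. -/
def innovation {p : ℕ} (φ : Fin p → ℝ) (a : ℤ → V) (t : ℤ) : V :=
  a t - ∑ j : Fin p, φ j • a (t - ((j : ℤ) + 1))

/-- First-order form of the recursion for the state `(a_t, …, a_{t-p+1})`: only the zeroth component
receives an innovation, the others are copied. -/
lemma state_eq {p : ℕ} (φ : Fin p → ℝ) (a : ℤ → V) (t : ℤ) (i : Fin p) :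
    a (t - i) = ∑ j, companion φ i j • a (t - 1 - j) +
      (if (i : ℕ) = 0 then (1 : ℝ) else 0) • innovation φ a t := by
  by_cases hi : (i : ℕ) = 0
  · simp only [companion, Matrix.of_apply, hi, if_true, one_smul, innovation]
    simp only [← sub_sub, sub_right_comm t _ (1 : ℤ)]
    simp
  · rw [if_neg hi, zero_smul, add_zero]
    set j : Fin p := ⟨(i : ℕ) - 1, by omega⟩
    rw [Finset.sum_eq_single j]
    · have hj : (j : ℕ) + 1 = i := by simp [j]; omega
      simp only [companion, Matrix.of_apply, hi, if_false, hj, if_true, one_smul]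
      congr 1; omega
    · intro k _ hk
      have : ¬ (k : ℕ) + 1 = i := fun h' => hk (Fin.ext (by simp [j]; omega))
      simp [companion, this, hi]
    · simp

/-- Iterating the state recursion moves the remainder back one step at a time. The weights depend on
neither the sequence nor the time, so one expansion serves random variables and covariances alike.
-/
lemma exists_ar_expansion {p : ℕ} (φ : Fin p → ℝ) (n : ℕ) :
    ∃ ψ : ℕ → ℝ, ∀ (a : ℤ → V) (t : ℤ),
      a t = ∑ j ∈ Finset.range (n + 1), ψ j • innovation φ a (t - j) +
        ∑ k : Fin p, arRemainder φ n k • a (t - n - 1 - k) := by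
  induction n with
  | zero =>
    refine ⟨fun _ => 1, fun a t => ?_⟩
    simp only [arRemainder, innovation]
    simp [← sub_sub, sub_right_comm t _ (1 : ℤ)]
  | succ n ih =>
    obtain ⟨ψ, hψ⟩ := ih
    -- The zeroth entry of the remainder, written as a sum so that it makes sense for `p = 0`.
    set c := ∑ k : Fin p, arRemainder φ n k * (if (k : ℕ) = 0 then (1 : ℝ) else 0)
    refine ⟨Function.update ψ (n + 1) c, fun a t => ?_⟩
    rw [Finset.sum_range_succ, Function.update_self]
    have h1 : ∑ j ∈ Finset.range (n + 1), Function.update ψ (n + 1) c j • innovation φ a (t - j) =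
        ∑ j ∈ Finset.range (n + 1), ψ j • innovation φ a (t - j) :=
      Finset.sum_congr rfl fun j hj => by
        rw [Function.update_of_ne (by simp at hj; omega)]
    have h2 : ∑ k : Fin p, arRemainder φ n k • a (t - n - 1 - k) =
        ∑ k, arRemainder φ (n + 1) k • a (t - (n + 1 : ℕ) - 1 - k) +
          c • innovation φ a (t - (n + 1 : ℕ)) := by
      have h3 : arRemainder φ (n + 1) = Matrix.vecMul (arRemainder φ n) (companion φ) := by
        rw [arRemainder, arRemainder, pow_succ, Matrix.vecMul_vecMul]
      rw [h3]
      simp only [Matrix.vecMul, dotProduct, Finset.sum_smul, c]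
      rw [Finset.sum_comm, ← Finset.sum_add_distrib]
      refine Finset.sum_congr rfl fun k _ => ?_
      rw [state_eq φ a (t - n - 1) k, smul_add, Finset.smul_sum]
      simp only [smul_smul]
      push_cast
      simp only [← sub_sub]
    rw [h1]
    conv_lhs => rw [hψ a t, h2]
    abel

/-- Causality: a bounded solution of a stable autoregression lies in the closed span of the past
innovations. -/
lemma mem_of_innovation_mem {V : Type*} [NormedAddCommGroup V] [NormedSpace ℝ V] {p : ℕ}
    {φ : Fin p → ℝ} (h : ∀ z : ℂ, ‖z‖ ≤ 1 → 1 - ∑ j, (φ j : ℂ) * z ^ ((j : ℕ) + 1) ≠ 0)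
    {a : ℤ → V} {C : ℝ} (hC : ∀ t, ‖a t‖ ≤ C) {K : Submodule ℝ V} (hK : IsClosed (K : Set V))
    {t : ℤ} (hz : ∀ s ≤ t, innovation φ a s ∈ K) : a t ∈ K := by
  choose ψ hψ using fun n => exists_ar_expansion (V := V) φ n
  -- Boundedness in the remote past excludes solutions of the homogeneous equation that grow
  -- backwards in time.
  have h1 : Tendsto (fun n : ℕ => ∑ k : Fin p, arRemainder φ n k • a (t - n - 1 - k)) atTop
      (𝓝 0) := by
    have h2 : Tendsto (fun n : ℕ => ∑ k : Fin p, |arRemainder φ n k| * C) atTop (𝓝 0) := by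
      have := tendsto_finsetSum (Finset.univ : Finset (Fin p)) fun k _ =>
        ((tendsto_arRemainder h k).abs.mul_const C)
      simpa using this
    refine squeeze_zero_norm (fun n => ?_) h2
    refine (norm_sum_le _ _).trans (Finset.sum_le_sum fun k _ => ?_)
    rw [norm_smul, Real.norm_eq_abs]
    exact mul_le_mul_of_nonneg_left (hC _) (abs_nonneg _)
  have h3 : Tendsto (fun n : ℕ => ∑ j ∈ Finset.range (n + 1), ψ n j • innovation φ a (t - j)) atTop
      (𝓝 (a t)) := by
    have h4 : ∀ n : ℕ, ∑ j ∈ Finset.range (n + 1), ψ n j • innovation φ a (t - j) =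
        a t - ∑ k : Fin p, arRemainder φ n k • a (t - n - 1 - k) := fun n =>
      eq_sub_of_add_eq (hψ n a t).symm
    simp_rw [h4]
    simpa using tendsto_const_nhds.sub h1
  refine hK.mem_of_tendsto h3 (Eventually.of_forall fun n => ?_)
  exact Submodule.sum_mem _ fun j _ => Submodule.smul_mem _ _ (hz _ (by omega))

/-- Solutions of the homogeneous stable recursion tend to zero. -/
lemma tendsto_zero_of_innovation_eq_zero {p : ℕ}
    {φ : Fin p → ℝ} (h : ∀ z : ℂ, ‖z‖ ≤ 1 → 1 - ∑ j, (φ j : ℂ) * z ^ ((j : ℕ) + 1) ≠ 0)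
    {γ : ℤ → ℝ} (hz : ∀ t, 1 ≤ t → innovation φ γ t = 0) :
    Tendsto (fun n : ℕ => γ n) atTop (𝓝 0) := by
  choose ψ hψ using fun n => exists_ar_expansion (V := ℝ) φ n
  rw [← tendsto_add_atTop_iff_nat 1]
  -- Expanding time `n + 1` over `n` steps uses exactly the innovations at times `1, …, n + 1`, and
  -- the remainder sits at the fixed times `0, -1, …`.
  have h1 : ∀ n : ℕ, γ ((n + 1 : ℕ) : ℤ) = ∑ k : Fin p, arRemainder φ n k * γ (-(k : ℤ)) := by
    intro n
    rw [hψ n γ, Finset.sum_eq_zero, zero_add]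
    · refine Finset.sum_congr rfl fun k _ => ?_
      rw [smul_eq_mul]; congr 2; push_cast; ring
    · intro j hj
      rw [hz _ (by simp at hj; push_cast; omega), smul_zero]
  simp_rw [h1]
  have := tendsto_finsetSum (Finset.univ : Finset (Fin p)) fun k _ =>
        ((tendsto_arRemainder h k).mul_const (γ (-(k : ℤ))))
  simpa using this

end Autoregression

/-! ### Harmonic coefficients -/

/-- A real orthonormal basis of the spherical harmonics of degree `l`. -/
def harmonic (l : ℕ) : Fin (2 * l + 1) → C(S2, ℝ) := (exists_orthonormal_harmonics l).choose

lemma harmonic_mem (l : ℕ) (m : Fin (2 * l + 1)) : harmonic l m ∈ harmonicSpace l :=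
  (exists_orthonormal_harmonics l).choose_spec.1 m

lemma integral_harmonic_mul (l : ℕ) (m n : Fin (2 * l + 1)) :
    ∫ y, harmonic l m y * harmonic l n y ∂surf = if m = n then 1 else 0 :=
  (exists_orthonormal_harmonics l).choose_spec.2.1 m n

/-- The addition formula. -/
lemma sum_harmonic_mul (l : ℕ) (x y : S2) : ∑ m, harmonic l m x * harmonic l m y =
    (2 * l + 1) / (4 * Real.pi) * (legendreP l).eval (dot x y) :=
  (exists_orthonormal_harmonics l).choose_spec.2.2 x y

lemma exists_abs_le (Y : C(S2, ℝ)) : ∃ M, ∀ x, |Y x| ≤ M :=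
  ⟨‖Y‖, fun x => Y.norm_coe_le_norm x⟩

/-- Cauchy–Schwarz in the addition formula, whose diagonal value is governed by `P_l(1) = 1`. -/
lemma abs_eval_legendreP_dot_le (l : ℕ) (x y : S2) : |(legendreP l).eval (dot x y)| ≤ 1 := by
  have hpi := Real.pi_pos
  have h1 := Finset.sum_mul_sq_le_sq_mul_sq Finset.univ (fun m => harmonic l m x)
    (fun m => harmonic l m y)
  simp only [sq (harmonic l _ _)] at h1
  rw [sum_harmonic_mul, sum_harmonic_mul, sum_harmonic_mul, dot_self, dot_self, eval_one_legendreP,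
    mul_one, mul_pow, ← sq] at h1
  have h2 : (0 : ℝ) < ((2 * l + 1) / (4 * Real.pi)) ^ 2 := by positivity
  rw [← sq_le_one_iff_abs_le_one]
  nlinarith

/-- A point of the sphere at height `z` (clamped to `[-1,1]`). -/
def pointAt (z : ℝ) : S2 :=
  ⟨!₂[√(1 - (max (-1) (min 1 z)) ^ 2), 0, max (-1) (min 1 z)], by
    have h1 : (-1 : ℝ) ≤ max (-1) (min 1 z) := le_max_left _ _
    have h2 : max (-1) (min 1 z) ≤ (1 : ℝ) := max_le (by norm_num) (min_le_left _ _)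
    have h3 : (max (-1) (min 1 z)) ^ 2 ≤ (1 : ℝ) := by nlinarith
    rw [mem_sphere_zero_iff_norm, EuclideanSpace.norm_eq, Fin.sum_univ_three]
    simp [Real.sq_sqrt (sub_nonneg.2 h3)]⟩

lemma continuous_pointAt : Continuous pointAt := by
  unfold pointAt
  refine Continuous.subtype_mk ?_ _
  refine (PiLp.continuous_toLp 2 _).comp (continuous_pi fun i => ?_)
  fin_cases i
  · simp; fun_prop
  · simp; fun_prop
  · simp; fun_prop

lemma dot_north_pointAt {z : ℝ} (hz : z ∈ Icc (-1 : ℝ) 1) : dot north (pointAt z) = z := by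
  rw [dot_comm, dot_north]
  simp [pointAt, hz.1, hz.2]

lemma abs_eval_legendreP_le (l : ℕ) {z : ℝ} (hz : z ∈ Icc (-1 : ℝ) 1) :
    |(legendreP l).eval z| ≤ 1 := by
  rw [← dot_north_pointAt hz]; exact abs_eval_legendreP_dot_le l _ _

lemma legendreCoeff_congr {f g : ℝ → ℝ} (h : ∀ᵐ z : ℝ, z ∈ Icc (-1 : ℝ) 1 → f z = g z) (l : ℕ) :
    legendreCoeff f l = legendreCoeff g l := by
  rw [legendreCoeff, legendreCoeff]
  congr 1
  refine intervalIntegral.integral_congr_ae ?_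
  filter_upwards [h] with z hz hz1
  rw [uIoc_of_le (by norm_num)] at hz1
  rw [hz (Ioc_subset_Icc_self hz1)]

/-- Termwise integration, dominated by `|c m|` because Legendre polynomials are bounded by 1 on the
interval. -/
lemma legendreCoeff_tsum {c : ℕ → ℝ} (hc : Summable c) (l : ℕ) :
    legendreCoeff (fun z => ∑' m, c m * (legendreP m).eval z) l = 4 * Real.pi / (2 * l + 1) * c l := by
  have habs : Summable fun m => |c m| := hc.abs
  have h := intervalIntegral.hasSum_integral_of_dominated_convergence (μ := volume)
    (a := (-1 : ℝ)) (b := 1)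
    (F := fun m z => c m * (legendreP m).eval z * (legendreP l).eval z)
    (f := fun z => (∑' m, c m * (legendreP m).eval z) * (legendreP l).eval z)
    (bound := fun m _ => |c m|)
    (fun m => by fun_prop)
    (fun m => Eventually.of_forall fun z hz => by
      rw [uIoc_of_le (by norm_num)] at hz
      have h1 := abs_eval_legendreP_le m (Ioc_subset_Icc_self hz)
      have h2 := abs_eval_legendreP_le l (Ioc_subset_Icc_self hz)
      rw [Real.norm_eq_abs, abs_mul, abs_mul, mul_assoc]
      exact mul_le_of_le_one_right (abs_nonneg _) (mul_le_one₀ h1 (abs_nonneg _) h2))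
    (Eventually.of_forall fun z _ => habs)
    (by simp)
    (Eventually.of_forall fun z hz => by
      rw [uIoc_of_le (by norm_num)] at hz
      refine (Summable.hasSum ?_).mul_right _
      refine Summable.of_norm_bounded habs fun m => ?_
      rw [Real.norm_eq_abs, abs_mul]
      exact mul_le_of_le_one_right (abs_nonneg _) (abs_eval_legendreP_le m (Ioc_subset_Icc_self hz)))
  simp only [mul_assoc, intervalIntegral.integral_const_mul] at h
  have h2 := h.unique (hasSum_single l fun m hm => by
    rw [integral_legendreP_mul_legendreP_of_ne hm, mul_zero])
  rw [legendreCoeff, h2, integral_legendreP_sq]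
  ring

lemma integrable_kernel_prod (q : ℝ[X]) {f : S2 → ℝ} (hf : Integrable f surf) (Y : C(S2, ℝ)) :
    Integrable (fun w : S2 × S2 => q.eval (dot w.1 w.2) * f w.2 * Y w.1) (surf.prod surf) := by
  obtain ⟨C, hC⟩ := exists_bound_eval_dot q
  have h1 : Integrable (fun w : S2 × S2 => f w.2) (surf.prod surf) := hf.comp_snd surf
  have h2 : Continuous fun w : S2 × S2 => q.eval (dot w.1 w.2) * Y w.1 := by fun_prop
  have h3 := h1.bdd_mul (c := C * ‖Y‖) h2.aestronglyMeasurable (Eventually.of_forall fun w => by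
    rw [norm_mul]
    exact mul_le_mul (hC _ _) (Y.norm_coe_le_norm _) (norm_nonneg _)
      ((abs_nonneg _).trans (hC w.1 w.2)))
  exact h3.congr (Eventually.of_forall fun w => by ring)

/-- The kernel is symmetric, so Fubini moves it onto `Y`, an eigenfunction by Funk–Hecke. -/
lemma integral_kernelOp_mul (q : ℝ[X]) {f : S2 → ℝ} (hf : Integrable f surf) {l : ℕ}
    {Y : C(S2, ℝ)} (hY : Y ∈ harmonicSpace l) :
    ∫ x, kernelOp (fun z => q.eval z) f x * Y x ∂surf =
      legendreCoeff (fun z => q.eval z) l * ∫ x, f x * Y x ∂surf := by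
  calc _ = ∫ x, ∫ y, q.eval (dot x y) * f y * Y x ∂surf ∂surf := by
        simp only [kernelOp, integral_mul_const]
    _ = ∫ y, ∫ x, q.eval (dot x y) * f y * Y x ∂surf ∂surf :=
        integral_integral_swap (integrable_kernel_prod q hf Y)
    _ = ∫ y, f y * (legendreCoeff (fun z => q.eval z) l * Y y) ∂surf := by
        congr 1; ext y
        rw [← funkHecke_polynomial q hY y, ← integral_const_mul]
        congr 1; ext x
        rw [dot_comm]; ring
    _ = _ := by
        rw [← integral_const_mul]
        congr 1; ext y; ring

lemma integrable_kernelOp_mul (q : ℝ[X]) {f : S2 → ℝ} (hf : Integrable f surf) (Y : C(S2, ℝ)) :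
    Integrable (fun x => kernelOp (fun z => q.eval z) f x * Y x) surf := by
  have h := (integrable_kernel_prod q hf Y).integral_prod_left
  refine h.congr (Eventually.of_forall fun x => ?_)
  simp only [kernelOp, integral_mul_const]

/-- By the hat-box theorem null sets of the interval pull back to null sets of the sphere, whatever
the base point; hence equality at every `x`. -/
lemma kernelOp_congr {k k' : ℝ → ℝ} (h : ∀ᵐ z : ℝ, z ∈ Icc (-1 : ℝ) 1 → k z = k' z)
    (f : S2 → ℝ) (x : S2) : kernelOp k f x = kernelOp k' f x := by
  refine integral_congr_ae ?_
  filter_upwards [ae_comp_dot x h] with y hy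
  rw [hy]

/-- The action of an isotropic polynomial kernel in terms of spherical harmonics. -/
lemma kernelOp_sum_legendreP {f : S2 → ℝ} (hf : Integrable f surf) (n : ℕ) (c : ℕ → ℝ) (x : S2) :
    kernelOp (fun z => (∑ l ∈ Finset.range n,
      Polynomial.C ((2 * l + 1) / (4 * Real.pi) * c l) * legendreP l).eval z) f x =
      ∑ l ∈ Finset.range n, ∑ m, c l * (∫ y, f y * harmonic l m y ∂surf) * harmonic l m x := by
  have hint : ∀ Y : C(S2, ℝ), Integrable (fun y => f y * Y y) surf := fun Y =>
    (hf.bdd_mul (c := ‖Y‖) Y.continuous.aestronglyMeasurable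
      (Eventually.of_forall fun y => Y.norm_coe_le_norm y)).congr
      (Eventually.of_forall fun y => mul_comm _ _)
  have h1 : ∀ y, (∑ l ∈ Finset.range n,
      Polynomial.C ((2 * l + 1) / (4 * Real.pi) * c l) * legendreP l).eval (dot x y) * f y =
      ∑ l ∈ Finset.range n, ∑ m, (c l * harmonic l m x) * (f y * harmonic l m y) := fun y => by
    rw [Polynomial.eval_finsetSum, Finset.sum_mul]
    refine Finset.sum_congr rfl fun l _ => ?_
    rw [Polynomial.eval_mul, Polynomial.eval_C, mul_right_comm _ (c l), ← sum_harmonic_mul,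
      Finset.sum_mul, Finset.sum_mul]
    exact Finset.sum_congr rfl fun m _ => by ring
  simp only [kernelOp, h1]
  rw [integral_finsetSum _ fun l _ => integrable_finsetSum _ fun m _ => (hint _).const_mul _]
  refine Finset.sum_congr rfl fun l _ => ?_
  rw [integral_finsetSum _ fun m _ => (hint _).const_mul _]
  refine Finset.sum_congr rfl fun m _ => ?_
  rw [integral_const_mul]; ring

section Isotropic

variable {Ω : Type*} [mΩ : MeasurableSpace Ω] {P : Measure Ω}

lemma abs_integral_mul_le {f g : Ω → ℝ} (hf : MemLp f 2 P) (hg : MemLp g 2 P) {C : ℝ}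
    (h1 : ∫ ω, f ω ^ 2 ∂P ≤ C) (h2 : ∫ ω, g ω ^ 2 ∂P ≤ C) : |∫ ω, f ω * g ω ∂P| ≤ C := by
  have h3 : ∀ ω, ‖f ω * g ω‖ ≤ 2⁻¹ * f ω ^ 2 + 2⁻¹ * g ω ^ 2 := fun ω => by
    rw [Real.norm_eq_abs, abs_mul, ← sq_abs (f ω), ← sq_abs (g ω)]
    nlinarith [sq_nonneg (|f ω| - |g ω|)]
  have h4 := norm_integral_le_of_norm_le
    ((hf.integrable_sq.const_mul 2⁻¹).add (hg.integrable_sq.const_mul 2⁻¹))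
    (Eventually.of_forall h3)
  have h5 : ∫ ω, (2⁻¹ * f ω ^ 2 + 2⁻¹ * g ω ^ 2) ∂P =
      2⁻¹ * ∫ ω, f ω ^ 2 ∂P + 2⁻¹ * ∫ ω, g ω ^ 2 ∂P := by
    rw [integral_add (hf.integrable_sq.const_mul 2⁻¹) (hg.integrable_sq.const_mul 2⁻¹),
      integral_const_mul, integral_const_mul]
  refine le_trans h4 (le_trans (le_of_eq h5) ?_)
  linarith

/-- The covariance of harmonic coefficients of isotropic random fields. -/
lemma integral_coeff_mul_coeff [IsProbabilityMeasure P] {X X' : S2 → Ω → ℝ} (hX : Measurable fun q : Ω × S2 => X q.2 q.1)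
    (hX' : Measurable fun q : Ω × S2 => X' q.2 q.1) (hi : ∀ s, MemLp (X s) 2 P)
    (hi' : ∀ s, MemLp (X' s) 2 P) {C : ℝ} (hC : ∀ s, ∫ ω, X s ω ^ 2 ∂P ≤ C)
    (hC' : ∀ s, ∫ ω, X' s ω ^ 2 ∂P ≤ C) {G : ℝ → ℝ}
    (hG : ∀ x y, ∫ ω, X x ω * X' y ω ∂P = G (dot x y)) {l : ℕ} {Y : C(S2, ℝ)}
    (hY : Y ∈ harmonicSpace l) (Y' : C(S2, ℝ)) :
    ∫ ω, (∫ x, X x ω * Y' x ∂surf) * (∫ x, X' x ω * Y x ∂surf) ∂P =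
      legendreCoeff G l * ∫ x, Y x * Y' x ∂surf := by
  -- `G` is not known to be measurable or bounded. Reading the covariance along a continuous curve
  -- of points of height `z` gives a function that is both and agrees with `G` on `[-1,1]`.
  set G' : ℝ → ℝ := fun z => ∫ ω, X north ω * X' (pointAt z) ω ∂P with hG'
  have hG'm : Measurable G' := by
    have h : StronglyMeasurable fun q : ℝ × Ω => X north q.2 * X' (pointAt q.1) q.2 := by
      refine Measurable.stronglyMeasurable (Measurable.mul ?_ ?_)
      · exact hX.comp (measurable_snd.prodMk measurable_const)
      · exact hX'.comp (measurable_snd.prodMk (continuous_pointAt.measurable.comp measurable_fst))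
    exact h.integral_prod_right.measurable
  have hG'b : ∀ z, |G' z| ≤ C := fun z => abs_integral_mul_le (hi _) (hi' _) (hC _) (hC' _)
  have hGG' : ∀ z ∈ Icc (-1 : ℝ) 1, G' z = G z := fun z hz => by
    rw [hG']; simp only []; rw [hG, dot_north_pointAt hz]
  rw [← legendreCoeff_congr (Eventually.of_forall hGG') l]
  obtain ⟨M, hM⟩ := exists_abs_le Y
  obtain ⟨M', hM'⟩ := exists_abs_le Y'
  have hYm := Y.continuous.measurable
  have hY'm := Y'.continuous.measurable
  have h1 := integral_mul_integral_field (σ := surf) hX hi hC hY'm hM'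
    (memLp_integral_mul (σ := surf) hX' hi' hC' hYm hM)
  simp_rw [mul_comm (∫ x, X x _ * Y' x ∂surf)]
  rw [h1, ← integral_const_mul]
  congr 1; ext x
  have h2 := integral_mul_integral_field (σ := surf) hX' hi' hC' hYm hM (hi x)
  simp_rw [mul_comm (∫ s, X' s _ * Y s ∂surf)]
  rw [h2]
  have h3 := funkHecke hG'm hG'b hY x
  have h4 : ∫ y, (∫ ω, X x ω * X' y ω ∂P) * Y y ∂surf = ∫ y, G' (dot x y) * Y y ∂surf := by
    congr 1; ext y
    rw [hG, hGG' _ (dot_mem_Icc x y)]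
  rw [h4, h3]; ring

end Isotropic

/-! ### Harmonic coefficients of second order random fields -/

section SecondOrder

variable {Ω : Type*} [mΩ : MeasurableSpace Ω] {P : Measure Ω}

/-- A jointly measurable random field on the sphere with bounded second moments. -/
structure IsSecondOrder (P : Measure Ω) (X : S2 → Ω → ℝ) : Prop where
  measurable : Measurable fun q : Ω × S2 => X q.2 q.1
  memLp : ∀ x, MemLp (X x) 2 P
  exists_le : ∃ C, ∀ x, ∫ ω, X x ω ^ 2 ∂P ≤ C

variable [IsProbabilityMeasure P] {X X' : S2 → Ω → ℝ}

lemma IsSecondOrder.memLp_coeff (h : IsSecondOrder P X) (Y : C(S2, ℝ)) :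
    MemLp (fun ω => ∫ x, X x ω * Y x ∂surf) 2 P := by
  obtain ⟨C, hC⟩ := h.exists_le
  obtain ⟨M, hM⟩ := exists_abs_le Y
  exact memLp_integral_mul h.measurable h.memLp hC Y.continuous.measurable hM

/-- The coefficient of a random field with respect to a continuous function. -/
def IsSecondOrder.coeff (h : IsSecondOrder P X) (Y : C(S2, ℝ)) : Lp ℝ 2 P :=
  (h.memLp_coeff Y).toLp _

lemma IsSecondOrder.coeFn_coeff (h : IsSecondOrder P X) (Y : C(S2, ℝ)) :
    h.coeff Y =ᵐ[P] fun ω => ∫ x, X x ω * Y x ∂surf := MemLp.coeFn_toLp _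

lemma IsSecondOrder.ae_memLp (h : IsSecondOrder P X) :
    ∀ᵐ ω ∂P, MemLp (fun x => X x ω) 2 surf := by
  obtain ⟨C, hC⟩ := h.exists_le
  exact ae_memLp_two h.measurable h.memLp hC

lemma IsSecondOrder.coeff_mem_closedSpan (h : IsSecondOrder P X) (Y : C(S2, ℝ)) {ι : Type*}
    {V : ι → Ω → ℝ} (hV : ∀ i, MemLp (V i) 2 P) (e : S2 → ι) (he : ∀ x, X x = V (e x)) :
    h.coeff Y ∈ closedSpan hV := by
  obtain ⟨C, hC⟩ := h.exists_le
  obtain ⟨M, hM⟩ := exists_abs_le Y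
  exact integral_mul_mem_closedSpan hV he h.measurable h.memLp hC Y.continuous.measurable hM

lemma IsSecondOrder.inner_coeff (h : IsSecondOrder P X) (h' : IsSecondOrder P X') {G : ℝ → ℝ}
    (hG : ∀ x y, ∫ ω, X x ω * X' y ω ∂P = G (dot x y)) {l : ℕ} {Y : C(S2, ℝ)}
    (hY : Y ∈ harmonicSpace l) (Y' : C(S2, ℝ)) :
    inner ℝ (h.coeff Y') (h'.coeff Y) = legendreCoeff G l * ∫ x, Y x * Y' x ∂surf := by
  obtain ⟨C, hC⟩ := h.exists_le
  obtain ⟨C', hC'⟩ := h'.exists_le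
  rw [← integral_coeff_mul_coeff h.measurable h'.measurable h.memLp h'.memLp
    (fun s => (hC s).trans (le_max_left C C')) (fun s => (hC' s).trans (le_max_right C C')) hG hY Y',
    inner_eq_integral]
  refine integral_congr_ae ?_
  filter_upwards [h.coeFn_coeff Y', h'.coeFn_coeff Y] with ω h1 h2
  rw [h1, h2]

end SecondOrder

lemma integral_harmonic_mul_eq {l l' : ℕ} (m : Fin (2 * l + 1)) (m' : Fin (2 * l' + 1)) :
    ∫ x, harmonic l m x * harmonic l' m' x ∂surf =
      if (⟨l, m⟩ : Σ l : ℕ, Fin (2 * l + 1)) = ⟨l', m'⟩ then 1 else 0 := by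
  by_cases h : l = l'
  · subst h
    rw [integral_harmonic_mul]
    by_cases h2 : m = m' <;> simp [h2]
  · rw [integral_mul_eq_zero_of_ne h (harmonic_mem l m) (harmonic_mem l' m'), if_neg]
    intro h2
    exact h (congrArg Sigma.fst h2)

/-! ### Harmonic coefficients of the autoregressive model -/

section Model

variable {Ω : Type*} [mΩ : MeasurableSpace Ω] {P : Measure Ω}
  {p L : ℕ} {k : Fin p → ℝ → ℝ} {T Z : S2 → ℤ → Ω → ℝ} {Γ₀ : ℝ → ℤ → ℝ} {CZ : ℕ → ℝ}

lemma IsGaussianIsotropicStationary.memLp (hT : IsGaussianIsotropicStationary P T Γ₀) (x : S2)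
    (t : ℤ) : MemLp (T x t) 2 P :=
  (hT.gaussian.hasGaussianLaw_eval (x, t)).memLp_two

lemma IsSphericalWhiteNoise.memLp (hZ : IsSphericalWhiteNoise P Z CZ) (x : S2)
    (t : ℤ) : MemLp (Z x t) 2 P :=
  ((hZ.gaussian t).hasGaussianLaw_eval x).memLp_two

/-- The `σ`-algebra generated by the noise at time `t`. -/
@[reducible]
def noiseSigma {Ω : Type*} (Z : S2 → ℤ → Ω → ℝ) (t : ℤ) : MeasurableSpace Ω :=
  MeasurableSpace.comap (fun ω x => Z x t ω) inferInstance

/-- The `σ`-algebra generated by the noise up to time `t`. -/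
@[reducible]
def pastSigma {Ω : Type*} (Z : S2 → ℤ → Ω → ℝ) (t : ℤ) : MeasurableSpace Ω :=
  ⨆ s ∈ Iic t, noiseSigma Z s

lemma IsSphericalWhiteNoise.measurable_eval (hZ : IsSphericalWhiteNoise P Z CZ) (x : S2) (t : ℤ) :
    Measurable (Z x t) :=
  hZ.measurable.comp (g := fun q : Ω × S2 × ℤ => Z q.2.1 q.2.2 q.1) (f := fun ω => (ω, x, t))
    (measurable_id.prodMk measurable_const)

lemma IsSphericalWhiteNoise.noiseSigma_le (hZ : IsSphericalWhiteNoise P Z CZ) (t : ℤ) :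
    noiseSigma Z t ≤ mΩ :=
  (measurable_pi_lambda _ fun x => hZ.measurable_eval x t).comap_le

lemma IsSphericalWhiteNoise.pastSigma_le (hZ : IsSphericalWhiteNoise P Z CZ) (t : ℤ) :
    pastSigma Z t ≤ mΩ := iSup₂_le fun s _ => hZ.noiseSigma_le s

lemma noiseSigma_le_pastSigma {Ω : Type*} (Z : S2 → ℤ → Ω → ℝ) {s t : ℤ} (h : s ≤ t) :
    noiseSigma Z s ≤ pastSigma Z t := le_iSup₂_of_le (f := fun s (_ : s ∈ Iic t) => noiseSigma Z s) s h le_rfl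

lemma pastSigma_mono {Ω : Type*} (Z : S2 → ℤ → Ω → ℝ) : Monotone (pastSigma Z) := fun _ _ h =>
  iSup₂_le fun _ hs => noiseSigma_le_pastSigma Z (le_trans hs h)

lemma IsSphericalWhiteNoise.indep_pastSigma (hZ : IsSphericalWhiteNoise P Z CZ) {s t : ℤ}
    (h : s < t) : Indep (pastSigma Z s) (noiseSigma Z t) P := by
  have h1 := indep_iSup_of_disjoint (S := Iic s) (T := {t}) (fun i => hZ.noiseSigma_le i)
    hZ.indep.iIndep (by simpa using h)
  simpa [pastSigma] using h1

variable [IsProbabilityMeasure P]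

lemma IsGaussianIsotropicStationary.integral_mul (hT : IsGaussianIsotropicStationary P T Γ₀)
    (x y : S2) (t s : ℤ) : ∫ ω, T x t ω * T y s ω ∂P = Γ₀ (dot x y) (t - s) := by
  rw [← hT.covariance_eq, covariance_eq_sub (hT.memLp x t) (hT.memLp y s), hT.mean_zero,
    zero_mul, sub_zero]
  rfl

lemma IsSphericalWhiteNoise.integral_mul (hZ : IsSphericalWhiteNoise P Z CZ)
    (x y : S2) (t : ℤ) : ∫ ω, Z x t ω * Z y t ω ∂P =
      ∑' l : ℕ, (2 * (l : ℝ) + 1) / (4 * Real.pi) * CZ l * (legendreP l).eval (dot x y) := by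
  rw [(hZ.covariance_eq t x y).tsum_eq, covariance_eq_sub (hZ.memLp x t) (hZ.memLp y t),
    hZ.mean_zero, zero_mul, sub_zero]
  rfl

lemma IsGaussianIsotropicStationary.isSecondOrder (hT : IsGaussianIsotropicStationary P T Γ₀)
    (t : ℤ) : IsSecondOrder P (fun x => T x t) where
  measurable := hT.measurable.comp
    (measurable_fst.prodMk (measurable_snd.prodMk measurable_const))
  memLp x := hT.memLp x t
  exists_le := ⟨Γ₀ 1 0, fun x => le_of_eq (by
    simp_rw [sq]; rw [hT.integral_mul, dot_self, sub_self])⟩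

lemma IsSphericalWhiteNoise.isSecondOrder (hZ : IsSphericalWhiteNoise P Z CZ)
    (t : ℤ) : IsSecondOrder P (fun x => Z x t) where
  measurable := hZ.measurable.comp
    (measurable_fst.prodMk (measurable_snd.prodMk measurable_const))
  memLp x := hZ.memLp x t
  exists_le := ⟨_, fun x => le_of_eq (by
    simp_rw [sq]; rw [hZ.integral_mul, dot_self])⟩

lemma IsGaussianIsotropicStationary.inner_coeff (hT : IsGaussianIsotropicStationary P T Γ₀)
    (t s : ℤ) {l : ℕ} {Y : C(S2, ℝ)} (hY : Y ∈ harmonicSpace l) (Y' : C(S2, ℝ)) :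
    inner ℝ ((hT.isSecondOrder t).coeff Y') ((hT.isSecondOrder s).coeff Y) =
      legendreCoeff (fun z => Γ₀ z (t - s)) l * ∫ x, Y x * Y' x ∂surf :=
  (hT.isSecondOrder t).inner_coeff (hT.isSecondOrder s) (G := fun z => Γ₀ z (t - s))
    (fun x y => hT.integral_mul x y t s) hY Y'

lemma IsSphericalWhiteNoise.inner_coeff (hZ : IsSphericalWhiteNoise P Z CZ)
    (t : ℤ) {l : ℕ} {Y : C(S2, ℝ)} (hY : Y ∈ harmonicSpace l) (Y' : C(S2, ℝ)) :
    inner ℝ ((hZ.isSecondOrder t).coeff Y') ((hZ.isSecondOrder t).coeff Y) =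
      CZ l * ∫ x, Y x * Y' x ∂surf := by
  rw [(hZ.isSecondOrder t).inner_coeff (hZ.isSecondOrder t)
    (G := fun z => ∑' l : ℕ, (2 * (l : ℝ) + 1) / (4 * Real.pi) * CZ l * (legendreP l).eval z)
    (fun x y => hZ.integral_mul x y t) hY Y', legendreCoeff_tsum hZ.summable]
  congr 1
  have := Real.pi_pos
  field_simp

/-- The polynomial version of the `j`-th kernel. -/
def kernelPoly (L : ℕ) (k : ℝ → ℝ) : ℝ[X] := ∑ l ∈ Finset.range (L + 1),
  Polynomial.C ((2 * l + 1) / (4 * Real.pi) * legendreCoeff k l) * legendreP l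

lemma ae_eq_kernelPoly {k : ℝ → ℝ} (hk : MemLp k 2 (volume.restrict (Icc (-1 : ℝ) 1)))
    (h : ∀ l, L < l → legendreCoeff k l = 0) :
    ∀ᵐ z : ℝ, z ∈ Icc (-1 : ℝ) 1 → k z = (kernelPoly L k).eval z :=
  ae_eq_sum_legendreP hk h

lemma integrable_mul_continuousMap {f : S2 → ℝ} (hf : MemLp f 2 surf) (Y : C(S2, ℝ)) :
    Integrable (fun x => f x * Y x) surf :=
  ((hf.integrable (by norm_num)).bdd_mul (c := ‖Y‖) Y.continuous.aestronglyMeasurable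
    (Eventually.of_forall fun y => Y.norm_coe_le_norm y)).congr
    (Eventually.of_forall fun y => mul_comm _ _)

/-- Integrate the field equation against a harmonic: each operator acts on its degree as a scalar,
which leaves a scalar autoregression. The equality in `L²(Ω × 𝕊²)` is what provides almost every
point of the sphere for almost every `ω`. -/
lemma IsSPHAR.ae_coeff_eq (hAR : IsSPHAR P p k T Z) (hT : IsGaussianIsotropicStationary P T Γ₀)
    (hZ : IsSphericalWhiteNoise P Z CZ)
    (hfinite : ∀ j l, L < l → legendreCoeff (k j) l = 0) (t : ℤ) {l : ℕ} {Y : C(S2, ℝ)}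
    (hY : Y ∈ harmonicSpace l) : ∀ᵐ ω ∂P, ∫ x, T x t ω * Y x ∂surf =
      ∑ j : Fin p, legendreCoeff (k j) l * (∫ x, T x (t - ((j : ℤ) + 1)) ω * Y x ∂surf) +
        ∫ x, Z x t ω * Y x ∂surf := by
  have hTm : ∀ᵐ ω ∂P, ∀ s, MemLp (fun x => T x s ω) 2 surf :=
    ae_all_iff.2 fun s => (hT.isSecondOrder s).ae_memLp
  filter_upwards [hTm, (hZ.isSecondOrder t).ae_memLp, Measure.ae_ae_of_ae_prod (hAR.eq_product t)]
    with ω h1 h2 h3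
  have hq := fun j => ae_eq_kernelPoly (hAR.kernel_memLp j) (hfinite j)
  have h4 : ∀ᵐ x ∂surf, T x t ω * Y x =
      ∑ j : Fin p, kernelOp (fun z => (kernelPoly L (k j)).eval z)
        (fun y => T y (t - ((j : ℤ) + 1)) ω) x * Y x + Z x t ω * Y x := by
    filter_upwards [h3] with x hx
    simp_rw [kernelOp_congr (hq _)] at hx
    rw [← Finset.sum_mul, ← add_mul]
    congr 1
    linarith
  have hint := fun j : Fin p => integrable_kernelOp_mul (kernelPoly L (k j))
    ((h1 (t - ((j : ℤ) + 1))).integrable (by norm_num)) Y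
  rw [integral_congr_ae h4, integral_add (integrable_finsetSum _ fun j _ => hint j)
    (integrable_mul_continuousMap h2 Y), integral_finsetSum _ fun j _ => hint j]
  congr 1
  refine Finset.sum_congr rfl fun j _ => ?_
  rw [integral_kernelOp_mul _ ((h1 _).integrable (by norm_num)) hY,
    legendreCoeff_congr (hq j) l]

/-- The scalar recursion as an identity in `L²(Ω)`, the form to which the abstract causality
argument applies. -/
lemma IsSPHAR.innovation_coeff (hAR : IsSPHAR P p k T Z)
    (hT : IsGaussianIsotropicStationary P T Γ₀) (hZ : IsSphericalWhiteNoise P Z CZ)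
    (hfinite : ∀ j l, L < l → legendreCoeff (k j) l = 0) (t : ℤ) {l : ℕ} {Y : C(S2, ℝ)}
    (hY : Y ∈ harmonicSpace l) :
    innovation (fun j => legendreCoeff (k j) l) (fun s => (hT.isSecondOrder s).coeff Y) t =
      (hZ.isSecondOrder t).coeff Y := by
  rw [innovation, sub_eq_iff_eq_add]
  apply Lp.ext
  have h1 : ∀ᵐ ω ∂P, ∀ s : ℤ, (hT.isSecondOrder s).coeff Y ω = ∫ x, T x s ω * Y x ∂surf :=
    ae_all_iff.2 fun s => (hT.isSecondOrder s).coeFn_coeff Y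
  have h2 : ∀ᵐ ω ∂P, ∀ j : Fin p, (legendreCoeff (k j) l •
      (hT.isSecondOrder (t - ((j : ℤ) + 1))).coeff Y : Lp ℝ 2 P) ω =
      legendreCoeff (k j) l * (hT.isSecondOrder (t - ((j : ℤ) + 1))).coeff Y ω :=
    ae_all_iff.2 fun j => (Lp.coeFn_smul _ _)
  filter_upwards [h1, h2, (hZ.isSecondOrder t).coeFn_coeff Y, hAR.ae_coeff_eq hT hZ hfinite t hY,
    Lp.coeFn_add ((hZ.isSecondOrder t).coeff Y) (∑ j : Fin p, legendreCoeff (k j) l •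
      (hT.isSecondOrder (t - ((j : ℤ) + 1))).coeff Y),
    Lp.coeFn_finsetSum Finset.univ fun j : Fin p => legendreCoeff (k j) l •
      (hT.isSecondOrder (t - ((j : ℤ) + 1))).coeff Y] with ω h1 h2 h3 h4 h5 h6
  rw [h5, Pi.add_apply, h6, Finset.sum_apply, h1, h4, h3, add_comm]
  congr 1
  refine Finset.sum_congr rfl fun j _ => ?_
  rw [h2, h1]

lemma IsSphericalWhiteNoise.coeff_mem (hZ : IsSphericalWhiteNoise P Z CZ) (t : ℤ) (Y : C(S2, ℝ)) :
    (hZ.isSecondOrder t).coeff Y ∈ closedSpan (fun x => hZ.memLp x t) :=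
  (hZ.isSecondOrder t).coeff_mem_closedSpan Y _ id fun _ => rfl

lemma IsGaussianIsotropicStationary.coeff_mem (hT : IsGaussianIsotropicStationary P T Γ₀) (t : ℤ)
    (Y : C(S2, ℝ)) : (hT.isSecondOrder t).coeff Y ∈
      closedSpan (X := fun q : S2 × ℤ => T q.1 q.2) (fun q => hT.memLp q.1 q.2) :=
  (hT.isSecondOrder t).coeff_mem_closedSpan Y _ (fun x => (x, t)) fun _ => rfl

lemma IsGaussianIsotropicStationary.isGaussianSpace (hT : IsGaussianIsotropicStationary P T Γ₀) :
    IsGaussianSpace (closedSpan (X := fun q : S2 × ℤ => T q.1 q.2) (fun q => hT.memLp q.1 q.2)) :=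
  isGaussianSpace_closedSpan _ hT.gaussian fun q => hT.mean_zero q.1 q.2

lemma IsSphericalWhiteNoise.isGaussianSpace (hZ : IsSphericalWhiteNoise P Z CZ) (t : ℤ) :
    IsGaussianSpace (closedSpan (fun x => hZ.memLp x t)) :=
  isGaussianSpace_closedSpan _ (hZ.gaussian t) fun x => hZ.mean_zero x t

lemma IsSphericalWhiteNoise.aestronglyMeasurable_coeff (hZ : IsSphericalWhiteNoise P Z CZ)
    (t : ℤ) (Y : C(S2, ℝ)) : AEStronglyMeasurable[noiseSigma Z t] ((hZ.isSecondOrder t).coeff Y) P := by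
  refine aestronglyMeasurable_of_mem_closedSpan (fun x => hZ.memLp x t) (hZ.noiseSigma_le t)
    (fun x => ?_) (hZ.coeff_mem t Y)
  have h : Measurable[noiseSigma Z t] (fun ω (x : S2) => Z x t ω) := comap_measurable _
  exact Measurable.stronglyMeasurable ((measurable_pi_apply x).comp h)

lemma StationarityCondition.ne_zero (hstat : StationarityCondition k) (l : ℕ) (z : ℂ)
    (hz : ‖z‖ ≤ 1) :
    1 - ∑ j : Fin p, ((legendreCoeff (k j) l : ℝ) : ℂ) * z ^ ((j : ℕ) + 1) ≠ 0 := by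
  obtain ⟨δ, hδ, h⟩ := hstat
  exact h l z (by linarith)

/-- The coefficients of the autoregressive field are causal functionals of the noise. -/
lemma IsSPHAR.aestronglyMeasurable_coeff (hAR : IsSPHAR P p k T Z)
    (hT : IsGaussianIsotropicStationary P T Γ₀) (hZ : IsSphericalWhiteNoise P Z CZ)
    (hstat : StationarityCondition k)
    (hfinite : ∀ j l, L < l → legendreCoeff (k j) l = 0) (t : ℤ) {l : ℕ} {Y : C(S2, ℝ)}
    (hY : Y ∈ harmonicSpace l) :
    AEStronglyMeasurable[pastSigma Z t] ((hT.isSecondOrder t).coeff Y) P := by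
  have hcl : IsClosed ((lpMeas ℝ ℝ (pastSigma Z t) 2 P : Submodule ℝ (Lp ℝ 2 P)) :
      Set (Lp ℝ 2 P)) := isClosed_aestronglyMeasurable (hZ.pastSigma_le t)
  -- Stationarity makes the norms constant in time, which is the boundedness needed for causality.
  have hb : ∀ s, ‖(hT.isSecondOrder s).coeff Y‖ ≤
      √(legendreCoeff (fun z => Γ₀ z 0) l * ∫ x, Y x * Y x ∂surf) := fun s => by
    rw [← sub_self s, ← hT.inner_coeff s s hY Y, real_inner_self_eq_norm_mul_norm,
      Real.sqrt_mul_self (norm_nonneg _)]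
  have h := mem_of_innovation_mem (hstat.ne_zero l) (a := fun s => (hT.isSecondOrder s).coeff Y)
    hb hcl (t := t) fun s hs => by
      rw [hAR.innovation_coeff hT hZ hfinite s hY, mem_lpMeas_iff_aestronglyMeasurable]
      exact (hZ.aestronglyMeasurable_coeff s Y).mono (noiseSigma_le_pastSigma Z hs)
  exact mem_lpMeas_iff_aestronglyMeasurable.1 h

lemma IsSphericalWhiteNoise.integral_coeff (hZ : IsSphericalWhiteNoise P Z CZ) (t : ℤ)
    (Y : C(S2, ℝ)) : ∫ ω, (hZ.isSecondOrder t).coeff Y ω ∂P = 0 := by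
  obtain ⟨C, hC⟩ := (hZ.isSecondOrder t).exists_le
  obtain ⟨M, hM⟩ := exists_abs_le Y
  have h := integral_mul_integral_field (σ := surf) (hZ.isSecondOrder t).measurable
    (hZ.isSecondOrder t).memLp hC Y.continuous.measurable hM (memLp_const (1 : ℝ))
  simp only [one_mul, hZ.mean_zero, zero_mul, integral_zero] at h
  rw [← h]
  exact integral_congr_ae ((hZ.isSecondOrder t).coeFn_coeff Y)

/-- The noise is orthogonal to the past of the autoregressive field. -/
lemma IsSPHAR.inner_coeff_noise (hAR : IsSPHAR P p k T Z)
    (hT : IsGaussianIsotropicStationary P T Γ₀) (hZ : IsSphericalWhiteNoise P Z CZ)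
    (hstat : StationarityCondition k)
    (hfinite : ∀ j l, L < l → legendreCoeff (k j) l = 0) {s t : ℤ} (hst : s < t) {l : ℕ}
    {Y : C(S2, ℝ)} (hY : Y ∈ harmonicSpace l) (Y' : C(S2, ℝ)) :
    inner ℝ ((hT.isSecondOrder s).coeff Y) ((hZ.isSecondOrder t).coeff Y') = 0 := by
  have h1 := hAR.aestronglyMeasurable_coeff hT hZ hstat hfinite s hY
  have h2 := hZ.aestronglyMeasurable_coeff t Y'
  have hind : IndepFun (h1.mk _) (h2.mk _) P := by
    rw [IndepFun_iff_Indep]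
    exact indep_of_indep_of_le_left (indep_of_indep_of_le_right (hZ.indep_pastSigma hst)
      h2.stronglyMeasurable_mk.measurable.comap_le) h1.stronglyMeasurable_mk.measurable.comap_le
  have hm1 : AEStronglyMeasurable (h1.mk _) P :=
    (h1.stronglyMeasurable_mk.mono (hZ.pastSigma_le s)).aestronglyMeasurable
  have hm2 : AEStronglyMeasurable (h2.mk _) P :=
    (h2.stronglyMeasurable_mk.mono (hZ.noiseSigma_le t)).aestronglyMeasurable
  rw [inner_eq_integral]
  calc _ = ∫ ω, h1.mk _ ω * h2.mk _ ω ∂P := by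
        refine integral_congr_ae ?_
        filter_upwards [h1.ae_eq_mk, h2.ae_eq_mk] with ω e1 e2
        rw [e1, e2]
    _ = (∫ ω, h1.mk _ ω ∂P) * ∫ ω, h2.mk _ ω ∂P := hind.integral_fun_mul_eq_mul_integral hm1 hm2
    _ = (∫ ω, h1.mk _ ω ∂P) * ∫ ω, (hZ.isSecondOrder t).coeff Y' ω ∂P := by
        rw [integral_congr_ae h2.ae_eq_mk.symm]
    _ = 0 := by rw [hZ.integral_coeff, mul_zero]

/-- The autocovariance function of the coefficients of degree `l`. -/
def autocov (Γ₀ : ℝ → ℤ → ℝ) (l : ℕ) (τ : ℤ) : ℝ := legendreCoeff (fun z => Γ₀ z τ) l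

lemma IsGaussianIsotropicStationary.inner_harmonic (hT : IsGaussianIsotropicStationary P T Γ₀)
    (t s : ℤ) {l l' : ℕ} (m : Fin (2 * l + 1)) (m' : Fin (2 * l' + 1)) :
    inner ℝ ((hT.isSecondOrder t).coeff (harmonic l m)) ((hT.isSecondOrder s).coeff (harmonic l' m')) =
      if (⟨l, m⟩ : Σ l : ℕ, Fin (2 * l + 1)) = ⟨l', m'⟩ then autocov Γ₀ l (t - s) else 0 := by
  rw [hT.inner_coeff t s (harmonic_mem l' m'), integral_harmonic_mul_eq, mul_ite, mul_one, mul_zero]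
  by_cases h : (⟨l, m⟩ : Σ l : ℕ, Fin (2 * l + 1)) = ⟨l', m'⟩
  · have h1 : l = l' := congrArg Sigma.fst h
    rw [if_pos h, if_pos h.symm, autocov, h1]
  · rw [if_neg h, if_neg (Ne.symm h)]

lemma IsSphericalWhiteNoise.inner_harmonic (hZ : IsSphericalWhiteNoise P Z CZ)
    (t : ℤ) {l l' : ℕ} (m : Fin (2 * l + 1)) (m' : Fin (2 * l' + 1)) :
    inner ℝ ((hZ.isSecondOrder t).coeff (harmonic l m)) ((hZ.isSecondOrder t).coeff (harmonic l' m')) =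
      if (⟨l, m⟩ : Σ l : ℕ, Fin (2 * l + 1)) = ⟨l', m'⟩ then CZ l else 0 := by
  rw [hZ.inner_coeff t (harmonic_mem l' m'), integral_harmonic_mul_eq, mul_ite, mul_one, mul_zero]
  by_cases h : (⟨l, m⟩ : Σ l : ℕ, Fin (2 * l + 1)) = ⟨l', m'⟩
  · have h1 : l = l' := congrArg Sigma.fst h
    rw [if_pos h, if_pos h.symm, h1]
  · rw [if_neg h, if_neg (Ne.symm h)]

lemma IsGaussianIsotropicStationary.autocov_neg (hT : IsGaussianIsotropicStationary P T Γ₀)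
    (l : ℕ) (τ : ℤ) : autocov Γ₀ l (-τ) = autocov Γ₀ l τ := by
  have h1 := hT.inner_harmonic 0 τ (l' := l) (0 : Fin (2 * l + 1)) 0
  have h2 := hT.inner_harmonic τ 0 (l' := l) (0 : Fin (2 * l + 1)) 0
  rw [if_pos rfl] at h1 h2
  rw [real_inner_comm, h2] at h1
  simpa using h1.symm

lemma IsGaussianIsotropicStationary.autocovMatrix_apply
    (hT : IsGaussianIsotropicStationary P T Γ₀) (l : ℕ) (i j : Fin p) :
    autocovMatrix p Γ₀ l i j = autocov Γ₀ l ((i : ℤ) - j) := by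
  change autocov Γ₀ l |(i : ℤ) - (j : ℤ)| = _
  rcases abs_choice ((i : ℤ) - j) with h | h <;> rw [h]
  exact hT.autocov_neg l _

/-- The autocovariance function of the coefficients vanishes at infinity. -/
lemma IsSPHAR.tendsto_autocov (hAR : IsSPHAR P p k T Z)
    (hT : IsGaussianIsotropicStationary P T Γ₀) (hZ : IsSphericalWhiteNoise P Z CZ)
    (hstat : StationarityCondition k)
    (hfinite : ∀ j l, L < l → legendreCoeff (k j) l = 0) (l : ℕ) :
    Tendsto (fun n : ℕ => autocov Γ₀ l n) atTop (𝓝 0) := by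
  refine tendsto_zero_of_innovation_eq_zero (hstat.ne_zero l) fun t ht => ?_
  have hY := harmonic_mem l 0
  have h1 : ∀ s, autocov Γ₀ l s = inner ℝ ((hT.isSecondOrder 0).coeff (harmonic l 0))
      ((hT.isSecondOrder s).coeff (harmonic l 0)) := fun s => by
    rw [hT.inner_harmonic, if_pos rfl, ← hT.autocov_neg]; simp
  -- Yule–Walker: the noise at `t ≥ 1` is orthogonal to the field at time 0, so the autocovariances
  -- solve the homogeneous recursion.
  have h2 := hAR.inner_coeff_noise hT hZ hstat hfinite (show (0 : ℤ) < t by omega) hY (harmonic l 0)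
  rw [← hAR.innovation_coeff hT hZ hfinite t hY, innovation, inner_sub_right, inner_sum] at h2
  simp_rw [inner_smul_right, ← h1] at h2
  exact h2

/-- The autoregressive part is a combination of earlier coefficients, orthogonal to the noise; only
the noise itself contributes. -/
lemma IsSPHAR.inner_coeff_noise_self (hAR : IsSPHAR P p k T Z)
    (hT : IsGaussianIsotropicStationary P T Γ₀) (hZ : IsSphericalWhiteNoise P Z CZ)
    (hstat : StationarityCondition k)
    (hfinite : ∀ j l, L < l → legendreCoeff (k j) l = 0) (t : ℤ) {l : ℕ} (m : Fin (2 * l + 1)) :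
    inner ℝ ((hT.isSecondOrder t).coeff (harmonic l m)) ((hZ.isSecondOrder t).coeff (harmonic l m)) =
      CZ l := by
  have h1 := hAR.innovation_coeff hT hZ hfinite t (harmonic_mem l m)
  rw [innovation, sub_eq_iff_eq_add] at h1
  rw [h1, inner_add_left, sum_inner, Finset.sum_eq_zero, add_zero, hZ.inner_harmonic, if_pos rfl]
  intro j _
  rw [inner_smul_left, hAR.inner_coeff_noise hT hZ hstat hfinite (by omega) (harmonic_mem l m),
    mul_zero]

/-- The quadratic form is the squared norm of a combination of values at consecutive times. Were it
zero, pairing with the noise at the latest time involved would force the corresponding coefficient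
to vanish. -/
lemma IsSPHAR.posDef_autocovMatrix (hAR : IsSPHAR P p k T Z)
    (hT : IsGaussianIsotropicStationary P T Γ₀) (hZ : IsSphericalWhiteNoise P Z CZ)
    (hstat : StationarityCondition k) (hident : ∀ l, 0 < CZ l)
    (hfinite : ∀ j l, L < l → legendreCoeff (k j) l = 0) (l : ℕ) :
    (autocovMatrix p Γ₀ l).PosDef := by
  set a : ℤ → Lp ℝ 2 P := fun s => (hT.isSecondOrder s).coeff (harmonic l 0) with ha
  have hinner : ∀ t s, inner ℝ (a t) (a s) = autocov Γ₀ l (t - s) := fun t s => by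
    rw [ha]; simp only; rw [hT.inner_harmonic, if_pos rfl]
  have hquad : ∀ c : Fin p → ℝ, c ⬝ᵥ (autocovMatrix p Γ₀ l).mulVec c =
      ‖∑ i : Fin p, c i • a (-(i : ℤ))‖ ^ 2 := fun c => by
    rw [← real_inner_self_eq_norm_sq, sum_inner]
    refine Finset.sum_congr rfl fun i _ => ?_
    rw [inner_sum, Matrix.mulVec, dotProduct, Finset.mul_sum]
    refine Finset.sum_congr rfl fun j _ => ?_
    rw [inner_smul_left, inner_smul_right, hinner, hT.autocovMatrix_apply, ← hT.autocov_neg]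
    simp only [conj_trivial]
    rw [show -((i : ℤ) - (j : ℤ)) = -(i : ℤ) - -(j : ℤ) by ring]
    ring
  refine Matrix.PosDef.of_dotProduct_mulVec_pos ?_ fun c hc => ?_
  · ext i j
    rw [Matrix.conjTranspose_apply, hT.autocovMatrix_apply, hT.autocovMatrix_apply,
      ← hT.autocov_neg]
    simp
  · rw [star_trivial, hquad]
    refine pow_pos (norm_pos_iff.2 fun h0 => ?_) 2
    -- Index `i` stands for time `-i`, so the smallest index with nonzero coefficient is the latest
    -- time.
    obtain ⟨i, hi, hmin⟩ : ∃ i, c i ≠ 0 ∧ ∀ j < i, c j = 0 := by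
      classical
      have hne : (Finset.univ.filter fun i => c i ≠ 0).Nonempty := by
        by_contra hne
        rw [Finset.not_nonempty_iff_eq_empty, Finset.filter_eq_empty_iff] at hne
        exact hc (funext fun i => by simpa using hne (Finset.mem_univ i))
      refine ⟨_, (Finset.mem_filter.1 (Finset.min'_mem _ hne)).2, fun j hj => ?_⟩
      by_contra hcj
      exact absurd hj (not_lt.2 (Finset.min'_le _ _ (by simp [hcj])))
    have h1 : inner ℝ (∑ i : Fin p, c i • a (-(i : ℤ)))
        ((hZ.isSecondOrder (-(i : ℤ))).coeff (harmonic l 0)) = c i * CZ l := by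
      rw [sum_inner, Finset.sum_eq_single i]
      · rw [inner_smul_left, hAR.inner_coeff_noise_self hT hZ hstat hfinite]; simp
      · intro j _ hj
        rcases lt_or_gt_of_ne hj with h | h
        · simp [hmin j h]
        · rw [inner_smul_left, hAR.inner_coeff_noise hT hZ hstat hfinite
            (by have : (i : ℕ) < j := h; omega) (harmonic_mem l 0), mul_zero]
      · simp
    rw [h0, inner_zero_left] at h1
    exact mul_ne_zero hi (hident l).ne' h1.symm

end Model

/-! ### Convergence in probability to a constant -/

section InMeasure

variable {Ω : Type*} [mΩ : MeasurableSpace Ω] {P : Measure Ω}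

lemma tendstoInMeasure_comp_continuousAt {E F : Type*} [PseudoMetricSpace E] [PseudoMetricSpace F]
    {X : ℕ → Ω → E} {c : E} (h : TendstoInMeasure P X atTop fun _ => c) {g : E → F}
    (hg : ContinuousAt g c) :
    TendstoInMeasure P (fun n ω => g (X n ω)) atTop fun _ => g c := by
  rw [tendstoInMeasure_iff_dist] at h ⊢
  intro ε hε
  obtain ⟨δ, hδ, hδε⟩ := Metric.continuousAt_iff.1 hg ε hε
  refine tendsto_of_tendsto_of_tendsto_of_le_of_le tendsto_const_nhds (h δ hδ)
    (fun _ => zero_le) fun n => measure_mono fun ω hω => ?_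
  simp only [mem_ofPred_eq] at hω ⊢
  by_contra! hlt
  exact absurd (hδε hlt) (not_lt.2 hω)

lemma tendstoInMeasure_pi {ι : Type*} [Fintype ι] {E : ι → Type*} [∀ i, PseudoMetricSpace (E i)]
    {X : ℕ → Ω → ∀ i, E i} {c : ∀ i, E i}
    (h : ∀ i, TendstoInMeasure P (fun n ω => X n ω i) atTop fun _ => c i) :
    TendstoInMeasure P X atTop fun _ => c := by
  simp only [tendstoInMeasure_iff_dist] at h ⊢
  intro ε hε
  have h1 : Tendsto (fun n => ∑ i, P {ω | ε ≤ dist (X n ω i) (c i)}) atTop (𝓝 0) := by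
    simpa using tendsto_finsetSum Finset.univ fun i _ => h i ε hε
  refine tendsto_of_tendsto_of_tendsto_of_le_of_le tendsto_const_nhds h1
    (fun _ => zero_le) fun n => ?_
  refine le_trans (measure_mono fun ω hω => ?_) (measure_iUnion_fintype_le _ _)
  simp only [mem_iUnion, mem_ofPred_eq] at hω ⊢
  by_contra! hlt
  exact absurd ((dist_pi_lt_iff hε).2 hlt) (not_lt.2 hω)

lemma tendsto_intCast_add {γ : ℤ → ℝ} (h : Tendsto (fun n : ℕ => γ n) atTop (𝓝 0)) (c : ℤ) :
    Tendsto (fun n : ℕ => γ (n + c)) atTop (𝓝 0) := by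
  have h1 : Tendsto (fun n : ℕ => ((n : ℤ) + c).toNat) atTop atTop := by
    refine tendsto_atTop.2 fun b => ?_
    filter_upwards [eventually_ge_atTop (b + c.natAbs)] with n hn
    omega
  refine (h.comp h1).congr' ?_
  filter_upwards [eventually_ge_atTop c.natAbs] with n hn
  simp only [Function.comp]
  rw [Int.toNat_of_nonneg (by omega)]

/-- The law of large numbers for sample autocovariances of a stationary Gaussian sequence. -/
lemma IsGaussianSpace.tendsto_average_mul [IsProbabilityMeasure P] {H : Submodule ℝ (Lp ℝ 2 P)}
    (hH : IsGaussianSpace H) {a : ℤ → Lp ℝ 2 P} (ha : ∀ t, a t ∈ H) {γ : ℤ → ℝ}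
    (hγ : ∀ s t, inner ℝ (a s) (a t) = γ (s - t))
    (hlim : Tendsto (fun n : ℕ => γ n) atTop (𝓝 0)) (α β : ℤ) :
    TendstoInMeasure P (fun (N : ℕ) ω => (N : ℝ)⁻¹ *
      ∑ n ∈ Finset.range N, a (n + α) ω * a (n + β) ω) atTop (fun _ => γ (α - β)) := by
  have hsymm : ∀ τ, γ (-τ) = γ τ := fun τ => by
    have h1 := hγ 0 τ
    have h2 := hγ τ 0
    rw [real_inner_comm, h2] at h1
    simpa using h1.symm
  -- Polarization: products are recovered from the squares of `a (n + α) ± a (n + β)`, again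
  -- stationary Gaussian sequences with decaying autocovariance.
  have key : ∀ ε : ℝ, ε = 1 ∨ ε = -1 → TendstoInMeasure P (fun (N : ℕ) ω => (N : ℝ)⁻¹ *
      ∑ n ∈ Finset.range N, ((a (n + α) ω + ε * a (n + β) ω) ^ 2 -
        (2 * γ 0 + ε * 2 * γ (α - β)))) atTop (fun _ => 0) := by
    intro ε hε
    have hε2 : ε * ε = 1 := by rcases hε with rfl | rfl <;> norm_num
    set f : ℕ → Lp ℝ 2 P := fun n => a (n + α) + ε • a (n + β) with hf
    have h := hH.tendsto_average_sq (f := f)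
      (ρ := fun τ => 2 * γ τ + ε * γ (τ + (α - β)) + ε * γ (τ + (β - α)))
      (fun n => H.add_mem (ha _) (H.smul_mem _ (ha _))) (fun m n => by
        simp only [hf, inner_add_left, inner_add_right, inner_smul_left, inner_smul_right, hγ,
          conj_trivial]
        rw [show (m : ℤ) + α - (n + α) = m - n by ring, show (m : ℤ) + β - (n + β) = m - n by ring,
          show (m : ℤ) + α - (n + β) = m - n + (α - β) by ring,
          show (m : ℤ) + β - (n + α) = m - n + (β - α) by ring]
        linear_combination (γ (m - n)) * hε2) (by
        have := ((hlim.const_mul 2).add ((tendsto_intCast_add hlim (α - β)).const_mul ε)).add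
          ((tendsto_intCast_add hlim (β - α)).const_mul ε)
        simpa using this)
    refine h.congr (fun N => ?_) Filter.EventuallyEq.rfl
    have hae : ∀ᵐ ω ∂P, ∀ n : ℕ, f n ω = a (n + α) ω + ε * a (n + β) ω := ae_all_iff.2 fun n => by
      filter_upwards [Lp.coeFn_add (a (n + α)) (ε • a (n + β)), Lp.coeFn_smul ε (a (n + β))]
        with ω h1 h2
      rw [hf]; simp only; rw [h1, Pi.add_apply, h2, Pi.smul_apply, smul_eq_mul]
    filter_upwards [hae] with ω hω
    congr 1
    refine Finset.sum_congr rfl fun n _ => ?_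
    rw [hω, zero_add, zero_add, show β - α = -(α - β) by ring, hsymm]
    ring
  have h2 := tendstoInMeasure_pi (X := fun (N : ℕ) ω (b : Bool) => (N : ℝ)⁻¹ *
      ∑ n ∈ Finset.range N, ((a (n + α) ω + (if b then 1 else -1) * a (n + β) ω) ^ 2 -
        (2 * γ 0 + (if b then 1 else -1) * 2 * γ (α - β)))) (c := fun _ => 0) (P := P)
      (fun b => key _ (by cases b <;> simp))
  have h3 := tendstoInMeasure_comp_continuousAt h2
    (g := fun x : Bool → ℝ => (x true - x false) / 4 + γ (α - β)) (by fun_prop)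
  refine h3.congr' ?_ (Eventually.of_forall fun _ => by simp)
  filter_upwards [eventually_gt_atTop 0] with N hN
  refine Eventually.of_forall fun ω => ?_
  have hN' : (N : ℝ) ≠ 0 := by positivity
  simp only [if_true, Bool.false_eq_true, if_false]
  rw [← mul_sub, ← Finset.sum_sub_distrib]
  have : ∀ n : ℕ, ((a (n + α) ω + 1 * a (n + β) ω) ^ 2 - (2 * γ 0 + 1 * 2 * γ (α - β))) -
      ((a (n + α) ω + -1 * a (n + β) ω) ^ 2 - (2 * γ 0 + -1 * 2 * γ (α - β))) =
      4 * (a (n + α) ω * a (n + β) ω) - 4 * γ (α - β) := fun n => by ring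
  simp_rw [this]
  rw [Finset.sum_sub_distrib, ← Finset.mul_sum, Finset.sum_const, Finset.card_range, nsmul_eq_mul]
  field_simp
  ring

end InMeasure

/-! ### The score of the autoregressive model -/

section Score

variable {Ω : Type*} [mΩ : MeasurableSpace Ω] {P : Measure Ω} [IsProbabilityMeasure P]
  {p L : ℕ} {k : Fin p → ℝ → ℝ} {T Z : S2 → ℤ → Ω → ℝ} {Γ₀ : ℝ → ℤ → ℝ} {CZ : ℕ → ℝ}

/-- The harmonic coefficient of a random field. -/
def harmCoeff (X : S2 → ℤ → Ω → ℝ) (l : ℕ) (m : Fin (2 * l + 1)) (t : ℤ) (ω : Ω) : ℝ :=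
  ∫ x, X x t ω * harmonic l m x ∂surf

/-- The Gram matrix of the regressors of degree `l`. -/
def gram (p : ℕ) (T : S2 → ℤ → Ω → ℝ) (l N : ℕ) (ω : Ω) : Matrix (Fin p) (Fin p) ℝ :=
  Matrix.of fun i j => ∑ n ∈ Finset.range N, ∑ m,
    harmCoeff T l m (n + (p - (i : ℤ))) ω * harmCoeff T l m (n + (p - (j : ℤ))) ω

/-- The score vector of degree `l`. -/
def score (p : ℕ) (T Z : S2 → ℤ → Ω → ℝ) (l N : ℕ) (ω : Ω) (i : Fin p) : ℝ :=
  ∑ n ∈ Finset.range N, ∑ m,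
    harmCoeff T l m (n + (p - (i : ℤ))) ω * harmCoeff Z l m (n + (p + 1)) ω

lemma IsGaussianIsotropicStationary.ae_coeff_eq_harmCoeff
    (hT : IsGaussianIsotropicStationary P T Γ₀) :
    ∀ᵐ ω ∂P, ∀ l m t, (hT.isSecondOrder t).coeff (harmonic l m) ω = harmCoeff T l m t ω :=
  ae_all_iff.2 fun _ => ae_all_iff.2 fun _ => ae_all_iff.2 fun t =>
    (hT.isSecondOrder t).coeFn_coeff _

lemma IsSphericalWhiteNoise.ae_coeff_eq_harmCoeff
    (hZ : IsSphericalWhiteNoise P Z CZ) :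
    ∀ᵐ ω ∂P, ∀ l m t, (hZ.isSecondOrder t).coeff (harmonic l m) ω = harmCoeff Z l m t ω :=
  ae_all_iff.2 fun _ => ae_all_iff.2 fun _ => ae_all_iff.2 fun t =>
    (hZ.isSecondOrder t).coeFn_coeff _

lemma IsSPHAR.tendsto_average_harmCoeff (hAR : IsSPHAR P p k T Z)
    (hT : IsGaussianIsotropicStationary P T Γ₀) (hZ : IsSphericalWhiteNoise P Z CZ)
    (hstat : StationarityCondition k)
    (hfinite : ∀ j l, L < l → legendreCoeff (k j) l = 0) (l : ℕ) (m : Fin (2 * l + 1))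
    (i j : Fin p) :
    TendstoInMeasure P (fun (N : ℕ) ω => (N : ℝ)⁻¹ * ∑ n ∈ Finset.range N,
      harmCoeff T l m (n + (p - (i : ℤ))) ω * harmCoeff T l m (n + (p - (j : ℤ))) ω) atTop
      (fun _ => autocovMatrix p Γ₀ l i j) := by
  have h := hT.isGaussianSpace.tendsto_average_mul
    (a := fun t => (hT.isSecondOrder t).coeff (harmonic l m)) (fun t => hT.coeff_mem t _)
    (γ := autocov Γ₀ l) (fun s t => by rw [hT.inner_harmonic, if_pos rfl])
    (hAR.tendsto_autocov hT hZ hstat hfinite l) (p - i) (p - j)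
  refine h.congr (fun N => ?_) (Eventually.of_forall fun _ => ?_)
  · filter_upwards [hT.ae_coeff_eq_harmCoeff] with ω hω
    simp only [hω]
  · simp only
    rw [hT.autocovMatrix_apply, ← hT.autocov_neg]
    congr 1; ring

lemma IsSPHAR.tendsto_gram (hAR : IsSPHAR P p k T Z)
    (hT : IsGaussianIsotropicStationary P T Γ₀) (hZ : IsSphericalWhiteNoise P Z CZ)
    (hstat : StationarityCondition k)
    (hfinite : ∀ j l, L < l → legendreCoeff (k j) l = 0) (l : ℕ) (i j : Fin p) :
    TendstoInMeasure P (fun (N : ℕ) ω => (N : ℝ)⁻¹ * gram p T l N ω i j) atTop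
      (fun _ => (2 * l + 1) * autocovMatrix p Γ₀ l i j) := by
  have h := tendstoInMeasure_comp_continuousAt (tendstoInMeasure_pi (E := fun _ => ℝ)
    (X := fun (N : ℕ) ω (m : Fin (2 * l + 1)) => (N : ℝ)⁻¹ * ∑ n ∈ Finset.range N,
      harmCoeff T l m (n + (p - (i : ℤ))) ω * harmCoeff T l m (n + (p - (j : ℤ))) ω)
    (c := fun _ => autocovMatrix p Γ₀ l i j)
    fun m => hAR.tendsto_average_harmCoeff hT hZ hstat hfinite l m i j)
    (g := fun x : Fin (2 * l + 1) → ℝ => ∑ m, x m) (by fun_prop)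
  refine h.congr (fun N => Eventually.of_forall fun ω => ?_) (Eventually.of_forall fun _ => ?_)
  · simp only [gram, Matrix.of_apply]
    rw [Finset.sum_comm, Finset.mul_sum]
  · simp

/-- The indices of the spherical harmonics of degree at most `L`. -/
abbrev HarmIdx (L : ℕ) : Type := Σ l : Fin (L + 1), Fin (2 * (l : ℕ) + 1)

/-- Every combination of coefficients of the noise at one time lies in a Gaussian space, so its law
is fixed by its norm, and orthogonality of the coefficients makes that norm diagonal. -/
lemma IsSphericalWhiteNoise.integral_exp_sum (hZ : IsSphericalWhiteNoise P Z CZ) (t : ℤ)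
    (c : HarmIdx L → ℝ) :
    ∫ ω, Complex.exp ((∑ i, c i * (hZ.isSecondOrder t).coeff (harmonic i.1 i.2) ω : ℝ) *
      Complex.I) ∂P = Complex.exp ((-(∑ i, CZ i.1 * c i ^ 2) / 2 : ℝ)) := by
  classical
  set H := closedSpan (fun x => hZ.memLp x t)
  set f : Lp ℝ 2 P := ∑ i, c i • (hZ.isSecondOrder t).coeff (harmonic i.1 i.2) with hf
  have hfH : f ∈ H := H.sum_mem fun i _ => H.smul_mem _ (hZ.coeff_mem t _)
  have hnorm : ‖f‖ ^ 2 = ∑ i, CZ i.1 * c i ^ 2 := by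
    rw [← real_inner_self_eq_norm_sq, hf, sum_inner]
    refine Finset.sum_congr rfl fun i _ => ?_
    rw [inner_sum, Finset.sum_eq_single i]
    · rw [inner_smul_left, inner_smul_right, hZ.inner_harmonic, if_pos rfl]
      simp only [conj_trivial]; ring
    · intro j _ hj
      rw [inner_smul_left, inner_smul_right, hZ.inner_harmonic, if_neg]
      · simp
      · intro h
        refine hj ?_
        obtain ⟨i1, i2⟩ := i
        obtain ⟨j1, j2⟩ := j
        simp only [Sigma.mk.injEq] at h ⊢
        obtain ⟨h1, h2⟩ := h
        have h1' : i1 = j1 := Fin.ext h1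
        subst h1'
        exact ⟨rfl, h2.symm⟩
    · simp
  have hae : ∀ᵐ ω ∂P, f ω = ∑ i, c i * (hZ.isSecondOrder t).coeff (harmonic i.1 i.2) ω := by
    have h1 : ∀ᵐ ω ∂P, ∀ i : HarmIdx L,
        (c i • (hZ.isSecondOrder t).coeff (harmonic i.1 i.2) : Lp ℝ 2 P) ω =
        c i * (hZ.isSecondOrder t).coeff (harmonic i.1 i.2) ω :=
      ae_all_iff.2 fun i => Lp.coeFn_smul _ _
    filter_upwards [h1, Lp.coeFn_finsetSum Finset.univ fun i : HarmIdx L =>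
      c i • (hZ.isSecondOrder t).coeff (harmonic i.1 i.2)] with ω h1 h2
    rw [hf, h2, Finset.sum_apply]
    exact Finset.sum_congr rfl fun i _ => h1 i
  have h := hZ.isGaussianSpace t f hfH 1
  rw [hnorm] at h
  calc _ = ∫ ω, Complex.exp (((1 : ℝ) * f ω : ℝ) * Complex.I) ∂P := by
        refine integral_congr_ae ?_
        filter_upwards [hae] with ω hω
        rw [hω, one_mul]
    _ = _ := h
    _ = _ := by congr 2; ring

/-- The average on the left is the normalized conditional variance of a linear combination of
scores, as the central limit theorem requires. Expanding the square reduces it to sample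
autocovariances, and the `2l + 1` orders share one limit. -/
lemma IsSPHAR.tendsto_average_quadratic (hAR : IsSPHAR P p k T Z)
    (hT : IsGaussianIsotropicStationary P T Γ₀) (hZ : IsSphericalWhiteNoise P Z CZ)
    (hstat : StationarityCondition k)
    (hfinite : ∀ j l, L < l → legendreCoeff (k j) l = 0) (c : Fin (L + 1) → Fin p → ℝ) :
    TendstoInMeasure P (fun (N : ℕ) ω => (N : ℝ)⁻¹ * ∑ n ∈ Finset.range N, ∑ i : HarmIdx L,
      CZ i.1 * (∑ j : Fin p, c i.1 j * harmCoeff T i.1 i.2 (n + (p - (j : ℤ))) ω) ^ 2) atTop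
      (fun _ => ∑ l : Fin (L + 1), (2 * l + 1) * CZ l *
        (c l ⬝ᵥ (autocovMatrix p Γ₀ l).mulVec (c l))) := by
  have h1 := tendstoInMeasure_pi (E := fun _ => ℝ) (P := P)
    (X := fun (N : ℕ) ω (q : HarmIdx L × Fin p × Fin p) => (N : ℝ)⁻¹ * ∑ n ∈ Finset.range N,
      harmCoeff T q.1.1 q.1.2 (n + (p - (q.2.1 : ℤ))) ω *
        harmCoeff T q.1.1 q.1.2 (n + (p - (q.2.2 : ℤ))) ω)
    (c := fun q => autocovMatrix p Γ₀ q.1.1 q.2.1 q.2.2)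
    fun q => hAR.tendsto_average_harmCoeff hT hZ hstat hfinite q.1.1 q.1.2 q.2.1 q.2.2
  have h2 := tendstoInMeasure_comp_continuousAt h1
    (g := fun x : HarmIdx L × Fin p × Fin p → ℝ =>
      ∑ i : HarmIdx L, CZ i.1 * ∑ j, ∑ j', c i.1 j * c i.1 j' * x (i, j, j'))
    (Continuous.continuousAt (by fun_prop))
  refine h2.congr (fun N => Eventually.of_forall fun ω => ?_) (Eventually.of_forall fun _ => ?_)
  · simp only
    rw [Finset.sum_comm, Finset.mul_sum]
    refine Finset.sum_congr rfl fun i _ => ?_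
    rw [← Finset.mul_sum, mul_left_comm]
    congr 1
    simp_rw [sq, Finset.sum_mul_sum]
    rw [Finset.sum_comm (s := Finset.range N), Finset.mul_sum]
    refine Finset.sum_congr rfl fun j _ => ?_
    rw [Finset.sum_comm (s := Finset.range N), Finset.mul_sum]
    refine Finset.sum_congr rfl fun j' _ => ?_
    rw [mul_left_comm, Finset.mul_sum]
    congr 1
    refine Finset.sum_congr rfl fun n _ => by ring
  · simp only
    rw [Fintype.sum_sigma]
    refine Finset.sum_congr rfl fun l _ => ?_
    simp only [Finset.sum_const, Finset.card_univ, Fintype.card_fin, nsmul_eq_mul]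
    push_cast
    rw [mul_assoc]
    congr 2
    simp only [dotProduct, Matrix.mulVec, Finset.mul_sum]
    refine Finset.sum_congr rfl fun j _ => Finset.sum_congr rfl fun j' _ => by ring

/-- Convergence of the characteristic functions of the normalized scores. -/
lemma IsSPHAR.tendsto_integral_exp_score (hAR : IsSPHAR P p k T Z)
    (hT : IsGaussianIsotropicStationary P T Γ₀) (hZ : IsSphericalWhiteNoise P Z CZ)
    (hstat : StationarityCondition k) (hident : ∀ l, 0 < CZ l)
    (hfinite : ∀ j l, L < l → legendreCoeff (k j) l = 0) (c : Fin (L + 1) → Fin p → ℝ) :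
    Tendsto (fun N : ℕ => ∫ ω, Complex.exp (((√N)⁻¹ * ∑ l : Fin (L + 1), ∑ j,
      c l j * score p T Z l N ω j : ℝ) * Complex.I) ∂P) atTop
      (𝓝 (Complex.exp ((-(∑ l : Fin (L + 1), (2 * l + 1) * CZ l *
        (c l ⬝ᵥ (autocovMatrix p Γ₀ l).mulVec (c l))) / 2 : ℝ)))) := by
  have hAm : ∀ (i : HarmIdx L) (t : ℤ), AEStronglyMeasurable[pastSigma Z t]
      ((hT.isSecondOrder t).coeff (harmonic i.1 i.2)) P := fun i t =>
    hAR.aestronglyMeasurable_coeff hT hZ hstat hfinite t (harmonic_mem _ _)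
  have hZm : ∀ (i : HarmIdx L) (t : ℤ), AEStronglyMeasurable[noiseSigma Z t]
      ((hZ.isSecondOrder t).coeff (harmonic i.1 i.2)) P := fun i t =>
    hZ.aestronglyMeasurable_coeff t _
  -- The regressors of step `n` live at times `n + p - j ≤ n + p`, the noise at `n + p + 1`, just
  -- beyond this past.
  set m : ℕ → MeasurableSpace Ω := fun n => pastSigma Z (n + p) with hm
  -- The coefficients are adapted only up to null sets; the representatives `mk` are strictly
  -- adapted.
  set v : ℕ → Ω → HarmIdx L → ℝ := fun n ω i =>
    ∑ j : Fin p, c i.1 j * (hAm i (n + (p - (j : ℤ)))).mk _ ω with hv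
  set ξ : ℕ → Ω → HarmIdx L → ℝ := fun n ω i => (hZm i (n + (p + 1))).mk _ ω with hξ
  have hξm : ∀ n : ℕ, Measurable[noiseSigma Z (n + (p + 1))] (ξ n) := fun n =>
    @measurable_pi_lambda _ _ _ (noiseSigma Z (n + (p + 1))) _ _ fun i =>
      (hZm i (n + (p + 1))).stronglyMeasurable_mk.measurable
  have haeA : ∀ᵐ ω ∂P, ∀ (i : HarmIdx L) t, (hAm i t).mk _ ω = harmCoeff T i.1 i.2 t ω := by
    have h1 : ∀ᵐ ω ∂P, ∀ (i : HarmIdx L) t, (hAm i t).mk _ ω =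
      (hT.isSecondOrder t).coeff (harmonic i.1 i.2) ω := ae_all_iff.2 fun i => ae_all_iff.2 fun t =>
        (hAm i t).ae_eq_mk.symm
    filter_upwards [h1, hT.ae_coeff_eq_harmCoeff] with ω h1 h2 i t
    rw [h1, h2]
  have haeZ' : ∀ᵐ ω ∂P, ∀ (i : HarmIdx L) t, (hZm i t).mk _ ω =
      (hZ.isSecondOrder t).coeff (harmonic i.1 i.2) ω := ae_all_iff.2 fun i => ae_all_iff.2 fun t =>
        (hZm i t).ae_eq_mk.symm
  have haeZ : ∀ᵐ ω ∂P, ∀ (i : HarmIdx L) t, (hZm i t).mk _ ω = harmCoeff Z i.1 i.2 t ω := by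
    filter_upwards [haeZ', hZ.ae_coeff_eq_harmCoeff] with ω h1 h2 i t
    rw [h1, h2]
  have h := tendsto_integral_exp_of_indep_gaussian (P := P) (m := m) (ξ := ξ) (v := v)
    (d := fun i => CZ i.1) (s := ∑ l : Fin (L + 1), (2 * l + 1) * CZ l *
        (c l ⬝ᵥ (autocovMatrix p Γ₀ l).mulVec (c l)))
    (fun n => hZ.pastSigma_le _) (fun n n' h => pastSigma_mono Z (by simpa using h))
    (fun n => (hξm n).mono (noiseSigma_le_pastSigma Z (by push_cast; linarith)) le_rfl)
    (fun n => @measurable_pi_lambda _ _ _ (m n) _ _ fun i =>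
      Finset.measurable_sum _ fun j _ => Measurable.const_mul
        ((hAm i _).stronglyMeasurable_mk.measurable.mono (pastSigma_mono Z (by linarith)) le_rfl) _)
    (fun n => indep_of_indep_of_le_right (hZ.indep_pastSigma (by linarith)) (hξm n).comap_le)
    (fun i => (hident _).le)
    (fun n c' => by
      rw [← hZ.integral_exp_sum (n + (p + 1)) c']
      refine integral_congr_ae ?_
      filter_upwards [haeZ'] with ω hω
      simp only [hξ, hω])
    (Finset.sum_nonneg fun l _ => mul_nonneg (mul_nonneg (by positivity) (hident _).le) (by
      simpa using (hAR.posDef_autocovMatrix hT hZ hstat hident hfinite l).posSemidef.dotProduct_mulVec_nonneg (c l)))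
    (hAR.tendsto_average_quadratic hT hZ hstat hfinite c |>.congr (fun N => by
      filter_upwards [haeA] with ω hω
      simp only [hv, hω]) Filter.EventuallyEq.rfl)
  refine h.congr fun N => integral_congr_ae ?_
  filter_upwards [haeA, haeZ] with ω h1 h2
  congr 3
  simp only [hv, hξ, h1, h2, score]
  congr 1
  rw [Finset.sum_comm, Fintype.sum_sigma]
  refine Finset.sum_congr rfl fun l _ => ?_
  simp only [Finset.sum_mul, Finset.mul_sum]
  rw [Finset.sum_comm]
  rw [Finset.sum_congr rfl fun n _ => Finset.sum_comm, Finset.sum_comm]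
  refine Finset.sum_congr rfl fun j _ => Finset.sum_congr rfl fun n _ =>
    Finset.sum_congr rfl fun i _ => by ring

end Score

/-! ### The limit distribution of the normalized least squares error -/

section Matrices

variable {p : ℕ}

/-- The entries of the inverse of a matrix, as a function of the entries of the matrix. -/
def invEntries (x : Fin p → Fin p → ℝ) (i j : Fin p) : ℝ := (Matrix.of x)⁻¹ i j

lemma continuousAt_invEntries {x : Fin p → Fin p → ℝ} (hx : (Matrix.of x).det ≠ 0) :
    ContinuousAt invEntries x := by
  have h1 : ContinuousAt (Inv.inv : Matrix (Fin p) (Fin p) ℝ → _) (Matrix.of x) := by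
    refine continuousAt_matrix_inv _ ?_
    rw [Ring.inverse_eq_inv']
    exact continuousAt_inv₀ hx
  exact h1

/-- Cramer's rule holds also in the singular case, where both sides are zero, so measurability needs
no restriction to invertible matrices. -/
lemma measurable_invEntries : Measurable (invEntries : (Fin p → Fin p → ℝ) → Fin p → Fin p → ℝ) := by
  refine measurable_pi_lambda _ fun i => measurable_pi_lambda _ fun j => ?_
  have h1 : Measurable fun x : Fin p → Fin p → ℝ => ((Matrix.of x).det)⁻¹ *
      (Matrix.of x).adjugate i j := by
    have hof : Continuous fun x : Fin p → Fin p → ℝ => (Matrix.of x : Matrix (Fin p) (Fin p) ℝ) :=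
      continuous_id
    exact hof.matrix_det.measurable.inv.mul (hof.matrix_adjugate.matrix_elem i j).measurable
  have h2 : (fun x : Fin p → Fin p → ℝ => invEntries x i j) = fun x => ((Matrix.of x).det)⁻¹ *
      (Matrix.of x).adjugate i j := by
    ext x
    rw [invEntries, Matrix.inv_def, Matrix.smul_apply, smul_eq_mul, Ring.inverse_eq_inv']
  rw [h2]; exact h1

end Matrices

/-! ### Measurability of the regression statistics. -/

section Measurability

variable {Ω : Type*} [mΩ : MeasurableSpace Ω]

lemma measurable_harmCoeff {X : S2 → ℤ → Ω → ℝ}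
    (hX : Measurable fun q : Ω × S2 × ℤ => X q.2.1 q.2.2 q.1) (l : ℕ) (m : Fin (2 * l + 1)) (t : ℤ) :
    Measurable (harmCoeff X l m t) := by
  have h : StronglyMeasurable fun q : Ω × S2 => X q.2 t q.1 * harmonic l m q.2 := by
    refine Measurable.stronglyMeasurable (Measurable.mul ?_ ?_)
    · exact hX.comp (measurable_fst.prodMk (measurable_snd.prodMk measurable_const))
    · exact (harmonic l m).continuous.measurable.comp measurable_snd
  exact h.integral_prod_right.measurable

lemma measurable_gram {T : S2 → ℤ → Ω → ℝ}
    (hT : Measurable fun q : Ω × S2 × ℤ => T q.2.1 q.2.2 q.1) (p l N : ℕ) (i j : Fin p) :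
    Measurable fun ω => gram p T l N ω i j := by
  simp only [gram, Matrix.of_apply]
  exact Finset.measurable_sum _ fun _ _ => Finset.measurable_sum _ fun _ _ =>
    (measurable_harmCoeff hT _ _ _).mul (measurable_harmCoeff hT _ _ _)

lemma measurable_score {T Z : S2 → ℤ → Ω → ℝ}
    (hT : Measurable fun q : Ω × S2 × ℤ => T q.2.1 q.2.2 q.1)
    (hZ : Measurable fun q : Ω × S2 × ℤ => Z q.2.1 q.2.2 q.1) (p l N : ℕ) (i : Fin p) :
    Measurable fun ω => score p T Z l N ω i :=
  Finset.measurable_sum _ fun _ _ => Finset.measurable_sum _ fun _ _ =>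
    (measurable_harmCoeff hT _ _ _).mul (measurable_harmCoeff hZ _ _ _)

end Measurability

/-! ### Joint convergence of the scores and Slutsky's argument. -/

section Limit

variable {Ω : Type*} [mΩ : MeasurableSpace Ω] {P : Measure Ω} [IsProbabilityMeasure P]
  {p L : ℕ} {k : Fin p → ℝ → ℝ} {T Z : S2 → ℤ → Ω → ℝ} {Γ₀ : ℝ → ℤ → ℝ} {CZ : ℕ → ℝ}

/-- The covariance matrix of the limit of the normalized scores. -/
def scoreCov (p L : ℕ) (CZ : ℕ → ℝ) (Γ₀ : ℝ → ℤ → ℝ) :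
    Matrix (Fin p × Fin (L + 1)) (Fin p × Fin (L + 1)) ℝ :=
  Matrix.blockDiagonal fun l : Fin (L + 1) => ((2 * l + 1) * CZ l) • autocovMatrix p Γ₀ l

lemma dotProduct_scoreCov_mulVec (x y : Fin p × Fin (L + 1) → ℝ) :
    x ⬝ᵥ (scoreCov p L CZ Γ₀).mulVec y = ∑ l : Fin (L + 1), (2 * l + 1) * CZ l *
      ((fun j => x (j, l)) ⬝ᵥ (autocovMatrix p Γ₀ l).mulVec fun j => y (j, l)) := by
  simp only [dotProduct, Matrix.mulVec, scoreCov, Matrix.blockDiagonal_apply]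
  rw [Fintype.sum_prod_type_right]
  refine Finset.sum_congr rfl fun l _ => ?_
  rw [Finset.mul_sum]
  refine Finset.sum_congr rfl fun i _ => ?_
  rw [Fintype.sum_prod_type_right, Finset.sum_eq_single l]
  · simp only [if_true, Matrix.smul_apply, smul_eq_mul, Finset.mul_sum]
    refine Finset.sum_congr rfl fun j _ => by ring
  · intro l' _ hl'
    simp [Ne.symm hl']
  · simp

lemma IsSPHAR.posSemidef_scoreCov (hAR : IsSPHAR P p k T Z)
    (hT : IsGaussianIsotropicStationary P T Γ₀) (hZ : IsSphericalWhiteNoise P Z CZ)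
    (hstat : StationarityCondition k) (hident : ∀ l, 0 < CZ l)
    (hfinite : ∀ j l, L < l → legendreCoeff (k j) l = 0) : (scoreCov p L CZ Γ₀).PosSemidef := by
  have h := fun l => hAR.posDef_autocovMatrix hT hZ hstat hident hfinite l
  refine .of_dotProduct_mulVec_nonneg ?_ fun x => ?_
  · rw [scoreCov, Matrix.IsHermitian, Matrix.blockDiagonal_conjTranspose]
    congr 1; ext1 l
    rw [Matrix.conjTranspose_smul, (h l).isHermitian.eq, star_trivial]
  · rw [star_trivial, dotProduct_scoreCov_mulVec]
    refine Finset.sum_nonneg fun l _ => mul_nonneg (mul_nonneg (by positivity) (hident _).le) ?_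
    simpa using (h l).posSemidef.dotProduct_mulVec_nonneg fun j => x (j, l)

/-- The normalized scores. -/
def normScore (p L : ℕ) (T Z : S2 → ℤ → Ω → ℝ) (N : ℕ) (ω : Ω) :
    EuclideanSpace ℝ (Fin p × Fin (L + 1)) :=
  WithLp.toLp 2 fun q => (√N)⁻¹ * score p T Z q.2 N ω q.1

/-- Lévy's continuity theorem: an inner product with the score vector is a linear combination of
scores, whose characteristic function is already controlled. -/
lemma IsSPHAR.tendstoInDistribution_normScore (hAR : IsSPHAR P p k T Z)
    (hT : IsGaussianIsotropicStationary P T Γ₀) (hZ : IsSphericalWhiteNoise P Z CZ)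
    (hstat : StationarityCondition k) (hident : ∀ l, 0 < CZ l)
    (hfinite : ∀ j l, L < l → legendreCoeff (k j) l = 0) :
    TendstoInDistribution (normScore p L T Z) atTop id (fun _ => P)
      (multivariateGaussian 0 (scoreCov p L CZ Γ₀)) where
  forall_aemeasurable N := by
    refine Measurable.aemeasurable ?_
    refine (WithLp.measurable_toLp 2 _).comp (measurable_pi_lambda _ fun q => ?_)
    exact (measurable_score hT.measurable hZ.measurable _ _ _ _).const_mul _
  aemeasurable_limit := aemeasurable_id
  tendsto := by
    refine ProbabilityMeasure.tendsto_of_tendsto_charFun fun x => ?_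
    have hm : ∀ N, AEMeasurable (normScore p L T Z N) P := fun N => by
      refine Measurable.aemeasurable ?_
      refine (WithLp.measurable_toLp 2 _).comp (measurable_pi_lambda _ fun q => ?_)
      exact (measurable_score hT.measurable hZ.measurable _ _ _ _).const_mul _
    have h := hAR.tendsto_integral_exp_score hT hZ hstat hident hfinite (fun l j => x (j, l))
    simp only [ProbabilityMeasure.coe_mk, Measure.map_id]
    rw [charFun_multivariateGaussian (hAR.posSemidef_scoreCov hT hZ hstat hident hfinite),
      dotProduct_scoreCov_mulVec]
    convert h using 2 with N
    · rw [charFun_apply, integral_map (hm N) (by fun_prop)]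
      congr 1; ext ω
      congr 3
      rw [PiLp.inner_apply, Fintype.sum_prod_type_right, Finset.mul_sum]
      refine Finset.sum_congr rfl fun l _ => ?_
      rw [Finset.mul_sum]
      refine Finset.sum_congr rfl fun j _ => ?_
      simp [normScore]
      ring
    · simp [neg_div]

/-- The element of `C_p[-1,1]` with prescribed Legendre coefficients. -/
def coeffCp (c : Fin (L + 1) → Fin p → ℝ) : Cp p :=
  toCp fun j => ∑ l : Fin (L + 1), Polynomial.C ((2 * l + 1) / (4 * Real.pi) * c l j) * legendreP l

lemma coeffCp_apply (c : Fin (L + 1) → Fin p → ℝ) (z : Icc (-1 : ℝ) 1) (j : Fin p) :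
    coeffCp c z j = ∑ l : Fin (L + 1), (2 * l + 1) / (4 * Real.pi) * c l j *
      (legendreP l).eval (z : ℝ) := by
  simp [coeffCp, toCp, Polynomial.eval_finsetSum]

/-- `coeffCp` as a linear map. -/
def coeffCpₗ (p L : ℕ) : (Fin (L + 1) → Fin p → ℝ) →ₗ[ℝ] Cp p where
  toFun := coeffCp
  map_add' c c' := by
    ext z j
    rw [ContinuousMap.add_apply, PiLp.add_apply]
    simp only [coeffCp_apply, Pi.add_apply, ← Finset.sum_add_distrib]
    exact Finset.sum_congr rfl fun l _ => by ring
  map_smul' a c := by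
    ext z j
    rw [ContinuousMap.smul_apply, PiLp.smul_apply]
    simp only [coeffCp_apply, Pi.smul_apply, smul_eq_mul, Finset.mul_sum, RingHom.id_apply]
    exact Finset.sum_congr rfl fun l _ => by ring

/-- Linearity on a finite-dimensional space suffices. This is why weak convergence in the function
space needs no tightness. -/
lemma continuous_coeffCp : Continuous (coeffCp : (Fin (L + 1) → Fin p → ℝ) → Cp p) :=
  (coeffCpₗ p L).continuous_of_finiteDimensional

/-- The entries of the inverses of the normalized Gram matrices. -/
def invGram (p L : ℕ) (T : S2 → ℤ → Ω → ℝ) (N : ℕ) (ω : Ω) (l : Fin (L + 1)) :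
    Fin p → Fin p → ℝ := invEntries fun i j => (N : ℝ)⁻¹ * gram p T l N ω i j

/-- The entries of the inverses of the limits of the normalized Gram matrices. -/
def invLimit (p L : ℕ) (Γ₀ : ℝ → ℤ → ℝ) (l : Fin (L + 1)) :
    Fin p → Fin p → ℝ := invEntries fun i j => (2 * l + 1) * autocovMatrix p Γ₀ l i j

lemma IsSPHAR.det_limit_ne_zero (hAR : IsSPHAR P p k T Z)
    (hT : IsGaussianIsotropicStationary P T Γ₀) (hZ : IsSphericalWhiteNoise P Z CZ)
    (hstat : StationarityCondition k) (hident : ∀ l, 0 < CZ l)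
    (hfinite : ∀ j l, L < l → legendreCoeff (k j) l = 0) (l : ℕ) :
    (Matrix.of fun i j : Fin p => (2 * l + 1) * autocovMatrix p Γ₀ l i j).det ≠ 0 := by
  have h1 : (Matrix.of fun i j : Fin p => (2 * l + 1) * autocovMatrix p Γ₀ l i j) =
      (2 * (l : ℝ) + 1) • autocovMatrix p Γ₀ l := by ext i j; simp
  rw [h1, Matrix.det_smul]
  exact mul_ne_zero (by positivity)
    (hAR.posDef_autocovMatrix hT hZ hstat hident hfinite l).det_pos.ne'

lemma IsSPHAR.tendsto_gram_pi (hAR : IsSPHAR P p k T Z)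
    (hT : IsGaussianIsotropicStationary P T Γ₀) (hZ : IsSphericalWhiteNoise P Z CZ)
    (hstat : StationarityCondition k)
    (hfinite : ∀ j l, L < l → legendreCoeff (k j) l = 0) (l : ℕ) :
    TendstoInMeasure P (fun (N : ℕ) ω (i j : Fin p) => (N : ℝ)⁻¹ * gram p T l N ω i j) atTop
      (fun _ i j => (2 * l + 1) * autocovMatrix p Γ₀ l i j) :=
  tendstoInMeasure_pi (E := fun _ => Fin p → ℝ)
    (X := fun (N : ℕ) ω (i j : Fin p) => (N : ℝ)⁻¹ * gram p T l N ω i j)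
    (c := fun i j => (2 * l + 1) * autocovMatrix p Γ₀ l i j) fun i =>
    tendstoInMeasure_pi (E := fun _ => ℝ)
    (X := fun (N : ℕ) ω (j : Fin p) => (N : ℝ)⁻¹ * gram p T l N ω i j)
    (c := fun j => (2 * l + 1) * autocovMatrix p Γ₀ l i j) fun j =>
      hAR.tendsto_gram hT hZ hstat hfinite l i j

lemma IsSPHAR.tendsto_invGram (hAR : IsSPHAR P p k T Z)
    (hT : IsGaussianIsotropicStationary P T Γ₀) (hZ : IsSphericalWhiteNoise P Z CZ)
    (hstat : StationarityCondition k) (hident : ∀ l, 0 < CZ l)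
    (hfinite : ∀ j l, L < l → legendreCoeff (k j) l = 0) :
    TendstoInMeasure P (invGram p L T) atTop (fun _ => invLimit p L Γ₀) :=
  tendstoInMeasure_pi (E := fun _ => Fin p → Fin p → ℝ) (X := invGram p L T)
    (c := invLimit p L Γ₀) fun l =>
    tendstoInMeasure_comp_continuousAt (hAR.tendsto_gram_pi hT hZ hstat hfinite l)
      (continuousAt_invEntries (hAR.det_limit_ne_zero hT hZ hstat hident hfinite l))

/-- The Gram matrices are invertible with probability tending to one. -/
lemma IsSPHAR.tendsto_measure_det_gram (hAR : IsSPHAR P p k T Z)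
    (hT : IsGaussianIsotropicStationary P T Γ₀) (hZ : IsSphericalWhiteNoise P Z CZ)
    (hstat : StationarityCondition k) (hident : ∀ l, 0 < CZ l)
    (hfinite : ∀ j l, L < l → legendreCoeff (k j) l = 0) :
    Tendsto (fun N => P {ω | ∃ l : Fin (L + 1), (gram p T l N ω).det = 0}) atTop (𝓝 0) := by
  have h1 : ∀ l : Fin (L + 1), Tendsto (fun N => P {ω | (gram p T l N ω).det = 0}) atTop (𝓝 0) := by
    intro l
    have h2 := tendstoInMeasure_comp_continuousAt (hAR.tendsto_gram_pi hT hZ hstat hfinite l)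
      (g := fun x : Fin p → Fin p → ℝ => (Matrix.of x).det)
      (Continuous.continuousAt (Continuous.matrix_det continuous_id))
    rw [tendstoInMeasure_iff_dist] at h2
    have hne := hAR.det_limit_ne_zero hT hZ hstat hident hfinite l
    -- A singular Gram matrix puts the determinant at distance exactly the absolute value of its
    -- nonzero limit.
    refine tendsto_of_tendsto_of_tendsto_of_le_of_le tendsto_const_nhds (h2 _ (abs_pos.2 hne))
      (fun _ => zero_le) fun N => measure_mono fun ω hω => ?_
    simp only [mem_ofPred_eq] at hω ⊢
    have h3 : (Matrix.of fun i j : Fin p => (N : ℝ)⁻¹ * gram p T l N ω i j) =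
        (N : ℝ)⁻¹ • gram p T l N ω := by ext i j; simp
    rw [h3, Matrix.det_smul, hω, mul_zero, Real.dist_eq, zero_sub, abs_neg]
  have h2 : Tendsto (fun N => ∑ l : Fin (L + 1), P {ω | (gram p T l N ω).det = 0}) atTop (𝓝 0) := by
    simpa using tendsto_finsetSum Finset.univ fun l _ => h1 l
  refine tendsto_of_tendsto_of_tendsto_of_le_of_le tendsto_const_nhds h2
    (fun _ => zero_le) fun N => ?_
  refine le_trans (measure_mono fun ω hω => ?_) (measure_iUnion_fintype_le _ _)
  simpa using hω

/-- The linear combination of scores that gives the normalized least squares error. -/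
def errorCp (p L : ℕ) (q : EuclideanSpace ℝ (Fin p × Fin (L + 1)) ×
    (Fin (L + 1) → Fin p → Fin p → ℝ)) : Cp p :=
  coeffCp fun l i => ∑ j, q.2 l i j * q.1 (j, l)

lemma continuous_errorCp : Continuous (errorCp p L) := by
  refine continuous_coeffCp.comp (continuous_pi fun l => continuous_pi fun i => ?_)
  fun_prop

/-- Slutsky: the scores converge in law, the inverse Gram matrices in probability to a constant, and
the error is a continuous function of the pair. -/
lemma IsSPHAR.tendstoInDistribution_errorCp (hAR : IsSPHAR P p k T Z)
    (hT : IsGaussianIsotropicStationary P T Γ₀) (hZ : IsSphericalWhiteNoise P Z CZ)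
    (hstat : StationarityCondition k) (hident : ∀ l, 0 < CZ l)
    (hfinite : ∀ j l, L < l → legendreCoeff (k j) l = 0) :
    TendstoInDistribution (fun N ω => errorCp p L (normScore p L T Z N ω, invGram p L T N ω)) atTop
      (fun x => errorCp p L (x, invLimit p L Γ₀)) (fun _ => P)
      (multivariateGaussian 0 (scoreCov p L CZ Γ₀)) := by
  refine (hAR.tendstoInDistribution_normScore hT hZ hstat hident
    hfinite).continuous_comp_prodMk_of_tendstoInMeasure_const (E' := Fin (L + 1) → Fin p → Fin p → ℝ)
    continuous_errorCp (hAR.tendsto_invGram hT hZ hstat hident hfinite) fun N => ?_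
  refine Measurable.aemeasurable (measurable_pi_lambda _ fun l => ?_)
  exact measurable_invEntries.comp (measurable_pi_lambda _ fun i => measurable_pi_lambda _ fun j =>
    (measurable_gram hT.measurable p l N i j).const_mul _)

end Limit

/-! ### The limit law -/

section LimitLaw

variable {Ω : Type*} [mΩ : MeasurableSpace Ω] {P : Measure Ω} [IsProbabilityMeasure P]
  {p L : ℕ} {k : Fin p → ℝ → ℝ} {T Z : S2 → ℤ → Ω → ℝ} {Γ₀ : ℝ → ℤ → ℝ} {CZ : ℕ → ℝ}

/-- `errorCp` with fixed inverse matrices, as a continuous linear map. -/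
def errorCLM (y : Fin (L + 1) → Fin p → Fin p → ℝ) :
    EuclideanSpace ℝ (Fin p × Fin (L + 1)) →L[ℝ] Cp p where
  toFun x := errorCp p L (x, y)
  map_add' x x' := by
    rw [errorCp, errorCp, errorCp]
    refine Eq.trans ?_ ((coeffCpₗ p L).map_add _ _)
    congr 1
    ext l i
    simp [mul_add, Finset.sum_add_distrib]
  map_smul' a x := by
    rw [errorCp, errorCp]
    refine Eq.trans ?_ ((coeffCpₗ p L).map_smul _ _)
    congr 1
    ext l i
    simp only [PiLp.smul_apply, Pi.smul_apply, smul_eq_mul, Finset.mul_sum, RingHom.id_apply]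
    exact Finset.sum_congr rfl fun j _ => by ring
  cont := continuous_errorCp.comp (continuous_id.prodMk continuous_const)

lemma errorCLM_apply (y : Fin (L + 1) → Fin p → Fin p → ℝ)
    (x : EuclideanSpace ℝ (Fin p × Fin (L + 1))) (z : Icc (-1 : ℝ) 1) (i : Fin p) :
    errorCLM y x z i = inner ℝ (WithLp.toLp 2 fun q : Fin p × Fin (L + 1) =>
      (2 * (q.2 : ℝ) + 1) / (4 * Real.pi) * (legendreP q.2).eval (z : ℝ) * y q.2 i q.1) x := by
  change coeffCp _ z i = _
  rw [coeffCp_apply, PiLp.inner_apply, Fintype.sum_prod_type_right]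
  refine Finset.sum_congr rfl fun l _ => ?_
  rw [Finset.mul_sum, Finset.sum_mul]
  refine Finset.sum_congr rfl fun j _ => ?_
  simp
  ring

/-- The law of the limit process. -/
def limitLaw (p L : ℕ) (CZ : ℕ → ℝ) (Γ₀ : ℝ → ℤ → ℝ) : ProbabilityMeasure (Cp p) :=
  ⟨(multivariateGaussian 0 (scoreCov p L CZ Γ₀)).map (errorCLM (invLimit p L Γ₀)),
    Measure.isProbabilityMeasure_map (errorCLM _).continuous.measurable.aemeasurable⟩

/-- Evaluation at finitely many points. -/
def evalCLM (I : Finset (Icc (-1 : ℝ) 1)) : Cp p →L[ℝ] (I → EuclideanSpace ℝ (Fin p)) :=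
  ContinuousLinearMap.pi fun z => ContinuousMap.evalCLM ℝ (z : Icc (-1 : ℝ) 1)

/-- A continuous linear image of a centered Gaussian vector. In each degree the factor `2l+1` of the
Legendre expansion cancels that of the inverse Gram limit, leaving `1/(4π)` on either side of the
score covariance. -/
lemma IsSPHAR.isCenteredGaussianLaw_limitLaw (hAR : IsSPHAR P p k T Z)
    (hT : IsGaussianIsotropicStationary P T Γ₀) (hZ : IsSphericalWhiteNoise P Z CZ)
    (hstat : StationarityCondition k) (hident : ∀ l, 0 < CZ l)
    (hfinite : ∀ j l, L < l → legendreCoeff (k j) l = 0) :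
    IsCenteredGaussianLaw (limitLaw p L CZ Γ₀) (limitCov p L CZ Γ₀) where
  gaussian := by
    refine ⟨fun I => ?_⟩
    have h : IsGaussian ((limitLaw p L CZ Γ₀ : ProbabilityMeasure (Cp p)) : Measure (Cp p)) := by
      rw [limitLaw, ProbabilityMeasure.coe_mk]; infer_instance
    exact IsGaussian.hasGaussianLaw_id.map_fun (evalCLM I)
  mean_zero z := by
    have hz : Continuous fun f : Cp p => f z := (ContinuousMap.evalCLM ℝ z).continuous
    rw [limitLaw, ProbabilityMeasure.coe_mk, integral_map (errorCLM _).continuous.measurable.aemeasurable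
      hz.aestronglyMeasurable]
    have h := ((ContinuousMap.evalCLM ℝ z).comp (errorCLM (invLimit p L Γ₀))).integral_comp_comm
      (μ := multivariateGaussian 0 (scoreCov p L CZ Γ₀)) (φ := id) IsGaussian.integrable_id
    rw [show (∫ x, id x ∂(multivariateGaussian 0 (scoreCov p L CZ Γ₀))) = 0 from
      integral_id_multivariateGaussian, map_zero] at h
    exact h
  covariance_eq z z' i j := by
    have hev : ∀ (z : Icc (-1 : ℝ) 1) (i : Fin p), Continuous fun f : Cp p => f z i := fun z i => by
      fun_prop
    rw [limitLaw, ProbabilityMeasure.coe_mk, covariance_map (hev z i).aestronglyMeasurable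
      (hev z' j).aestronglyMeasurable (errorCLM _).continuous.measurable.aemeasurable]
    have hpos := hAR.posSemidef_scoreCov hT hZ hstat hident hfinite
    have h1 : ∀ (z : Icc (-1 : ℝ) 1) (i : Fin p), (fun f : Cp p => f z i) ∘
        (errorCLM (invLimit p L Γ₀)) = fun x => inner ℝ (WithLp.toLp 2
          fun q : Fin p × Fin (L + 1) => (2 * (q.2 : ℝ) + 1) / (4 * Real.pi) *
            (legendreP q.2).eval (z : ℝ) * invLimit p L Γ₀ q.2 i q.1) x := fun z i => by
      ext x; exact errorCLM_apply _ _ _ _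
    rw [h1, h1, ← covarianceBilin_apply_eq_cov IsGaussian.memLp_two_id,
      covarianceBilin_multivariateGaussian hpos, dotProduct_scoreCov_mulVec, limitCov,
      Matrix.sum_apply, ← Fin.sum_univ_eq_sum_range (fun l => ((CZ l * ((2 * (l : ℝ) + 1) / (16 * Real.pi ^ 2)) *
      (legendreP l).eval (z : ℝ) * (legendreP l).eval (z' : ℝ)) • (autocovMatrix p Γ₀ l)⁻¹) i j)]
    refine Finset.sum_congr rfl fun l _ => ?_
    have hdet := (hAR.posDef_autocovMatrix hT hZ hstat hident hfinite l).det_pos.ne'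
    have hsymm := (hAR.posDef_autocovMatrix hT hZ hstat hident hfinite l).isHermitian
    set A := autocovMatrix p Γ₀ l with hA
    have hinv : ∀ a b, invLimit p L Γ₀ l a b = (2 * (l : ℝ) + 1)⁻¹ * A⁻¹ a b := fun a b => by
      have h2 : (Matrix.of fun i j : Fin p => (2 * (l : ℝ) + 1) * A i j) = (2 * (l : ℝ) + 1) • A := by
        ext i j; simp
      rw [invLimit, invEntries, ← hA, h2]
      have h3 : ((2 * (l : ℝ) + 1) • A)⁻¹ = (2 * (l : ℝ) + 1)⁻¹ • A⁻¹ := by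
        refine Matrix.inv_eq_right_inv ?_
        rw [Matrix.smul_mul, Matrix.mul_smul, smul_smul, mul_inv_cancel₀ (by positivity), one_smul,
          Matrix.mul_nonsing_inv _ (isUnit_iff_ne_zero.2 hdet)]
      rw [h3, Matrix.smul_apply, smul_eq_mul]
    have hsi : (A⁻¹).transpose = A⁻¹ := by
      rw [Matrix.transpose_nonsing_inv]
      congr 1
    -- The sandwich `A⁻¹ A A⁻¹` collapses to `A⁻¹`; symmetry of the inverse lets its rows serve as
    -- columns.
    have hquad : (fun a => A⁻¹ i a) ⬝ᵥ A.mulVec (fun a => A⁻¹ j a) = A⁻¹ i j := by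
      have : A.mulVec (fun a => A⁻¹ j a) = fun a => (1 : Matrix (Fin p) (Fin p) ℝ) a j := by
        have h4 : A * (A⁻¹).transpose = 1 := by
          rw [hsi, Matrix.mul_nonsing_inv _ (isUnit_iff_ne_zero.2 hdet)]
        ext a
        rw [← h4]; rfl
      rw [this, dotProduct, Finset.sum_eq_single j]
      · simp
      · intro b _ hb; simp [hb]
      · simp
    have e : ∀ (z : Icc (-1 : ℝ) 1) (i : Fin p), (fun a : Fin p => (2 * (l : ℝ) + 1) / (4 * Real.pi) *
        (legendreP l).eval (z : ℝ) * invLimit p L Γ₀ l i a) =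
        ((4 * Real.pi)⁻¹ * (legendreP l).eval (z : ℝ)) • fun a => A⁻¹ i a := fun z i => by
      ext a
      rw [hinv, Pi.smul_apply, smul_eq_mul]
      field_simp
    change (2 * (l : ℝ) + 1) * CZ l * ((fun a : Fin p => (2 * (l : ℝ) + 1) / (4 * Real.pi) *
        (legendreP l).eval (z : ℝ) * invLimit p L Γ₀ l i a) ⬝ᵥ A.mulVec
        (fun a : Fin p => (2 * (l : ℝ) + 1) / (4 * Real.pi) *
        (legendreP l).eval (z' : ℝ) * invLimit p L Γ₀ l j a)) = _
    rw [e, e, Matrix.mulVec_smul, smul_dotProduct, dotProduct_smul, hquad, Matrix.smul_apply]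
    simp only [smul_eq_mul]
    have := Real.pi_pos
    field_simp
    ring

end LimitLaw

/-! ### Least squares -/

section LeastSquares

variable {R : Type*} {p : ℕ} (s : Finset R) (X : R → Fin p → ℝ) (y : R → ℝ)

/-- The residual sum of squares of a linear regression. -/
def rss (v : Fin p → ℝ) : ℝ := ∑ r ∈ s, (y r - ∑ j, v j * X r j) ^ 2

/-- The matrix of the normal equations. -/
def normalMatrix : Matrix (Fin p) (Fin p) ℝ := Matrix.of fun i j => ∑ r ∈ s, X r i * X r j

/-- The right hand side of the normal equations. -/
def normalRhs (i : Fin p) : ℝ := ∑ r ∈ s, X r i * y r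

lemma dotProduct_normalMatrix_mulVec (h v : Fin p → ℝ) : h ⬝ᵥ (normalMatrix s X).mulVec v =
    ∑ r ∈ s, (∑ j, h j * X r j) * (∑ j, v j * X r j) := by
  simp only [dotProduct, Matrix.mulVec, normalMatrix, Matrix.of_apply, Finset.mul_sum,
    Finset.sum_mul]
  rw [Finset.sum_congr rfl fun i _ => Finset.sum_comm, Finset.sum_comm]
  refine Finset.sum_congr rfl fun r _ => ?_
  rw [Finset.sum_comm]
  exact Finset.sum_congr rfl fun i _ => Finset.sum_congr rfl fun j _ => by ring

/-- The criterion is quadratic, so this second-order expansion is exact; at a solution of the normal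
equations the linear term drops out. -/
lemma rss_add (v h : Fin p → ℝ) : rss s X y (v + h) = rss s X y v -
    2 * (h ⬝ᵥ (normalRhs s X y - (normalMatrix s X).mulVec v)) +
      h ⬝ᵥ (normalMatrix s X).mulVec h := by
  have h1 : h ⬝ᵥ normalRhs s X y = ∑ r ∈ s, (∑ j, h j * X r j) * y r := by
    simp only [dotProduct, normalRhs, Finset.mul_sum, Finset.sum_mul]
    rw [Finset.sum_comm]
    exact Finset.sum_congr rfl fun r _ => Finset.sum_congr rfl fun i _ => by ring
  rw [dotProduct_sub, h1, dotProduct_normalMatrix_mulVec, dotProduct_normalMatrix_mulVec, rss, rss,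
    ← Finset.sum_sub_distrib, Finset.mul_sum, ← Finset.sum_sub_distrib, ← Finset.sum_add_distrib]
  refine Finset.sum_congr rfl fun r _ => ?_
  simp only [Pi.add_apply, add_mul, Finset.sum_add_distrib]
  ring

lemma dotProduct_normalMatrix_nonneg (h : Fin p → ℝ) :
    0 ≤ h ⬝ᵥ (normalMatrix s X).mulVec h := by
  rw [dotProduct_normalMatrix_mulVec]
  exact Finset.sum_nonneg fun r _ => mul_self_nonneg _

/-- The form is a sum of squares of the fitted values of `h`, so its vanishing makes all of them
zero. -/
lemma normalMatrix_mulVec_eq_zero {h : Fin p → ℝ}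
    (h0 : h ⬝ᵥ (normalMatrix s X).mulVec h = 0) : (normalMatrix s X).mulVec h = 0 := by
  rw [dotProduct_normalMatrix_mulVec, Finset.sum_eq_zero_iff_of_nonneg fun r _ => mul_self_nonneg _] at h0
  ext i
  have : ∀ v : Fin p → ℝ, v ⬝ᵥ (normalMatrix s X).mulVec h = 0 := fun v => by
    rw [dotProduct_normalMatrix_mulVec]
    exact Finset.sum_eq_zero fun r hr => by rw [mul_self_eq_zero.1 (h0 r hr), mul_zero]
  simpa using this (Pi.single i 1)

variable {s X y}

lemma rss_add_of_normal {v : Fin p → ℝ} (hv : (normalMatrix s X).mulVec v = normalRhs s X y)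
    (h : Fin p → ℝ) : rss s X y (v + h) = rss s X y v + h ⬝ᵥ (normalMatrix s X).mulVec h := by
  rw [rss_add, hv, sub_self, dotProduct_zero, mul_zero, sub_zero]

lemma eq_zero_of_dotProduct_normalMatrix (hdet : (normalMatrix s X).det ≠ 0) {h : Fin p → ℝ}
    (h0 : h ⬝ᵥ (normalMatrix s X).mulVec h = 0) : h = 0 :=
  Matrix.eq_zero_of_mulVec_eq_zero hdet (normalMatrix_mulVec_eq_zero s X h0)

/-- A null vector of the normal matrix has zero fitted values, so moving along it is invisible to
the criterion. -/
lemma exists_rss_add_eq (hdet : (normalMatrix s X).det = 0) :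
    ∃ h : Fin p → ℝ, h ≠ 0 ∧ ∀ v, rss s X y (v + h) = rss s X y v := by
  obtain ⟨h, hne, h0⟩ := Matrix.exists_mulVec_eq_zero_iff.2 hdet
  refine ⟨h, hne, fun v => ?_⟩
  have h1 : ∀ r ∈ s, ∑ j, h j * X r j = 0 := by
    have h2 : h ⬝ᵥ (normalMatrix s X).mulVec h = 0 := by rw [h0, dotProduct_zero]
    rw [dotProduct_normalMatrix_mulVec,
      Finset.sum_eq_zero_iff_of_nonneg fun r _ => mul_self_nonneg _] at h2
    exact fun r hr => mul_self_eq_zero.1 (h2 r hr)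
  refine Finset.sum_congr rfl fun r hr => ?_
  simp only [Pi.add_apply, add_mul, Finset.sum_add_distrib, h1 r hr, add_zero]

end LeastSquares

/-! ### The least squares criterion in terms of harmonic coefficients -/

section Criterion

variable {L p : ℕ}

/-- The polynomial of degree at most `L` with prescribed Legendre coefficients. -/
def coeffPoly (c : Fin (L + 1) → ℝ) : ℝ[X] :=
  ∑ l : Fin (L + 1), Polynomial.C ((2 * l + 1) / (4 * Real.pi) * c l) * legendreP l

/-- Extension of a vector by zero. -/
def extendZero (c : Fin (L + 1) → ℝ) (l : ℕ) : ℝ := if h : l < L + 1 then c ⟨l, h⟩ else 0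

lemma extendZero_coe (c : Fin (L + 1) → ℝ) (l : Fin (L + 1)) : extendZero c l = c l :=
  dif_pos l.2

lemma coeffPoly_eq_sum_range (c : Fin (L + 1) → ℝ) : coeffPoly c = ∑ l ∈ Finset.range (L + 1),
    Polynomial.C ((2 * l + 1) / (4 * Real.pi) * extendZero c l) * legendreP l := by
  rw [Finset.sum_range, coeffPoly]
  exact Finset.sum_congr rfl fun l _ => by rw [extendZero_coe]

lemma coeffPoly_mem (c : Fin (L + 1) → ℝ) : coeffPoly c ∈ legendreSpan L := by
  refine Submodule.sum_mem _ fun l _ => ?_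
  rw [Polynomial.C_mul']
  exact Submodule.smul_mem _ _ (Submodule.subset_span ⟨l, Nat.lt_succ_iff.1 l.2, rfl⟩)

lemma legendreCoeff_coeffPoly (c : Fin (L + 1) → ℝ) (l : Fin (L + 1)) :
    legendreCoeff (fun z => (coeffPoly c).eval z) l = c l := by
  have h := legendreCoeff_sum (L + 1) (fun l => (2 * l + 1) / (4 * Real.pi) * extendZero c l) l
  rw [coeffPoly_eq_sum_range, h, if_pos l.2, extendZero_coe]
  have := Real.pi_pos
  field_simp

lemma coeffPoly_injective : Function.Injective (coeffPoly : (Fin (L + 1) → ℝ) → ℝ[X]) :=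
  fun c c' h => funext fun l => by rw [← legendreCoeff_coeffPoly c, h, legendreCoeff_coeffPoly]

lemma exists_coeffPoly_eq {q : ℝ[X]} (hq : q ∈ legendreSpan L) :
    ∃ c : Fin (L + 1) → ℝ, coeffPoly c = q := by
  rw [mem_legendreSpan_iff] at hq
  refine ⟨fun l => legendreCoeff (fun z => q.eval z) l, ?_⟩
  have h := eq_sum_legendreCoeff (n := L + 1) (q := q)
    (lt_of_le_of_lt Polynomial.degree_le_natDegree (by exact_mod_cast Nat.lt_succ_of_le hq))
  rw [Finset.sum_range] at h
  exact h.symm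

lemma kernelOp_coeffPoly {f : S2 → ℝ} (hf : Integrable f surf) (c : Fin (L + 1) → ℝ) (x : S2) :
    kernelOp (fun z => (coeffPoly c).eval z) f x = ∑ i : HarmIdx L,
      c i.1 * (∫ y, f y * harmonic i.1 i.2 y ∂surf) * harmonic i.1 i.2 x := by
  rw [coeffPoly_eq_sum_range, kernelOp_sum_legendreP hf, Finset.sum_range, Fintype.sum_sigma]
  exact Finset.sum_congr rfl fun l _ => Finset.sum_congr rfl fun m _ => by rw [extendZero_coe]

lemma integral_harmonic_mul_harmIdx (i i' : HarmIdx L) :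
    ∫ x, harmonic i.1 i.2 x * harmonic i'.1 i'.2 x ∂surf = if i = i' then 1 else 0 := by
  rw [integral_harmonic_mul_eq]
  congr 1
  rw [eq_iff_iff]
  constructor
  · intro h
    obtain ⟨i1, i2⟩ := i
    obtain ⟨j1, j2⟩ := i'
    simp only [Sigma.mk.injEq] at h ⊢
    obtain ⟨h1, h2⟩ := h
    have h1' : i1 = j1 := Fin.ext h1
    subst h1'
    exact ⟨rfl, h2⟩
  · rintro rfl; rfl

/-- Pythagoras' theorem for the projection on the spherical harmonics of degree at most `L`. -/
lemma integral_sub_harmonic_sq {f : S2 → ℝ} (hf : MemLp f 2 surf) (β : HarmIdx L → ℝ) :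
    ∫ x, (f x - ∑ i, β i * harmonic i.1 i.2 x) ^ 2 ∂surf =
      ∫ x, f x ^ 2 ∂surf - ∑ i : HarmIdx L, (∫ x, f x * harmonic i.1 i.2 x ∂surf) ^ 2 +
        ∑ i : HarmIdx L, (∫ x, f x * harmonic i.1 i.2 x ∂surf - β i) ^ 2 := by
  have hfi := fun i : HarmIdx L => integrable_mul_continuousMap hf (harmonic i.1 i.2)
  have hii : ∀ i i' : HarmIdx L, Integrable (fun x => harmonic i.1 i.2 x * harmonic i'.1 i'.2 x) surf :=
    fun i i' => integrable_continuousMap (harmonic i.1 i.2 * harmonic i'.1 i'.2)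
  have h1 : ∀ x, (f x - ∑ i, β i * harmonic i.1 i.2 x) ^ 2 = f x ^ 2 -
      ∑ i, 2 * β i * (f x * harmonic i.1 i.2 x) +
      ∑ i, ∑ i', β i * β i' * (harmonic i.1 i.2 x * harmonic i'.1 i'.2 x) := fun x => by
    have e1 : ∑ i, 2 * β i * (f x * harmonic i.1 i.2 x) =
        2 * f x * ∑ i, β i * harmonic i.1 i.2 x := by
      rw [Finset.mul_sum]; exact Finset.sum_congr rfl fun i _ => by ring
    have e2 : ∑ i, ∑ i', β i * β i' * (harmonic i.1 i.2 x * harmonic i'.1 i'.2 x) =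
        (∑ i, β i * harmonic i.1 i.2 x) * ∑ i, β i * harmonic i.1 i.2 x := by
      rw [Finset.sum_mul_sum]
      exact Finset.sum_congr rfl fun i _ => Finset.sum_congr rfl fun j _ => by ring
    rw [e1, e2]; ring
  have h0 : Integrable (fun x => f x ^ 2 - ∑ i : HarmIdx L, 2 * β i * (f x * harmonic i.1 i.2 x)) surf :=
    hf.integrable_sq.sub (integrable_finsetSum _ fun i _ => (hfi i).const_mul _)
  simp_rw [h1]
  rw [integral_add h0
      (integrable_finsetSum _ fun i _ => integrable_finsetSum _ fun i' _ => (hii i i').const_mul _),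
    integral_sub hf.integrable_sq (integrable_finsetSum _ fun i _ => (hfi i).const_mul _),
    integral_finsetSum _ fun i _ => (hfi i).const_mul _,
    integral_finsetSum _ fun i _ => integrable_finsetSum _ fun i' _ => (hii i i').const_mul _]
  have h2 : ∀ i : HarmIdx L, ∫ x, ∑ i', β i * β i' * (harmonic i.1 i.2 x * harmonic i'.1 i'.2 x) ∂surf =
      β i ^ 2 := fun i => by
    rw [integral_finsetSum _ fun i' _ => (hii i i').const_mul _, Finset.sum_eq_single i]
    · rw [integral_const_mul, integral_harmonic_mul_harmIdx, if_pos rfl]; ring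
    · intro j _ hj
      rw [integral_const_mul, integral_harmonic_mul_harmIdx, if_neg (Ne.symm hj), mul_zero]
    · simp
  simp_rw [h2, integral_const_mul]
  rw [sub_add, sub_add, ← Finset.sum_sub_distrib, ← Finset.sum_sub_distrib]
  congr 1
  exact Finset.sum_congr rfl fun i _ => by ring

variable {Ω : Type*} {T : S2 → ℤ → Ω → ℝ} {ω : Ω}

/-- The time points and orders of the regression of degree `l`. -/
def rows (l N : ℕ) : Finset (ℕ × Fin (2 * l + 1)) := Finset.range N ×ˢ Finset.univ

/-- The regressors of degree `l`. -/
def regressor (p : ℕ) (T : S2 → ℤ → Ω → ℝ) (ω : Ω) (l : ℕ) (r : ℕ × Fin (2 * l + 1)) (j : Fin p) : ℝ :=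
  harmCoeff T l r.2 (r.1 + (p - (j : ℤ))) ω

/-- The responses of degree `l`. -/
def response (p : ℕ) (T : S2 → ℤ → Ω → ℝ) (ω : Ω) (l : ℕ) (r : ℕ × Fin (2 * l + 1)) : ℝ :=
  harmCoeff T l r.2 (r.1 + (p + 1)) ω

lemma normalMatrix_regressor (l N : ℕ) :
    normalMatrix (rows l N) (regressor p T ω l) = gram p T l N ω := by
  ext i j
  simp only [normalMatrix, gram, rows, Matrix.of_apply, Finset.sum_product, regressor]

/-- The residual sum of squares of all degrees up to `L`. -/
def totalRss (T : S2 → ℤ → Ω → ℝ) (N : ℕ) (ω : Ω) (c : Fin (L + 1) → Fin p → ℝ) : ℝ :=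
  ∑ l : Fin (L + 1), rss (rows l N) (regressor p T ω l) (response p T ω l) (c l)

/-- The vector of polynomials with prescribed Legendre coefficients. -/
def coeffPolys (c : Fin (L + 1) → Fin p → ℝ) (j : Fin p) : ℝ[X] := coeffPoly fun l => c l j

lemma sum_Icc_one_eq_sum_range (F : ℕ → ℝ) (N : ℕ) :
    ∑ t ∈ Finset.Icc 1 N, F t = ∑ n ∈ Finset.range N, F (n + 1) := by
  rw [Finset.range_eq_Ico, Finset.sum_Ico_add' F 0 N 1]
  congr 1

/-- Pythagoras at each time: the energy beyond degree `L` is out of reach of the kernels and makes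
up `K`. Below, the operators act as scalars on each degree, so the regressions decouple. -/
lemma exists_lsCriterion_eq (hT : ∀ t, MemLp (fun x => T x t ω) 2 surf) (N : ℕ) : ∃ K : ℝ,
    ∀ c : Fin (L + 1) → Fin p → ℝ, lsCriterion T N ω (coeffPolys c) = K + totalRss T N ω c := by
  refine ⟨∑ n ∈ Finset.range N, (∫ x, T x ((n : ℤ) + (p + 1)) ω ^ 2 ∂surf -
    ∑ i : HarmIdx L, harmCoeff T i.1 i.2 ((n : ℤ) + (p + 1)) ω ^ 2), fun c => ?_⟩
  have h1 : totalRss T N ω c = ∑ n ∈ Finset.range N, ∑ i : HarmIdx L,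
      (harmCoeff T i.1 i.2 ((n : ℤ) + (p + 1)) ω -
        ∑ j, c i.1 j * harmCoeff T i.1 i.2 (n + (p - (j : ℤ))) ω) ^ 2 := by
    simp only [totalRss, rss, rows, Finset.sum_product, regressor, response, Fintype.sum_sigma]
    rw [Finset.sum_comm]
  rw [h1, ← Finset.sum_add_distrib, lsCriterion, sum_Icc_one_eq_sum_range]
  refine Finset.sum_congr rfl fun n _ => ?_
  have h2 : ∀ x, ∑ j : Fin p, kernelOp (fun z => (coeffPolys c j).eval z)
      (fun y => T y (((n + 1 : ℕ) : ℤ) + p - ((j : ℤ) + 1)) ω) x =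
      ∑ i : HarmIdx L, (∑ j, c i.1 j * harmCoeff T i.1 i.2 (n + (p - (j : ℤ))) ω) *
        harmonic i.1 i.2 x := fun x => by
    simp_rw [Finset.sum_mul]
    rw [Finset.sum_comm]
    refine Finset.sum_congr rfl fun j _ => ?_
    -- Time `t = n + 1` with response at `t + p`: index `j` is lag `j + 1`.
    rw [show (((n + 1 : ℕ) : ℤ) + p - ((j : ℤ) + 1)) = n + (p - (j : ℤ)) by push_cast; ring]
    exact kernelOp_coeffPoly ((hT _).integrable (by norm_num)) _ x
  simp_rw [h2]
  rw [show (((n + 1 : ℕ) : ℤ) + p) = n + (p + 1) by push_cast; ring]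
  exact integral_sub_harmonic_sq (hT _) _

lemma coeffPolys_injective :
    Function.Injective (coeffPolys : (Fin (L + 1) → Fin p → ℝ) → Fin p → ℝ[X]) := by
  intro c c' h
  ext l j
  exact congrFun (coeffPoly_injective (congrFun h j)) l

lemma exists_coeffPolys_eq {κ : Fin p → ℝ[X]} (hκ : ∀ j, κ j ∈ legendreSpan L) :
    ∃ c : Fin (L + 1) → Fin p → ℝ, coeffPolys c = κ := by
  choose c hc using fun j => exists_coeffPoly_eq (hκ j)
  exact ⟨fun l j => c j l, funext hc⟩

lemma isLSMinimizer_coeffPolys_iff (hT : ∀ t, MemLp (fun x => T x t ω) 2 surf) (N : ℕ)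
    (c : Fin (L + 1) → Fin p → ℝ) : IsLSMinimizer T L N ω (coeffPolys c) ↔
      ∀ d : Fin (L + 1) → Fin p → ℝ, totalRss T N ω c ≤ totalRss T N ω d := by
  obtain ⟨K, hK⟩ := exists_lsCriterion_eq (L := L) (p := p) hT N
  constructor
  · intro h d
    have := h.2 (coeffPolys d) fun j => coeffPoly_mem _
    rw [hK, hK] at this
    linarith
  · refine fun h => ⟨fun j => coeffPoly_mem _, fun κ hκ => ?_⟩
    obtain ⟨d, rfl⟩ := exists_coeffPolys_eq hκ
    rw [hK, hK]
    linarith [h d]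

/-- The solution of the normal equations of all degrees up to `L`. -/
def lsCoeff (p L : ℕ) (T : S2 → ℤ → Ω → ℝ) (N : ℕ) (ω : Ω) (l : Fin (L + 1)) : Fin p → ℝ :=
  (gram p T l N ω)⁻¹.mulVec (normalRhs (rows l N) (regressor p T ω l) (response p T ω l))

lemma totalRss_lsCoeff_add {N : ℕ} (hdet : ∀ l : Fin (L + 1), (gram p T l N ω).det ≠ 0)
    (h : Fin (L + 1) → Fin p → ℝ) : totalRss T N ω (lsCoeff p L T N ω + h) =
      totalRss T N ω (lsCoeff p L T N ω) + ∑ l, h l ⬝ᵥ (gram p T l N ω).mulVec (h l) := by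
  simp only [totalRss]
  rw [← Finset.sum_add_distrib]
  refine Finset.sum_congr rfl fun l _ => ?_
  rw [← normalMatrix_regressor]
  refine rss_add_of_normal ?_ _
  rw [lsCoeff, normalMatrix_regressor, Matrix.mulVec_mulVec,
    Matrix.mul_nonsing_inv _ (isUnit_iff_ne_zero.2 (hdet l)), Matrix.one_mulVec]

/-- If all Gram matrices are invertible, the estimator solves the normal equations. -/
lemma kernelEstimator_eq (hT : ∀ t, MemLp (fun x => T x t ω) 2 surf) {N : ℕ}
    (hdet : ∀ l : Fin (L + 1), (gram p T l N ω).det ≠ 0) :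
    kernelEstimator p T L N ω = coeffPolys (lsCoeff p L T N ω) := by
  have hnn : ∀ (l : Fin (L + 1)) (h : Fin p → ℝ), 0 ≤ h ⬝ᵥ (gram p T l N ω).mulVec h := fun l h => by
    rw [← normalMatrix_regressor]; exact dotProduct_normalMatrix_nonneg _ _ _
  have hmin : IsLSMinimizer T L N ω (coeffPolys (lsCoeff p L T N ω)) := by
    rw [isLSMinimizer_coeffPolys_iff hT]
    intro c
    have h := totalRss_lsCoeff_add hdet (c - lsCoeff p L T N ω)
    rw [add_sub_cancel] at h
    rw [h]
    exact le_add_of_nonneg_right (Finset.sum_nonneg fun l _ => hnn l _)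
  have huniq : ∀ κ, IsLSMinimizer T L N ω κ → κ = coeffPolys (lsCoeff p L T N ω) := by
    intro κ hκ
    obtain ⟨c, rfl⟩ := exists_coeffPolys_eq hκ.1
    have h1 := (isLSMinimizer_coeffPolys_iff hT N c).1 hκ (lsCoeff p L T N ω)
    have h := totalRss_lsCoeff_add hdet (c - lsCoeff p L T N ω)
    rw [add_sub_cancel] at h
    have h2 : ∑ l, (c - lsCoeff p L T N ω) l ⬝ᵥ
        (gram p T l N ω).mulVec ((c - lsCoeff p L T N ω) l) = 0 :=
      le_antisymm (by linarith) (Finset.sum_nonneg fun l _ => hnn l _)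
    rw [Finset.sum_eq_zero_iff_of_nonneg fun l _ => hnn l _] at h2
    congr 1
    rw [← sub_eq_zero]
    ext1 l
    have h3 := h2 l (Finset.mem_univ _)
    rw [← normalMatrix_regressor] at h3
    exact eq_zero_of_dotProduct_normalMatrix (by rw [normalMatrix_regressor]; exact hdet l) h3
  have hex : ∃! κ : Fin p → ℝ[X], IsLSMinimizer T L N ω κ := ⟨_, hmin, huniq⟩
  rw [kernelEstimator, dif_pos hex]
  exact huniq _ hex.choose_spec.1

/-- If some Gram matrix is singular, the least squares minimizer is not unique. -/
lemma kernelEstimator_eq_zero (hT : ∀ t, MemLp (fun x => T x t ω) 2 surf) {N : ℕ}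
    (hdet : ∃ l : Fin (L + 1), (gram p T l N ω).det = 0) : kernelEstimator p T L N ω = 0 := by
  rw [kernelEstimator, dif_neg]
  rintro ⟨κ, hκ, huniq⟩
  obtain ⟨l, hl⟩ := hdet
  obtain ⟨c, rfl⟩ := exists_coeffPolys_eq hκ.1
  rw [← normalMatrix_regressor] at hl
  -- A shift in the singular degree alone turns any minimizer into a different one.
  obtain ⟨h, hne, hh⟩ := exists_rss_add_eq (y := response p T ω l) hl
  have h1 : totalRss T N ω (c + Pi.single l h) = totalRss T N ω c := by
    simp only [totalRss]
    refine Finset.sum_congr rfl fun l' _ => ?_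
    by_cases hll : l' = l
    · subst hll
      rw [Pi.add_apply, Pi.single_eq_same, hh]
    · rw [Pi.add_apply, Pi.single_eq_of_ne hll, add_zero]
  have h2 : IsLSMinimizer T L N ω (coeffPolys (c + Pi.single l h)) := by
    rw [isLSMinimizer_coeffPolys_iff hT, h1]
    exact (isLSMinimizer_coeffPolys_iff hT N c).1 hκ
  have h3 := coeffPolys_injective (huniq _ h2)
  have h4 : Pi.single l h = (0 : Fin (L + 1) → Fin p → ℝ) := by simpa using h3
  exact hne (by simpa using congrFun h4 l)

end Criterion

/-! ### Asymptotic normality of the estimator -/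

section Asymptotics

variable {Ω : Type*} [mΩ : MeasurableSpace Ω] {P : Measure Ω}
  {p L : ℕ} {k : Fin p → ℝ → ℝ} {T Z : S2 → ℤ → Ω → ℝ} {Γ₀ : ℝ → ℤ → ℝ} {CZ : ℕ → ℝ}

/-- The continuous version of the vector of kernels. -/
def kernelCp (L : ℕ) (k : Fin p → ℝ → ℝ) : Cp p :=
  coeffCp fun (l : Fin (L + 1)) j => legendreCoeff (k j) l

lemma IsSPHAR.ae_kernelCp_eq (hAR : IsSPHAR P p k T Z)
    (hfinite : ∀ j l, L < l → legendreCoeff (k j) l = 0) (j : Fin p) :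
    ∀ᵐ z : ℝ, ∀ hz : z ∈ Icc (-1 : ℝ) 1, kernelCp L k ⟨z, hz⟩ j = k j z := by
  filter_upwards [ae_eq_kernelPoly (hAR.kernel_memLp j) (hfinite j)] with z h hz
  rw [h hz, kernelCp, coeffCp_apply, kernelPoly, Polynomial.eval_finsetSum, Finset.sum_range]
  exact Finset.sum_congr rfl fun l _ => by simp

variable [IsProbabilityMeasure P]

/-- Substituting the scalar autoregression for the responses splits the right hand side of the
normal equations into the Gram matrix times the true coefficients plus the score. One null set
serves all `N` and `l`. -/
lemma IsSPHAR.ae_lsCoeff_eq (hAR : IsSPHAR P p k T Z)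
    (hT : IsGaussianIsotropicStationary P T Γ₀) (hZ : IsSphericalWhiteNoise P Z CZ)
    (hfinite : ∀ j l, L < l → legendreCoeff (k j) l = 0) :
    ∀ᵐ ω ∂P, ∀ (N : ℕ) (l : Fin (L + 1)), (gram p T l N ω).det ≠ 0 →
      lsCoeff p L T N ω l = (fun j => legendreCoeff (k j) l) +
        (gram p T l N ω)⁻¹.mulVec (score p T Z l N ω) := by
  have h : ∀ᵐ ω ∂P, ∀ (l : ℕ) (m : Fin (2 * l + 1)) (t : ℤ), harmCoeff T l m t ω =
      ∑ j : Fin p, legendreCoeff (k j) l * harmCoeff T l m (t - ((j : ℤ) + 1)) ω +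
        harmCoeff Z l m t ω :=
    ae_all_iff.2 fun l => ae_all_iff.2 fun m => ae_all_iff.2 fun t =>
      hAR.ae_coeff_eq hT hZ hfinite t (harmonic_mem l m)
  filter_upwards [h] with ω hω N l hdet
  have h1 : normalRhs (rows l N) (regressor p T ω l) (response p T ω l) =
      (gram p T l N ω).mulVec (fun j => legendreCoeff (k j) l) + score p T Z l N ω := by
    ext i
    have h2 : ∀ r ∈ rows l N, regressor p T ω l r i * response p T ω l r =
        ∑ j, regressor p T ω l r i * regressor p T ω l r j * legendreCoeff (k j) l +
          harmCoeff T l r.2 (r.1 + (p - (i : ℤ))) ω * harmCoeff Z l r.2 (r.1 + (p + 1)) ω := by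
      intro r _
      simp only [response, regressor]
      rw [hω l r.2 (r.1 + (p + 1)), mul_add, Finset.mul_sum]
      congr 1
      refine Finset.sum_congr rfl fun j _ => ?_
      rw [show (r.1 : ℤ) + (p + 1) - ((j : ℤ) + 1) = r.1 + (p - (j : ℤ)) by ring]
      ring
    rw [normalRhs, Finset.sum_congr rfl h2, Finset.sum_add_distrib, Pi.add_apply]
    congr 1
    · rw [Finset.sum_comm, Matrix.mulVec, dotProduct]
      refine Finset.sum_congr rfl fun j _ => ?_
      rw [← Finset.sum_mul, ← normalMatrix_regressor]
      rfl
    · rw [score, rows, Finset.sum_product]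
  rw [lsCoeff, h1, Matrix.mulVec_add, Matrix.mulVec_mulVec,
    Matrix.nonsing_inv_mul _ (isUnit_iff_ne_zero.2 hdet), Matrix.one_mulVec]

lemma IsGaussianIsotropicStationary.ae_memLp (hT : IsGaussianIsotropicStationary P T Γ₀) :
    ∀ᵐ ω ∂P, ∀ t, MemLp (fun x => T x t ω) 2 surf :=
  ae_all_iff.2 fun t => (hT.isSecondOrder t).ae_memLp

lemma coeffCp_eq_toCp (c : Fin (L + 1) → Fin p → ℝ) : coeffCp c = toCp (coeffPolys c) := rfl

lemma measurable_lsCoeff (hT : Measurable fun q : Ω × S2 × ℤ => T q.2.1 q.2.2 q.1) (N : ℕ) :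
    Measurable (lsCoeff p L T N) := by
  refine measurable_pi_lambda _ fun l => measurable_pi_lambda _ fun i => ?_
  simp only [lsCoeff, Matrix.mulVec, dotProduct]
  refine Finset.measurable_sum _ fun j _ => Measurable.mul ?_ ?_
  · have h : Measurable fun ω => invEntries (fun i j => gram p T l N ω i j) :=
      measurable_invEntries.comp (measurable_pi_lambda _ fun i => measurable_pi_lambda _ fun j =>
        measurable_gram hT p l N i j)
    exact (measurable_pi_apply j).comp ((measurable_pi_apply i).comp h)
  · simp only [normalRhs, regressor, response]
    exact Finset.measurable_sum _ fun r _ =>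
      (measurable_harmCoeff hT _ _ _).mul (measurable_harmCoeff hT _ _ _)

lemma measurableSet_det_gram (hT : Measurable fun q : Ω × S2 × ℤ => T q.2.1 q.2.2 q.1) (N : ℕ) :
    MeasurableSet {ω | ∃ l : Fin (L + 1), (gram p T l N ω).det = 0} := by
  rw [ofPred_exists]
  refine MeasurableSet.iUnion fun l => ?_
  have h : Measurable fun ω => (gram p T l N ω).det := by
    simp only [Matrix.det_apply]
    exact Finset.measurable_sum _ fun σ _ => Measurable.const_smul
      (Finset.measurable_prod _ fun i _ => measurable_gram hT p l N _ _) _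
  exact h (measurableSet_singleton 0)

/-- The estimator is defined by choice, so measurability is read off the explicit formula: the
normal equations when all Gram matrices are invertible, and 0 otherwise. The two agree for all `ω`
whose field is square integrable at every time. -/
lemma IsGaussianIsotropicStationary.aemeasurable_toCp_kernelEstimator
    (hT : IsGaussianIsotropicStationary P T Γ₀) (N : ℕ) :
    AEMeasurable (fun ω => toCp (kernelEstimator p T L N ω)) P := by
  classical
  refine ⟨fun ω => if ω ∈ {ω | ∃ l : Fin (L + 1), (gram p T l N ω).det = 0} then toCp 0 else
    coeffCp (lsCoeff p L T N ω), ?_, ?_⟩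
  · exact Measurable.ite (measurableSet_det_gram hT.measurable N) measurable_const
      (continuous_coeffCp.measurable.comp (measurable_lsCoeff hT.measurable N))
  · filter_upwards [hT.ae_memLp] with ω hω
    by_cases h : ∃ l : Fin (L + 1), (gram p T l N ω).det = 0
    · rw [if_pos h, kernelEstimator_eq_zero hω h]
    · rw [if_neg h, kernelEstimator_eq hω (by push Not at h; exact h), coeffCp_eq_toCp]

/-- The normalized estimation error on the event that the Gram matrices are invertible. -/
lemma IsSPHAR.ae_smul_sub_eq (hAR : IsSPHAR P p k T Z)
    (hT : IsGaussianIsotropicStationary P T Γ₀) (hZ : IsSphericalWhiteNoise P Z CZ)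
    (hfinite : ∀ j l, L < l → legendreCoeff (k j) l = 0) :
    ∀ᵐ ω ∂P, ∀ N : ℕ, N ≠ 0 → (∀ l : Fin (L + 1), (gram p T l N ω).det ≠ 0) →
      √(N : ℝ) • (toCp (kernelEstimator p T L N ω) - kernelCp L k) =
        errorCp p L (normScore p L T Z N ω, invGram p L T N ω) := by
  filter_upwards [hT.ae_memLp, hAR.ae_lsCoeff_eq hT hZ hfinite] with ω h1 h2 N hN hdet
  have hN' : (0 : ℝ) < N := by positivity
  rw [kernelEstimator_eq h1 hdet, ← coeffCp_eq_toCp, kernelCp, errorCp]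
  refine Eq.trans (b := coeffCpₗ p L (√(N : ℝ) • (lsCoeff p L T N ω -
    fun (l : Fin (L + 1)) j => legendreCoeff (k j) l))) ?_ ?_
  · rw [map_smul, map_sub]; rfl
  · change coeffCp _ = coeffCp _
    congr 1
    ext l i
    rw [Pi.smul_apply, Pi.sub_apply, h2 N l (hdet l), add_sub_cancel_left, Pi.smul_apply,
      smul_eq_mul, Matrix.mulVec, dotProduct, Finset.mul_sum]
    refine Finset.sum_congr rfl fun j _ => ?_
    have h3 : (Matrix.of fun i j : Fin p => (N : ℝ)⁻¹ * gram p T l N ω i j) =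
        (N : ℝ)⁻¹ • gram p T l N ω := by ext i j; simp
    have h4 : ((N : ℝ)⁻¹ • gram p T l N ω)⁻¹ = (N : ℝ) • (gram p T l N ω)⁻¹ := by
      refine Matrix.inv_eq_right_inv ?_
      rw [Matrix.smul_mul, Matrix.mul_smul, smul_smul, inv_mul_cancel₀ hN'.ne', one_smul,
        Matrix.mul_nonsing_inv _ (isUnit_iff_ne_zero.2 (hdet l))]
    simp only [invGram, invEntries, normScore, h3, h4, Matrix.smul_apply, smul_eq_mul]
    -- The factor `N` comes from inverting `N⁻¹` times the Gram matrix, the factor `N^{-1/2}` from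
    -- the normalized scores.
    have h5 : (N : ℝ) * (√(N : ℝ))⁻¹ = √(N : ℝ) := by
      rw [← div_eq_mul_inv, Real.div_sqrt]
    calc _ = (N : ℝ) * (√(N : ℝ))⁻¹ * ((gram p T l N ω)⁻¹ i j * score p T Z l N ω j) := by rw [h5]
      _ = _ := by ring

/-- The least squares estimator is asymptotically normal. -/
theorem IsSPHAR.tendstoInDistribution_kernelEstimator (hAR : IsSPHAR P p k T Z)
    (hT : IsGaussianIsotropicStationary P T Γ₀) (hZ : IsSphericalWhiteNoise P Z CZ)
    (hstat : StationarityCondition k) (hident : ∀ l, 0 < CZ l)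
    (hfinite : ∀ j l, L < l → legendreCoeff (k j) l = 0) :
    TendstoInDistribution (fun (N : ℕ) ω =>
        √(N : ℝ) • (toCp (kernelEstimator p T L N ω) - kernelCp L k)) atTop id (fun _ => P)
      (limitLaw p L CZ Γ₀ : Measure (Cp p)) := by
  have hY : ∀ N : ℕ, AEMeasurable (fun ω =>
      √(N : ℝ) • (toCp (kernelEstimator p T L N ω) - kernelCp L k)) P := fun N =>
    (((continuous_id.sub continuous_const).const_smul (√(N : ℝ))).measurable.comp_aemeasurable
      (hT.aemeasurable_toCp_kernelEstimator N))
  -- For `N ≠ 0` the error differs from `errorCp`, up to a null set, only where some Gram matrix is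
  -- singular, an event of vanishing probability.
  have h := tendstoInDistribution_of_tendstoInMeasure_sub
    (fun (N : ℕ) ω => √(N : ℝ) • (toCp (kernelEstimator p T L N ω) - kernelCp L k)) _
    (hAR.tendstoInDistribution_errorCp hT hZ hstat hident hfinite) (by
      rw [tendstoInMeasure_iff_norm]
      intro ε hε
      refine tendsto_of_tendsto_of_tendsto_of_le_of_le' tendsto_const_nhds
        (hAR.tendsto_measure_det_gram hT hZ hstat hident hfinite)
        (Eventually.of_forall fun _ => zero_le) ?_
      filter_upwards [eventually_ne_atTop 0] with N hN
      refine measure_mono_ae ?_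
      filter_upwards [hAR.ae_smul_sub_eq hT hZ hfinite] with ω hω h1
      by_contra hdet
      have hdet' : ∀ l : Fin (L + 1), (gram p T l N ω).det ≠ 0 := fun l hl => hdet ⟨l, hl⟩
      have h2 : ε ≤ ‖√(N : ℝ) • (toCp (kernelEstimator p T L N ω) - kernelCp L k) -
        errorCp p L (normScore p L T Z N ω, invGram p L T N ω) - 0‖ := h1
      rw [hω N hN hdet', sub_self, sub_zero, norm_zero] at h2
      exact absurd h2 (not_le.2 hε)) hY
  refine ⟨hY, aemeasurable_id, ?_⟩
  convert h.tendsto using 2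
  exact congrArg 𝓝 (Subtype.ext Measure.map_id)

end Asymptotics

end SPHAR

end

theorem theorem3 {Ω : Type*} [MeasurableSpace Ω] (P : Measure Ω) [IsProbabilityMeasure P]
    (p L : ℕ) (k : Fin p → ℝ → ℝ) (T Z : SPHAR.S2 → ℤ → Ω → ℝ)
    (Γ₀ : ℝ → ℤ → ℝ) (CZ : ℕ → ℝ)
    (hT : SPHAR.IsGaussianIsotropicStationary P T Γ₀)
    (hZ : SPHAR.IsSphericalWhiteNoise P Z CZ)
    (hAR : SPHAR.IsSPHAR P p k T Z)
    (hstat : SPHAR.StationarityCondition k)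
    (hident : ∀ l, 0 < CZ l)
    (hfinite : ∀ j l, L < l → SPHAR.legendreCoeff (k j) l = 0) :
    ∃ kc : SPHAR.Cp p, 
      (∀ j, ∀ᵐ z : ℝ, ∀ hz : z ∈ Icc (-1 : ℝ) 1, kc ⟨z, hz⟩ j = k j z) ∧
      ∃ W : ProbabilityMeasure (SPHAR.Cp p),
        SPHAR.IsCenteredGaussianLaw W (SPHAR.limitCov p L CZ Γ₀) ∧
        TendstoInDistribution
          (fun (N : ℕ) (ω : Ω) =>
            Real.sqrt N • (SPHAR.toCp (SPHAR.kernelEstimator p T L N ω) - kc))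
          atTop id (fun _ => P) (W : Measure (SPHAR.Cp p)) := by
  exact ⟨SPHAR.kernelCp L k, hAR.ae_kernelCp_eq hfinite, SPHAR.limitLaw p L CZ Γ₀,
    hAR.isCenteredGaussianLaw_limitLaw hT hZ hstat hident hfinite,
    hAR.tendstoInDistribution_kernelEstimator hT hZ hstat hident hfinite⟩
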